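/- **Theorem 5.1.** Let $q,r$ be complex-valued functions in the Schwartz class $\mathcal S(\mathbb R)$, and consider the linear system $$\frac{d}{dx}\begin{bmatrix}\alpha\\ \beta\end{bmatrix}=\begin{bmatrix}-i\zeta^2-\frac i2 q(x)r(x)&\zeta q(x)\\ \zeta r(x)& i\zeta^2+\frac i2 q(x)r(x)\end{bmatrix}\begin{bmatrix}\alpha\\ \beta\end{bmatrix},\qquad x\in\mathbb R,\tag{1}$$ with spectral parameter $\zeta\in\mathbb C$; put $\lambda=\zeta^2$, $\zeta=\sqrt\lambda$ (principal branch). An overbar does not denote complex conjugation. The Jost solutions $\psi,\bar\psi,\phi,\bar\phi$ of (1) (components indexed by $1,2$) are the solutions with $$\psi=\begin{bmatrix}o(1)\\ e^{i\lambda x}[1+o(1)]\end{bmatrix},\quad \bar\psi=\begin{bmatrix}e^{-i\lambda x}[1+o(1)]\\ o(1)\end{bmatrix}\quad(x\to+\infty),$$ $$\phi=\begin{bmatrix}e^{-i\lambda x}[1+o(1)]\\ o(1)\end{bmatrix},\quad \bar\phi=\begin{bmatrix}o(1)\\ e^{i\lambda x}[1+o(1)]\end{bmatrix}\quad(x\to-\infty).$$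 For $\lambda\in\mathbb R$ the coefficients $T,\bar T,R,\bar R$ are defined by the limits, as $x\to+\infty$, $$\frac1{T(\zeta)}=\lim e^{i\lambda x}\phi_1,\quad \frac{R(\zeta)}{T(\zeta)}=\lim e^{-i\lambda x}\phi_2,\quad \frac1{\bar T(\zeta)}=\lim e^{-i\lambda x}\bar\phi_2,\quad \frac{\bar R(\zeta)}{\bar T(\zeta)}=\lim e^{i\lambda x}\bar\phi_1 .$$ Suppose that (1) has no bound states, i.e. for no $\zeta\in\mathbb C$ does (1) have a nontrivial square-integrable solution, and that $T$ and $\bar T$ have no poles on the real $\lambda$-axis, i.e. $1/T(\sqrt\lambda)\neq0$ and $1/\bar T(\sqrt\lambda)\ne0$ for all $\lambda\in\mathbb R$. Then, for each $\lambda\in\mathbb R$, the four Jost solutions at $\zeta=\sqrt\lambda$ exist and are unique and the four limits above exist. The functions $R(\zeta)/\zeta$ and $\bar R(\zeta)/\zeta$ are integrable in $\lambda\in\mathbb R$, and $$\hat R(y):=\frac1{2\pi}\int_{-\infty}^\infty d\lambda\,\frac{R(\zeta)}{\zeta}\,e^{i\lambda y},\qquad \hat{\bar R}(y):=\frac1{2\pi}\int_{-\infty}^\infty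 d\lambda\,\frac{\bar R(\zeta)}{\zeta}\,e^{-i\lambda y}$$ are differentiable on $\mathbb R$, with derivatives $\hat R'$ and $\hat{\bar R}'$. For all real $x<y$ the integrals $$K_1(x,y):=\frac1{2\pi}\int_{-\infty}^\infty d\lambda\,\frac{\psi_1(\zeta,x)}{\zeta}\,e^{-i\lambda y},\qquad K_2(x,y):=\frac1{2\pi}\int_{-\infty}^\infty d\lambda\,\bigl[\psi_2(\zeta,x)-e^{i\lambda x}\bigr]e^{-i\lambda y},$$ $$\bar K_1(x,y):=\frac1{2\pi}\int_{-\infty}^\infty d\lambda\,\bigl[\bar\psi_1(\zeta,x)-e^{-i\lambda x}\bigr]e^{i\lambda y},\qquad \bar K_2(x,y):=\frac1{2\pi}\int_{-\infty}^\infty d\lambda\,\frac{\bar\psi_2(\zeta,x)}{\zeta}\,e^{i\lambda y}$$ converge as improper integrals (locally integrable integrand, limit of $\int_a^b$ as $a\to-\infty$ and $b\to+\infty$ independently), the integrals over $z$ below converge absolutely, and the Marchenko system holds: $$\begin{bmatrix}0&0\\0&0\end{bmatrix}=\begin{bmatrix}\bar K_1(x,y)&K_1(x,y)\\ \bar K_2(x,y)&K_2(x,y)\end{bmatrix}+\begin{bmatrix}0&\hat{\bar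 R}(x+y)\\ \hat R(x+y)&0\end{bmatrix}+\int_x^\infty dz\begin{bmatrix}-i\,K_1(x,z)\,\hat R'(z+y)&\bar K_1(x,z)\,\hat{\bar R}(z+y)\\ K_2(x,z)\,\hat R(z+y)&i\,\bar K_2(x,z)\,\hat{\bar R}'(z+y)\end{bmatrix},\qquad x<y.$$ -/

import Mathlib

open Complex Filter Topology MeasureTheory
open scoped SchwartzMap

noncomputable section

namespace DNLS

/-- The coefficient matrix of the linear system with energy-dependent potentials `q`, `r`. -/
def coeffMatrix (q r : ℝ → ℂ) (ζ : ℂ) (x : ℝ) : Matrix (Fin 2) (Fin 2) ℂ :=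
  !![-I * ζ ^ 2 - I / 2 * (q x * r x), ζ * q x;
     ζ * r x, I * ζ ^ 2 + I / 2 * (q x * r x)]

/-- `w` is a column-vector solution on the whole line at the spectral parameter `ζ`. -/
def IsSolution (q r : ℝ → ℂ) (ζ : ℂ) (w : ℝ → Fin 2 → ℂ) : Prop :=
  ∀ x : ℝ, HasDerivAt w ((coeffMatrix q r ζ x).mulVec (w x)) x

/-- There are no bound states: at no complex `ζ` is there a nontrivial square-integrable
solution. -/
def NoBoundStates (q r : ℝ → ℂ) : Prop :=
  ∀ (ζ : ℂ) (w : ℝ → Fin 2 → ℂ), IsSolution q r ζ w → MemLp w 2 volume → w = 0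

/-! ### Jost solutions

The overbar of the source is written `Bar`; it is not complex conjugation. -/

/-- `w = (o(1), e^{iζ²x}[1 + o(1)])` as `x → +∞`. -/
def IsJostPsi (q r : ℝ → ℂ) (ζ : ℂ) (w : ℝ → Fin 2 → ℂ) : Prop :=
  IsSolution q r ζ w ∧ Tendsto (fun x => w x 0) atTop (𝓝 0) ∧
    Tendsto (fun x : ℝ => exp (-I * ζ ^ 2 * x) * w x 1) atTop (𝓝 1)

/-- `w = (e^{-iζ²x}[1 + o(1)], o(1))` as `x → +∞`. -/
def IsJostPsiBar (q r : ℝ → ℂ) (ζ : ℂ) (w : ℝ → Fin 2 → ℂ) : Prop :=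
  IsSolution q r ζ w ∧ Tendsto (fun x : ℝ => exp (I * ζ ^ 2 * x) * w x 0) atTop (𝓝 1) ∧
    Tendsto (fun x => w x 1) atTop (𝓝 0)

/-- `w = (e^{-iζ²x}[1 + o(1)], o(1))` as `x → -∞`. -/
def IsJostPhi (q r : ℝ → ℂ) (ζ : ℂ) (w : ℝ → Fin 2 → ℂ) : Prop :=
  IsSolution q r ζ w ∧ Tendsto (fun x : ℝ => exp (I * ζ ^ 2 * x) * w x 0) atBot (𝓝 1) ∧
    Tendsto (fun x => w x 1) atBot (𝓝 0)

/-- `w = (o(1), e^{iζ²x}[1 + o(1)])` as `x → -∞`. -/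
def IsJostPhiBar (q r : ℝ → ℂ) (ζ : ℂ) (w : ℝ → Fin 2 → ℂ) : Prop :=
  IsSolution q r ζ w ∧ Tendsto (fun x => w x 0) atBot (𝓝 0) ∧
    Tendsto (fun x : ℝ => exp (-I * ζ ^ 2 * x) * w x 1) atBot (𝓝 1)

/-- The Jost solution `ψ(ζ, ·)`. -/
def psi (q r : ℝ → ℂ) (ζ : ℂ) : ℝ → Fin 2 → ℂ := Classical.epsilon (IsJostPsi q r ζ)

/-- The Jost solution `ψ̄(ζ, ·)`. -/
def psiBar (q r : ℝ → ℂ) (ζ : ℂ) : ℝ → Fin 2 → ℂ := Classical.epsilon (IsJostPsiBar q r ζ)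

/-- The Jost solution `φ(ζ, ·)`. -/
def phi (q r : ℝ → ℂ) (ζ : ℂ) : ℝ → Fin 2 → ℂ := Classical.epsilon (IsJostPhi q r ζ)

/-- The Jost solution `φ̄(ζ, ·)`. -/
def phiBar (q r : ℝ → ℂ) (ζ : ℂ) : ℝ → Fin 2 → ℂ := Classical.epsilon (IsJostPhiBar q r ζ)

/-! ### Scattering coefficients, read off from `φ` and `φ̄` as `x → +∞` -/

/-- `1 / T(ζ)`: the amplitude of `e^{-iζ²x}` in the first component of `φ` as `x → +∞`. -/
def invT (q r : ℝ → ℂ) (ζ : ℂ) : ℂ :=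
  limUnder atTop fun x : ℝ => exp (I * ζ ^ 2 * x) * phi q r ζ x 0

/-- `R(ζ) / T(ζ)`: the amplitude of `e^{iζ²x}` in the second component of `φ` as `x → +∞`. -/
def RdivT (q r : ℝ → ℂ) (ζ : ℂ) : ℂ :=
  limUnder atTop fun x : ℝ => exp (-I * ζ ^ 2 * x) * phi q r ζ x 1

/-- `1 / T̄(ζ)`: the amplitude of `e^{iζ²x}` in the second component of `φ̄` as `x → +∞`. -/
def invTBar (q r : ℝ → ℂ) (ζ : ℂ) : ℂ :=
  limUnder atTop fun x : ℝ => exp (-I * ζ ^ 2 * x) * phiBar q r ζ x 1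

/-- `R̄(ζ) / T̄(ζ)`: the amplitude of `e^{-iζ²x}` in the first component of `φ̄` as `x → +∞`. -/
def RBarDivTBar (q r : ℝ → ℂ) (ζ : ℂ) : ℂ :=
  limUnder atTop fun x : ℝ => exp (I * ζ ^ 2 * x) * phiBar q r ζ x 0

/-- The right reflection coefficient `R(ζ)`. -/
def R (q r : ℝ → ℂ) (ζ : ℂ) : ℂ := RdivT q r ζ / invT q r ζ

/-- The right reflection coefficient `R̄(ζ)`. -/
def RBar (q r : ℝ → ℂ) (ζ : ℂ) : ℂ := RBarDivTBar q r ζ / invTBar q r ζ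

/-- `ζ = √λ` for real `λ`, with the principal branch. -/
def zeta (l : ℝ) : ℂ := Complex.sqrt (l : ℂ)

/-- The transmission coefficients `T` and `T̄` have no poles on the real `λ`-axis. -/
def NoRealPoles (q r : ℝ → ℂ) : Prop :=
  ∀ l : ℝ, invT q r (zeta l) ≠ 0 ∧ invTBar q r (zeta l) ≠ 0

/-- At `ζ` the four Jost solutions exist and are unique, and the amplitudes of `φ` and `φ̄` at
`+∞` exist. -/
def ScatteringWellDefined (q r : ℝ → ℂ) (ζ : ℂ) : Prop :=
  (∃! w, IsJostPsi q r ζ w) ∧ (∃! w, IsJostPsiBar q r ζ w) ∧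
  (∃! w, IsJostPhi q r ζ w) ∧ (∃! w, IsJostPhiBar q r ζ w) ∧
  Tendsto (fun x : ℝ => exp (I * ζ ^ 2 * x) * phi q r ζ x 0) atTop (𝓝 (invT q r ζ)) ∧
  Tendsto (fun x : ℝ => exp (-I * ζ ^ 2 * x) * phi q r ζ x 1) atTop (𝓝 (RdivT q r ζ)) ∧
  Tendsto (fun x : ℝ => exp (-I * ζ ^ 2 * x) * phiBar q r ζ x 1) atTop (𝓝 (invTBar q r ζ)) ∧
  Tendsto (fun x : ℝ => exp (I * ζ ^ 2 * x) * phiBar q r ζ x 0) atTop (𝓝 (RBarDivTBar q r ζ))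

/-! ### Fourier transforms -/

/-- `R̂(y) = (1/2π) ∫ (R(ζ)/ζ) e^{iλy} dλ`. -/
def RHat (q r : ℝ → ℂ) (y : ℝ) : ℂ :=
  1 / (2 * Real.pi) * ∫ l : ℝ, R q r (zeta l) / zeta l * exp (I * l * y)

/-- The Fourier transform of `R̄(ζ)/ζ`, `(1/2π) ∫ (R̄(ζ)/ζ) e^{-iλy} dλ`. -/
def RBarHat (q r : ℝ → ℂ) (y : ℝ) : ℂ :=
  1 / (2 * Real.pi) * ∫ l : ℝ, RBar q r (zeta l) / zeta l * exp (-I * l * y)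

/-- `f` is locally integrable and `∫_a^b f` tends to `c` as `a → -∞` and `b → +∞` independently. -/
def HasImproperIntegral (f : ℝ → ℂ) (c : ℂ) : Prop :=
  LocallyIntegrable f volume ∧
    Tendsto (fun p : ℝ × ℝ => ∫ t in p.1..p.2, f t) (atBot ×ˢ atTop) (𝓝 c)

/-- The value of the improper integral `∫_{-∞}^{∞} f`. -/
def improperIntegral (f : ℝ → ℂ) : ℂ :=
  limUnder (atBot ×ˢ atTop) fun p : ℝ × ℝ => ∫ t in p.1..p.2, f t

/-- `[ψ₁(ζ,x)/ζ] e^{-iλy}` as a function of `λ`. -/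
def integrandK1 (q r : ℝ → ℂ) (x y l : ℝ) : ℂ :=
  psi q r (zeta l) x 0 / zeta l * exp (-I * l * y)

/-- `[ψ₂(ζ,x) - e^{iλx}] e^{-iλy}` as a function of `λ`. -/
def integrandK2 (q r : ℝ → ℂ) (x y l : ℝ) : ℂ :=
  (psi q r (zeta l) x 1 - exp (I * l * x)) * exp (-I * l * y)

/-- `[ψ̄₁(ζ,x) - e^{-iλx}] e^{iλy}` as a function of `λ`. -/
def integrandK1Bar (q r : ℝ → ℂ) (x y l : ℝ) : ℂ :=
  (psiBar q r (zeta l) x 0 - exp (-I * l * x)) * exp (I * l * y)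

/-- `[ψ̄₂(ζ,x)/ζ] e^{iλy}` as a function of `λ`. -/
def integrandK2Bar (q r : ℝ → ℂ) (x y l : ℝ) : ℂ :=
  psiBar q r (zeta l) x 1 / zeta l * exp (I * l * y)

/-- `K₁(x,y) = (1/2π) ∫ [ψ₁(ζ,x)/ζ] e^{-iλy} dλ`, as an improper integral. -/
def K1 (q r : ℝ → ℂ) (x y : ℝ) : ℂ :=
  1 / (2 * Real.pi) * improperIntegral (integrandK1 q r x y)

/-- `K₂(x,y) = (1/2π) ∫ [ψ₂(ζ,x) - e^{iλx}] e^{-iλy} dλ`, as an improper integral. -/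
def K2 (q r : ℝ → ℂ) (x y : ℝ) : ℂ :=
  1 / (2 * Real.pi) * improperIntegral (integrandK2 q r x y)

/-- `K̄₁(x,y) = (1/2π) ∫ [ψ̄₁(ζ,x) - e^{-iλx}] e^{iλy} dλ`, as an improper integral. -/
def K1Bar (q r : ℝ → ℂ) (x y : ℝ) : ℂ :=
  1 / (2 * Real.pi) * improperIntegral (integrandK1Bar q r x y)

/-- `K̄₂(x,y) = (1/2π) ∫ [ψ̄₂(ζ,x)/ζ] e^{iλy} dλ`, as an improper integral. -/
def K2Bar (q r : ℝ → ℂ) (x y : ℝ) : ℂ :=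
  1 / (2 * Real.pi) * improperIntegral (integrandK2Bar q r x y)

end DNLS

end

open Complex Filter Topology MeasureTheory
open scoped SchwartzMap BoundedContinuousFunction

noncomputable section

namespace DNLS

/-! Write `ψ = e^{iλx}(ζA, B)` with `λ = ζ²` and put `D = λA + (i/2)qB`. Then `B' = rD` and `D' =
-2iλD + sB` with `s = (i/2)q' - q²r/4`, a system in which the spectral parameter no longer
multiplies the potentials. Volterra equations for kernels (`exists_jost_kernel`) give `B = 1 + ∫₀^∞
b(x,t)e^{iλt}dt` and `D = ∫₀^∞ d(x,t)e^{iλt}dt` in the closed upper half-plane. At `λ = 0` one has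
`D = (i/2)qB` (`jostD_zero`), so `D - (i/2)qB` can be divided by `λ` and `A = ψ₁e^{-iλx}/ζ` is again
a half-line Fourier transform (`mul_jostA`). By Fourier inversion the kernels of `A` and `B` at `t =
y - x` are `K₁` and `K₂`. The integrands decay only like `1/λ`, hence the improper integrals.

The other Jost solutions come from `ψ` by symmetry. Interchanging the components replaces `(q, r,
ζ)` by `(-ir, -iq, iζ)`, hence `λ` by `-λ`, and produces the barred solutions; combining the
interchange with `x ↦ -x` produces `φ`.

Wronskians give `φ = aψ̄ + ζbψ` for real `λ`, with `a = 1/T` and `ζb = R/T` (`jost_relation`). A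
zero of `a` in the open upper half-plane would make `φ` and `ψ` proportional and so produce a bound
state (`aCoef_ne_zero`); zeros on the real axis are excluded by hypothesis. As `a → 1` at infinity,
`1/a` is bounded; as `b = O(λ⁻³)`, both `R/ζ` and `λR/ζ` are integrable, so the Fourier transform of
`R/ζ` is differentiable.

Divide the relation by `a`, multiply by `e^{iλτ}` with `τ = y - x > 0` and integrate over `λ`. The
side `φ/a` is analytic in the upper half-plane and, after subtraction of its limit, `O(1/λ)`, so it
contributes zero by Jordan's lemma (`hasImproperIntegral_jordan`). The other side is a kernel of
`ψ̄`, the transform of `R/ζ` and a convolution of the two kinds (`marchenko_kernelA`,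
`marchenko_kernelB`). This is the left column of the system; the right column is the same statement
for the interchanged potentials. -/

/-- The weight `(1 + x²)⁻¹`. -/
def wt (x : ℝ) : ℝ := (1 + x ^ 2)⁻¹

lemma wt_pos (x : ℝ) : 0 < wt x := by unfold wt; positivity

lemma wt_le_one (x : ℝ) : wt x ≤ 1 := by
  unfold wt; exact inv_le_one_of_one_le₀ (by nlinarith [sq_nonneg x])

lemma wt_mul (x : ℝ) : wt x * (1 + x ^ 2) = 1 := by unfold wt; field_simp

lemma one_le_one_add_sq (x : ℝ) : 1 ≤ 1 + x ^ 2 := by nlinarith [sq_nonneg x]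

@[fun_prop]
lemma continuous_wt : Continuous wt := by
  unfold wt
  exact Continuous.inv₀ (by fun_prop) fun x => by positivity

lemma integrable_wt : Integrable wt := integrable_inv_one_add_sq

lemma wt_pow_le (x : ℝ) {m n : ℕ} (h : m ≤ n) : wt x ^ n ≤ wt x ^ m :=
  pow_le_pow_of_le_one (wt_pos x).le (wt_le_one x) h

lemma integrable_wt_pow (n : ℕ) : Integrable (fun x => wt x ^ (n + 1)) := by
  refine integrable_wt.mono' (by fun_prop) (Eventually.of_forall fun x => ?_)
  rw [Real.norm_of_nonneg (pow_nonneg (wt_pos x).le _)]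
  simpa using wt_pow_le x (show 1 ≤ n + 1 by omega)

lemma exists_wt_bound (f : 𝓢(ℝ, ℂ)) (k : ℕ) : ∃ C, 0 ≤ C ∧ ∀ x, ‖f x‖ ≤ C * wt x ^ k := by
  have h := fun x => SchwartzMap.one_add_le_sup_seminorm_apply (𝕜 := ℝ) (m := (2 * k, 0)) le_rfl
    le_rfl f x
  simp only [norm_iteratedFDeriv_zero] at h
  refine ⟨_, (h 0).trans' (by positivity), fun x => ?_⟩
  have h1 : (1 + x ^ 2) ^ k * ‖f x‖ ≤ (1 + ‖x‖) ^ (2 * k) * ‖f x‖ := by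
    rw [pow_mul]
    gcongr
    rw [Real.norm_eq_abs]
    nlinarith [abs_nonneg x, sq_abs x]
  have h2 : ‖f x‖ = ((1 + x ^ 2) ^ k * ‖f x‖) * wt x ^ k := by
    have : wt x ^ k * (1 + x ^ 2) ^ k = 1 := by rw [← mul_pow, wt_mul, one_pow]
    linear_combination (-‖f x‖) * this
  rw [h2]
  exact mul_le_mul_of_nonneg_right (h1.trans (h x)) (pow_nonneg (wt_pos x).le _)

/-! ### Volterra operators and coupled Volterra equations. -/

/-- A Volterra-type integral operator on bounded continuous functions on the plane. -/
theorem exists_volterra_operator {S : Set (ℝ × (ℝ × ℝ))} {k : ℝ × (ℝ × ℝ) → ℂ}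
    {Φ : ℝ × (ℝ × ℝ) → ℝ × ℝ} {g : ℝ → ℝ} (hk : Continuous k) (hΦ : Continuous Φ)
    (hS : MeasurableSet S) (hfr : ∀ p, ∀ᵐ v, (v, p) ∉ frontier S) (hg : Integrable g)
    (hkg : ∀ z ∈ S, ‖k z‖ ≤ g z.1)
    (hnorm : ∀ p, ∫ v, S.indicator (fun z => ‖k z‖) (v, p) ≤ 1 / 2) :
    ∃ L : (ℝ × ℝ →ᵇ ℂ) →L[ℂ] (ℝ × ℝ →ᵇ ℂ), ‖L‖ ≤ 1 / 2 ∧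
      ∀ β p, L β p = ∫ v, S.indicator (fun z => k z * β (Φ z)) (v, p) := by
  have hmeas : ∀ {F : Type} [NormedAddCommGroup F] (h : ℝ × (ℝ × ℝ) → F), Continuous h → ∀ p,
      AEStronglyMeasurable (fun v => S.indicator h (v, p)) volume := by
    intro F _ h hh p
    have : (fun v => S.indicator h (v, p)) =
        ((fun v => (v, p)) ⁻¹' S).indicator (fun v => h (v, p)) := by
      ext v; rfl
    rw [this]
    exact AEStronglyMeasurable.indicator
      (Continuous.aestronglyMeasurable (by fun_prop)) (measurable_prodMk_right hS)
  have hbd : ∀ (β : ℝ × ℝ →ᵇ ℂ) p v,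
      ‖S.indicator (fun z => k z * β (Φ z)) (v, p)‖ ≤ S.indicator (fun z => ‖k z‖) (v, p) * ‖β‖ := by
    intro β p v
    by_cases h : (v, p) ∈ S
    · simp only [Set.indicator_of_mem h, norm_mul]
      gcongr
      exact β.norm_coe_le_norm _
    · simp [h]
  have hind : ∀ p v, S.indicator (fun z => ‖k z‖) (v, p) ≤ |g v| := by
    intro p v
    by_cases h : (v, p) ∈ S
    · simp only [Set.indicator_of_mem h]
      exact (hkg _ h).trans (le_abs_self _)
    · simp [h]
  have hind0 : ∀ p, Integrable (fun v => S.indicator (fun z => ‖k z‖) (v, p)) := fun p =>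
    hg.abs.mono' (hmeas _ hk.norm p) (Eventually.of_forall fun v => by
      rw [Real.norm_of_nonneg (Set.indicator_nonneg (fun _ _ => norm_nonneg _) _)]
      exact hind p v)
  have hbd' : ∀ (β : ℝ × ℝ →ᵇ ℂ) p v,
      ‖S.indicator (fun z => k z * β (Φ z)) (v, p)‖ ≤ |g v| * ‖β‖ := fun β p v =>
    (hbd β p v).trans (mul_le_mul_of_nonneg_right (hind p v) (norm_nonneg _))
  have hint : ∀ (β : ℝ × ℝ →ᵇ ℂ) p,
      Integrable (fun v => S.indicator (fun z => k z * β (Φ z)) (v, p)) := fun β p =>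
    (hg.abs.mul_const ‖β‖).mono' (hmeas _ (by fun_prop) p) (Eventually.of_forall (hbd' β p))
  have hcont : ∀ β : ℝ × ℝ →ᵇ ℂ,
      Continuous fun p => ∫ v, S.indicator (fun z => k z * β (Φ z)) (v, p) := by
    intro β
    rw [continuous_iff_continuousAt]
    intro p
    refine continuousAt_of_dominated (Eventually.of_forall fun q => hmeas _ (by fun_prop) q)
      (Eventually.of_forall fun q => Eventually.of_forall (hbd' β q)) (hg.abs.mul_const ‖β‖) ?_
    -- Off the frontier of `S` the indicator is locally constant in `p`, so the integrand is
    -- continuous at `p` for almost every `v`.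
    filter_upwards [hfr p] with v hv
    have hmap : ContinuousAt (fun q : ℝ × ℝ => (v, q)) p := by fun_prop
    by_cases h : (v, p) ∈ S
    · have hint : S ∈ 𝓝 (v, p) := by
        rw [mem_interior_iff_mem_nhds.symm]
        by_contra hc
        exact hv ⟨subset_closure h, hc⟩
      have hc : ContinuousAt (fun q : ℝ × ℝ => k (v, q) * β (Φ (v, q))) p := by fun_prop
      refine hc.congr ?_
      filter_upwards [hmap hint] with q hq
      have hq' : (v, q) ∈ S := hq
      simp [hq']
    · have hint : Sᶜ ∈ 𝓝 (v, p) := by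
        rw [mem_interior_iff_mem_nhds.symm]
        by_contra hc
        rw [← frontier_compl] at hv
        exact hv ⟨subset_closure h, hc⟩
      have hc : ContinuousAt (fun q : ℝ × ℝ => (0 : ℂ)) p := continuousAt_const
      refine hc.congr ?_
      filter_upwards [hmap hint] with q hq
      have hq' : (v, q) ∉ S := hq
      simp [hq']
  have hnb : ∀ (β : ℝ × ℝ →ᵇ ℂ) p,
      ‖∫ v, S.indicator (fun z => k z * β (Φ z)) (v, p)‖ ≤ 1 / 2 * ‖β‖ := by
    intro β p
    refine (norm_integral_le_of_norm_le ((hind0 p).mul_const ‖β‖)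
      (Eventually.of_forall (hbd β p))).trans ?_
    rw [integral_mul_const]
    exact mul_le_mul_of_nonneg_right (hnorm p) (norm_nonneg _)
  let L₀ : (ℝ × ℝ →ᵇ ℂ) →ₗ[ℂ] (ℝ × ℝ →ᵇ ℂ) :=
    { toFun := fun β => BoundedContinuousFunction.ofNormedAddCommGroup
        (fun p => ∫ v, S.indicator (fun z => k z * β (Φ z)) (v, p)) (hcont β) _ (hnb β)
      map_add' := by
        intro β γ
        ext p
        simp only [BoundedContinuousFunction.coe_ofNormedAddCommGroup,
          BoundedContinuousFunction.add_apply]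
        rw [← integral_add (hint β p) (hint γ p)]
        congr 1; ext v
        by_cases h : (v, p) ∈ S <;> simp [h, mul_add]
      map_smul' := by
        intro c β
        ext p
        simp only [BoundedContinuousFunction.coe_ofNormedAddCommGroup,
          BoundedContinuousFunction.coe_smul, RingHom.id_apply, smul_eq_mul]
        rw [← integral_const_mul]
        congr 1; ext v
        by_cases h : (v, p) ∈ S <;> simp [h]; ring }
  refine ⟨L₀.mkContinuous (1 / 2) fun β => ?_, LinearMap.mkContinuous_norm_le _ (by norm_num) _,
    fun β p => rfl⟩
  exact BoundedContinuousFunction.norm_ofNormedAddCommGroup_le _ (by positivity) (hnb β)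

/-- Two coupled Volterra equations with contractive operators are solvable. -/
theorem exists_coupled_solution {E : Type*} [NormedAddCommGroup E] [NormedSpace ℂ E]
    [CompleteSpace E] {P Q : E →L[ℂ] E} (hP : ‖P‖ ≤ 1 / 2) (hQ : ‖Q‖ ≤ 1 / 2) (f : E) :
    ∃ β δ : E, β = -Q δ ∧ δ = f - P β := by
  have h : ‖P.comp Q‖ < 1 := by
    refine (P.opNorm_comp_le Q).trans_lt ?_
    nlinarith [norm_nonneg P, norm_nonneg Q]
  -- Eliminating `β` leaves `(1 - PQ)δ = f`, solved by a Neumann series because `‖PQ‖ ≤ 1/4`.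
  let u := Units.oneSub (P.comp Q) h
  let δ := (↑u⁻¹ : E →L[ℂ] E) f
  have h1 : δ - P (Q δ) = f := by
    have h2 : (u : E →L[ℂ] E) * (↑u⁻¹ : E →L[ℂ] E) = 1 := u.mul_inv
    have h3 := congrArg (fun T : E →L[ℂ] E => T f) h2
    simpa [u, δ] using h3
  refine ⟨-Q δ, δ, rfl, ?_⟩
  rw [map_neg, sub_neg_eq_add, ← h1]
  abel

/-! ### Weights for the kernel equations, and existence of the kernels. -/

/-- A nonincreasing weight: constant on the negative half-line, decaying on the positive one. -/
def rho (z : ℝ) : ℝ := wt (max z 0) ^ 3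

lemma rho_pos (z : ℝ) : 0 < rho z := pow_pos (wt_pos _) 3

@[fun_prop]
lemma continuous_rho : Continuous rho := by unfold rho; fun_prop

lemma rho_antitone : Antitone rho := by
  intro y z h
  have h0 : (0 : ℝ) ≤ max y 0 := le_max_right _ _
  have h1 : max y 0 ≤ max z 0 := max_le_max_right 0 h
  unfold rho wt
  gcongr

lemma wt_pow_le_rho (z : ℝ) : wt z ^ 3 ≤ rho z := by
  unfold rho wt
  have : max z 0 ^ 2 ≤ z ^ 2 := by
    rcases max_cases z 0 with h | h <;> rw [h.1]
    nlinarith [sq_nonneg z]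
  gcongr

/-- Since `t ≤ 2m + 2|x|` with `m = max (x + t/2) 0`, decay in `x + t/2` becomes decay in `t` at the
price of polynomial growth in `x`; `512` is `8³`. -/
lemma rho_le (x : ℝ) {t : ℝ} (ht : 0 ≤ t) :
    rho (x + t / 2) ≤ 512 * (1 + x ^ 2) ^ 3 * wt t ^ 3 := by
  have h0 : (0 : ℝ) ≤ max (x + t / 2) 0 := le_max_right _ _
  have h2 : x + t / 2 ≤ max (x + t / 2) 0 := le_max_left _ _
  set m := max (x + t / 2) 0 with hm
  have h3 : 1 + t ^ 2 ≤ 8 * (1 + x ^ 2) * (1 + m ^ 2) := by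
    have h4 : t ≤ 2 * m + 2 * |x| := by linarith [neg_abs_le x]
    have h5 : t ^ 2 ≤ (2 * m + 2 * |x|) ^ 2 := by gcongr
    nlinarith [sq_nonneg (m - |x|), sq_abs x, mul_nonneg (sq_nonneg x) (sq_nonneg m)]
  have h4 : wt m ≤ 8 * (1 + x ^ 2) * wt t := by
    have e1 := wt_mul t
    have e2 := wt_mul m
    have : wt m * wt t * (1 + t ^ 2) ≤ wt m * wt t * (8 * (1 + x ^ 2) * (1 + m ^ 2)) :=
      mul_le_mul_of_nonneg_left h3 (mul_pos (wt_pos _) (wt_pos _)).le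
    calc wt m = wt m * wt t * (1 + t ^ 2) := by linear_combination (-wt m) * e1
      _ ≤ _ := this
      _ = 8 * (1 + x ^ 2) * wt t := by linear_combination (8 * (1 + x ^ 2) * wt t) * e2
  calc rho (x + t / 2) = wt m ^ 3 := rfl
    _ ≤ (8 * (1 + x ^ 2) * wt t) ^ 3 := pow_le_pow_left₀ (wt_pos m).le h4 3
    _ = _ := by ring

/-- The exponential weight which makes the Volterra operators contractive. -/
def expWt (M x : ℝ) : ℝ := Real.exp (2 * M * (Real.pi / 2 - Real.arctan x))

lemma expWt_pos (M x : ℝ) : 0 < expWt M x := Real.exp_pos _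

@[fun_prop]
lemma continuous_expWt (M : ℝ) : Continuous (expWt M) := by
  unfold expWt; fun_prop

lemma one_le_expWt {M : ℝ} (hM : 0 ≤ M) (x : ℝ) : 1 ≤ expWt M x := by
  unfold expWt
  rw [Real.one_le_exp_iff]
  have := Real.arctan_lt_pi_div_two x
  apply mul_nonneg <;> linarith

lemma expWt_le {M : ℝ} (hM : 0 ≤ M) (x : ℝ) : expWt M x ≤ Real.exp (2 * M * Real.pi) := by
  unfold expWt
  gcongr
  linarith [Real.neg_pi_div_two_lt_arctan x]

lemma hasDerivAt_expWt (M x : ℝ) :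
    HasDerivAt (fun x => -(1 / 2) * expWt M x) (M * wt x * expWt M x) x := by
  have h := (((Real.hasDerivAt_arctan x).const_sub (Real.pi / 2)).const_mul (2 * M)).exp.const_mul
    (-(1 / 2))
  refine h.congr_deriv ?_
  simp only [expWt, wt]
  ring

lemma tendsto_expWt (M : ℝ) : Tendsto (expWt M) atTop (𝓝 1) := by
  have h := ((tendsto_nhds_of_tendsto_nhdsWithin Real.tendsto_arctan_atTop).const_sub
    (Real.pi / 2)).const_mul (2 * M)
  have := (Real.continuous_exp.tendsto _).comp h
  have h0 : Real.exp (2 * M * (Real.pi / 2 - Real.pi / 2)) = 1 := by simp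
  rw [h0] at this
  exact this

lemma integrable_wt_mul_expWt {M : ℝ} (hM : 0 ≤ M) :
    Integrable fun v => M * wt v * expWt M v := by
  refine (integrable_wt.const_mul (M * Real.exp (2 * M * Real.pi))).mono'
    (Continuous.aestronglyMeasurable (by fun_prop)) (Eventually.of_forall fun v => ?_)
  have h1 := wt_pos v
  have h2 := expWt_pos M v
  rw [Real.norm_of_nonneg (by positivity)]
  calc M * wt v * expWt M v ≤ M * wt v * Real.exp (2 * M * Real.pi) := by
        gcongr; exact expWt_le hM v
    _ = _ := by ring

/-- The weight solves `E' = -2M·wt·E` with `E → 1` at `+∞`, so its Volterra integral is at most half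
of `E` itself, whatever the size of `M`. -/
lemma integral_wt_mul_expWt {M : ℝ} (hM : 0 ≤ M) (x : ℝ) :
    ∫ v in Set.Ioi x, M * wt v * expWt M v = -(1 / 2) + 1 / 2 * expWt M x := by
  rw [integral_Ioi_of_hasDerivAt_of_tendsto' (fun v _ => hasDerivAt_expWt M v)
    (integrable_wt_mul_expWt hM).integrableOn ((tendsto_expWt M).const_mul (-(1 / 2)))]
  ring

/-- After conjugation by `expWt` the integral is at most `(1 - 1/E(x))/2`, where `E = expWt M`. The
operators are thus contractive without any smallness of the potentials. -/
lemma integral_indicator_volterra_le {M : ℝ} (hM : 0 ≤ M) {S : Set (ℝ × (ℝ × ℝ))}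
    {k : ℝ × (ℝ × ℝ) → ℂ} (hS : ∀ z ∈ S, z.2.1 ≤ z.1)
    (hk : ∀ z ∈ S, ‖k z‖ ≤ M * wt z.1 * (expWt M z.1 / expWt M z.2.1)) (p : ℝ × ℝ) :
    ∫ v, S.indicator (fun z => ‖k z‖) (v, p) ≤ 1 / 2 := by
  have hpos := expWt_pos M p.1
  have key : ∀ v, S.indicator (fun z => ‖k z‖) (v, p) ≤
      (Set.Ici p.1).indicator (fun v => M * wt v * expWt M v * (expWt M p.1)⁻¹) v := by
    intro v
    by_cases h : (v, p) ∈ S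
    · rw [Set.indicator_of_mem h, Set.indicator_of_mem (show v ∈ Set.Ici p.1 from hS _ h)]
      refine (hk _ h).trans_eq ?_
      simp only [div_eq_mul_inv, mul_assoc]
    · rw [Set.indicator_of_notMem h]
      refine Set.indicator_nonneg (fun v _ => ?_) v
      have h1 := wt_pos v
      have h2 := expWt_pos M v
      positivity
  refine (integral_mono_of_nonneg
    (Eventually.of_forall fun v => Set.indicator_nonneg (fun _ _ => norm_nonneg _) _)
    (((integrable_wt_mul_expWt hM).mul_const _).indicator measurableSet_Ici)
    (Eventually.of_forall key)).trans ?_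
  rw [integral_indicator measurableSet_Ici, integral_Ici_eq_integral_Ioi, integral_mul_const,
    integral_wt_mul_expWt hM, add_mul, mul_assoc, mul_inv_cancel₀ hpos.ne']
  have : 0 < (expWt M p.1)⁻¹ := by positivity
  linarith

/-- The Gelfand–Levitan type kernels of the Jost solution of the system `B' = r D`,
`D' = -2iλD + sB`. -/
theorem exists_jost_kernel {s r : ℝ → ℂ} (hs : Continuous s) (hr : Continuous r) {M : ℝ}
    (hM : 0 ≤ M) (hsM : ∀ x, ‖s x‖ ≤ M * wt x ^ 3) (hrM : ∀ x, ‖r x‖ ≤ M * wt x) :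
    ∃ b d : ℝ × ℝ → ℂ, Continuous b ∧ Continuous d ∧
      (∃ C, 0 ≤ C ∧ ∀ x t, 0 ≤ t → ‖b (x, t)‖ ≤ C * (1 + x ^ 2) ^ 3 * wt t ^ 3 ∧
        ‖d (x, t)‖ ≤ C * (1 + x ^ 2) ^ 3 * wt t ^ 3) ∧
      (∀ x t, b (x, t) = -∫ u in Set.Ioi x, r u * d (u, t)) ∧
      ∀ x t, d (x, t) = -(1 / 2) * s (x + t / 2) -
        ∫ v, if x ≤ v ∧ v ≤ x + t / 2 then s v * b (v, t - 2 * (v - x)) else 0 := by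
  have hne : ∀ x, (expWt M x : ℂ) ≠ 0 := fun x => ofReal_ne_zero.2 (expWt_pos M x).ne'
  have hne' : ∀ x, (rho x : ℂ) ≠ 0 := fun x => ofReal_ne_zero.2 (rho_pos x).ne'
  have hg : Integrable fun v => M * wt v * Real.exp (2 * M * Real.pi) :=
    (integrable_wt.const_mul M).mul_const _
  have hratio : ∀ x v, expWt M v / expWt M x ≤ Real.exp (2 * M * Real.pi) := fun x v =>
    (div_le_self (expWt_pos M v).le (one_le_expWt hM x)).trans (expWt_le hM v)
  have hfr1 : ∀ p : ℝ × ℝ, ∀ᵐ v, (v, p) ∉ frontier {z : ℝ × (ℝ × ℝ) | z.2.1 ≤ z.1} := by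
    intro p
    filter_upwards [compl_mem_ae_iff.2 (measure_singleton p.1)] with v hv hf
    exact hv (frontier_le_subset_eq (f := fun z : ℝ × (ℝ × ℝ) => z.2.1)
      (g := fun z => z.1) (by fun_prop) (by fun_prop) hf).symm
  -- The unknowns are `b` and `d` divided by `rho (x + t/2) * expWt M x`. The map `(x, t) ↦ (v, t -
  -- 2(v - x))` preserves `x + t/2`, so `rho` drops out of the kernel of `P`.
  obtain ⟨P, hP, hPe⟩ := exists_volterra_operator
    (S := {z : ℝ × (ℝ × ℝ) | z.2.1 ≤ z.1 ∧ z.1 ≤ z.2.1 + z.2.2 / 2})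
    (k := fun z => s z.1 * (expWt M z.1 / expWt M z.2.1))
    (Φ := fun z => (z.1, z.2.2 - 2 * (z.1 - z.2.1)))
    (g := fun v => M * wt v * Real.exp (2 * M * Real.pi))
    (by
      refine Continuous.mul (by fun_prop) (Continuous.div (by fun_prop) (by fun_prop) fun z => hne _))
    (by fun_prop)
    (by
      have h1 : MeasurableSet {z : ℝ × (ℝ × ℝ) | z.2.1 ≤ z.1} :=
        measurableSet_le (by fun_prop) (by fun_prop)
      have h2 : MeasurableSet {z : ℝ × (ℝ × ℝ) | z.1 ≤ z.2.1 + z.2.2 / 2} :=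
        measurableSet_le (by fun_prop) (by fun_prop)
      exact h1.inter h2)
    (by
      intro p
      filter_upwards [hfr1 p, compl_mem_ae_iff.2 (measure_singleton (p.1 + p.2 / 2))] with v hv1 hv2 hf
      have := frontier_inter_subset {z : ℝ × (ℝ × ℝ) | z.2.1 ≤ z.1}
        {z : ℝ × (ℝ × ℝ) | z.1 ≤ z.2.1 + z.2.2 / 2} hf
      rcases this with h | h
      · exact hv1 h.1
      · exact hv2 (frontier_le_subset_eq (f := fun z : ℝ × (ℝ × ℝ) => z.1)
          (g := fun z => z.2.1 + z.2.2 / 2) (by fun_prop) (by fun_prop) h.2))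
    hg
    (by
      rintro ⟨v, x, t⟩ -
      have h1 := expWt_pos M v
      have h2 := expWt_pos M x
      have h3 := wt_pos v
      have h4 : ‖((expWt M v : ℂ) / expWt M x)‖ = expWt M v / expWt M x := by
        rw [← ofReal_div, norm_real, Real.norm_of_nonneg (by positivity)]
      simp only [norm_mul, h4]
      gcongr
      · exact (hsM v).trans (by simpa using mul_le_mul_of_nonneg_left (wt_pow_le v (show 1 ≤ 3 by omega)) hM)
      · exact hratio x v)
    (integral_indicator_volterra_le hM (fun z hz => hz.1) (by
      rintro ⟨v, x, t⟩ -
      have h1 := expWt_pos M v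
      have h2 := expWt_pos M x
      have h4 : ‖((expWt M v : ℂ) / expWt M x)‖ = expWt M v / expWt M x := by
        rw [← ofReal_div, norm_real, Real.norm_of_nonneg (by positivity)]
      simp only [norm_mul, h4]
      gcongr
      exact (hsM v).trans (by simpa using mul_le_mul_of_nonneg_left (wt_pow_le v (show 1 ≤ 3 by omega)) hM)))
  -- Here `t` stays fixed while `x` moves up to `v`, so the quotient of the two values of `rho` is
  -- at most one by monotonicity.
  have hQk : ∀ z : ℝ × (ℝ × ℝ), z.2.1 ≤ z.1 →
      ‖r z.1 * (expWt M z.1 / expWt M z.2.1) *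
        (rho (z.1 + z.2.2 / 2) / rho (z.2.1 + z.2.2 / 2))‖ ≤
      M * wt z.1 * (expWt M z.1 / expWt M z.2.1) := by
    rintro ⟨v, x, t⟩ hz
    have h1 := expWt_pos M v
    have h2 := expWt_pos M x
    have h3 := rho_pos (v + t / 2)
    have h3' := rho_pos (x + t / 2)
    have h4 : ‖((expWt M v : ℂ) / expWt M x)‖ = expWt M v / expWt M x := by
      rw [← ofReal_div, norm_real, Real.norm_of_nonneg (by positivity)]
    have h5 : ‖((rho (v + t / 2) : ℂ) / rho (x + t / 2))‖ ≤ 1 := by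
      rw [← ofReal_div, norm_real, Real.norm_of_nonneg (by positivity), div_le_one h3']
      exact rho_antitone (by simpa using hz)
    simp only [norm_mul, h4]
    calc _ ≤ M * wt v * (expWt M v / expWt M x) * 1 := by
          have := hrM v
          have := wt_pos v
          gcongr
      _ = _ := mul_one _
  obtain ⟨Q, hQ, hQe⟩ := exists_volterra_operator
    (S := {z : ℝ × (ℝ × ℝ) | z.2.1 ≤ z.1})
    (k := fun z => r z.1 * (expWt M z.1 / expWt M z.2.1) *
      (rho (z.1 + z.2.2 / 2) / rho (z.2.1 + z.2.2 / 2)))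
    (Φ := fun z => (z.1, z.2.2))
    (g := fun v => M * wt v * Real.exp (2 * M * Real.pi))
    (by
      refine Continuous.mul (Continuous.mul (by fun_prop)
        (Continuous.div (by fun_prop) (by fun_prop) fun z => hne _))
        (Continuous.div (by fun_prop) (by fun_prop) fun z => hne' _))
    (by fun_prop)
    (isClosed_le (by fun_prop) (by fun_prop)).measurableSet
    hfr1 hg
    (by
      rintro ⟨v, x, t⟩ hz
      refine (hQk _ hz).trans ?_
      have h3 := wt_pos v
      exact mul_le_mul_of_nonneg_left (hratio x v) (by positivity))
    (integral_indicator_volterra_le hM (fun z hz => hz) hQk)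
  have hfc : Continuous fun p : ℝ × ℝ =>
      -(1 / 2) * s (p.1 + p.2 / 2) / (expWt M p.1 * rho (p.1 + p.2 / 2)) :=
    Continuous.div (by fun_prop) (by fun_prop) fun p => mul_ne_zero (hne _) (hne' _)
  let f : ℝ × ℝ →ᵇ ℂ := BoundedContinuousFunction.ofNormedAddCommGroup _ hfc M (by
    intro p
    have h1 := one_le_expWt hM p.1
    have h2 := rho_pos (p.1 + p.2 / 2)
    rw [norm_div, norm_mul, norm_mul, norm_real, norm_real, Real.norm_of_nonneg (by positivity),
      Real.norm_of_nonneg h2.le, div_le_iff₀ (by positivity)]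
    have h3 := (hsM (p.1 + p.2 / 2)).trans
      (mul_le_mul_of_nonneg_left (wt_pow_le_rho (p.1 + p.2 / 2)) hM)
    have h4 : ‖(-(1 / 2) : ℂ)‖ = 1 / 2 := by norm_num
    rw [h4]
    have h5 : M * rho (p.1 + p.2 / 2) ≤ M * (expWt M p.1 * rho (p.1 + p.2 / 2)) :=
      mul_le_mul_of_nonneg_left (le_mul_of_one_le_left h2.le h1) hM
    have := norm_nonneg (s (p.1 + p.2 / 2))
    linarith)
  obtain ⟨β, δ, hβ, hδ⟩ := exists_coupled_solution hP hQ f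
  have hbound : ∀ (γ : ℝ × ℝ →ᵇ ℂ) x t, 0 ≤ t →
      ‖((rho (x + t / 2) * expWt M x : ℝ) : ℂ) * γ (x, t)‖ ≤
        Real.exp (2 * M * Real.pi) * 512 * (‖β‖ + ‖δ‖ + ‖γ‖) * (1 + x ^ 2) ^ 3 * wt t ^ 3 := by
    intro γ x t ht
    have h1 := expWt_pos M x
    have h2 := rho_pos (x + t / 2)
    have h3 := wt_pos t
    rw [norm_mul, norm_real, Real.norm_of_nonneg (by positivity)]
    calc _ ≤ (512 * (1 + x ^ 2) ^ 3 * wt t ^ 3) * Real.exp (2 * M * Real.pi) *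
          (‖β‖ + ‖δ‖ + ‖γ‖) := by
          gcongr
          · exact rho_le x ht
          · exact expWt_le hM x
          · exact (γ.norm_coe_le_norm _).trans (by linarith [norm_nonneg β, norm_nonneg δ])
      _ = _ := by ring
  refine ⟨fun p => ((rho (p.1 + p.2 / 2) * expWt M p.1 : ℝ) : ℂ) * β p,
    fun p => ((rho (p.1 + p.2 / 2) * expWt M p.1 : ℝ) : ℂ) * δ p, by fun_prop, by fun_prop,
    ⟨Real.exp (2 * M * Real.pi) * 512 * (2 * (‖β‖ + ‖δ‖)), by positivity, fun x t ht => ⟨?_, ?_⟩⟩,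
    fun x t => ?_, fun x t => ?_⟩
  · refine (hbound β x t ht).trans ?_
    have h3 := wt_pos t
    gcongr
    linarith [norm_nonneg δ]
  · refine (hbound δ x t ht).trans ?_
    have h3 := wt_pos t
    gcongr
    linarith [norm_nonneg β]
  · have h1 := congrArg (fun γ : ℝ × ℝ →ᵇ ℂ => γ (x, t)) hβ
    simp only [BoundedContinuousFunction.neg_apply] at h1
    simp only
    rw [h1, hQe, mul_neg, ← integral_const_mul, ← integral_Ici_eq_integral_Ioi,
      ← integral_indicator measurableSet_Ici]
    congr 2
    ext v
    by_cases h : x ≤ v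
    · have h2 := hne x
      have h3 := hne' (x + t / 2)
      rw [Set.indicator_of_mem (show (v, (x, t)) ∈ {z : ℝ × (ℝ × ℝ) | z.2.1 ≤ z.1} from h),
        Set.indicator_of_mem (show v ∈ Set.Ici x from h)]
      push_cast
      generalize (rho (x + t / 2) : ℂ) = R at *
      field_simp
    · rw [Set.indicator_of_notMem (show (v, (x, t)) ∉ {z : ℝ × (ℝ × ℝ) | z.2.1 ≤ z.1} from h),
        Set.indicator_of_notMem (show v ∉ Set.Ici x from h), mul_zero]
  · have h1 := congrArg (fun γ : ℝ × ℝ →ᵇ ℂ => γ (x, t)) hδ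
    simp only [BoundedContinuousFunction.sub_apply] at h1
    have h2 := hne x
    have h3 := hne' (x + t / 2)
    simp only
    rw [h1, hPe, mul_sub, ← integral_const_mul]
    congr 1
    · simp only [f, BoundedContinuousFunction.coe_ofNormedAddCommGroup]
      push_cast
      generalize (rho (x + t / 2) : ℂ) = R at *
      field_simp
    · congr 1
      ext v
      by_cases h : x ≤ v ∧ v ≤ x + t / 2
      · rw [Set.indicator_of_mem
          (show (v, (x, t)) ∈ {z : ℝ × (ℝ × ℝ) | z.2.1 ≤ z.1 ∧ z.1 ≤ z.2.1 + z.2.2 / 2} from h),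
          if_pos h]
        have h4 : v + (t - 2 * (v - x)) / 2 = x + t / 2 := by ring
        push_cast
        rw [h4]
        field_simp
      · rw [Set.indicator_of_notMem
          (show (v, (x, t)) ∉ {z : ℝ × (ℝ × ℝ) | z.2.1 ≤ z.1 ∧ z.1 ≤ z.2.1 + z.2.2 / 2} from h),
          if_neg h, mul_zero]

/-! ### The half-line Fourier transform. -/

/-- The half-line Fourier transform `∫₀^∞ k(t) e^{iλt} dt`. -/
def ft (k : ℝ → ℂ) (l : ℂ) : ℂ := ∫ t in Set.Ioi (0 : ℝ), k t * exp (I * l * t)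

lemma norm_exp_I_mul_le {l : ℂ} (hl : 0 ≤ l.im) {t : ℝ} (ht : 0 ≤ t) :
    ‖exp (I * l * t)‖ ≤ 1 := by
  rw [Complex.norm_exp, Real.exp_le_one_iff]
  simp
  positivity

lemma norm_exp_I_mul_ofReal (l t : ℝ) : ‖exp (I * l * t)‖ = 1 := by
  rw [Complex.norm_exp]; simp

lemma norm_exp_neg_I_mul_ofReal (l t : ℝ) : ‖exp (-I * l * t)‖ = 1 := by
  rw [Complex.norm_exp]; simp

lemma integral_wt : ∫ x, wt x = Real.pi := integral_univ_inv_one_add_sq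

lemma setIntegral_wt_le (s : Set ℝ) : ∫ x in s, wt x ≤ Real.pi := by
  rw [← integral_wt]
  exact setIntegral_le_integral integrable_wt (Eventually.of_forall fun x => (wt_pos x).le)

lemma norm_setIntegral_le_of_wt {f : ℝ → ℂ} {s : Set ℝ} (hs : MeasurableSet s) {C : ℝ}
    (hC : 0 ≤ C) (hf : ∀ t ∈ s, ‖f t‖ ≤ C * wt t) : ‖∫ t in s, f t‖ ≤ C * Real.pi := by
  refine (norm_integral_le_of_norm_le (integrable_wt.const_mul C).integrableOn
    ((ae_restrict_iff' hs).2 (Eventually.of_forall hf))).trans ?_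
  rw [integral_const_mul]
  exact mul_le_mul_of_nonneg_left (setIntegral_wt_le s) hC

section ft

variable {k : ℝ → ℂ} {C : ℝ}

lemma integrableOn_ft (hk : Continuous k) (hC : ∀ t, 0 ≤ t → ‖k t‖ ≤ C * wt t) {l : ℂ}
    (hl : 0 ≤ l.im) : IntegrableOn (fun t : ℝ => k t * exp (I * l * t)) (Set.Ioi 0) := by
  refine (integrable_wt.const_mul C).integrableOn.mono'
    (Continuous.aestronglyMeasurable (by fun_prop))
    ((ae_restrict_iff' measurableSet_Ioi).2 (Eventually.of_forall fun t ht => ?_))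
  rw [norm_mul]
  exact (mul_le_of_le_one_right (norm_nonneg _) (norm_exp_I_mul_le hl (le_of_lt ht))).trans
    (hC t (le_of_lt ht))

lemma norm_ft_le (hC0 : 0 ≤ C) (hC : ∀ t, 0 ≤ t → ‖k t‖ ≤ C * wt t) {l : ℂ} (hl : 0 ≤ l.im) :
    ‖ft k l‖ ≤ C * Real.pi := by
  refine norm_setIntegral_le_of_wt measurableSet_Ioi hC0 fun t ht => ?_
  rw [norm_mul]
  exact (mul_le_of_le_one_right (norm_nonneg _) (norm_exp_I_mul_le hl (le_of_lt ht))).trans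
    (hC t (le_of_lt ht))

lemma continuousOn_ft (hk : Continuous k) (hC : ∀ t, 0 ≤ t → ‖k t‖ ≤ C * wt t) :
    ContinuousOn (ft k) {l | 0 ≤ l.im} := by
  refine continuousOn_of_dominated (bound := fun t => C * wt t)
    (fun l _ => Continuous.aestronglyMeasurable (by fun_prop)) (fun l hl => ?_)
    (integrable_wt.const_mul C).integrableOn
    (Eventually.of_forall fun t => Continuous.continuousOn (by fun_prop))
  refine (ae_restrict_iff' measurableSet_Ioi).2 (Eventually.of_forall fun t ht => ?_)
  rw [norm_mul]
  exact (mul_le_of_le_one_right (norm_nonneg _) (norm_exp_I_mul_le hl (le_of_lt ht))).trans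
    (hC t (le_of_lt ht))

lemma abs_mul_wt_sq_le (t : ℝ) : |t| * wt t ^ 2 ≤ wt t := by
  have h1 : |t| ≤ 1 + t ^ 2 := by nlinarith [sq_abs t, sq_nonneg (|t| - 1)]
  have h2 := mul_le_mul_of_nonneg_right h1 (sq_nonneg (wt t))
  have h3 := wt_mul t
  calc _ ≤ _ := h2
    _ = wt t := by linear_combination (wt t) * h3

/-- The second power of `wt` absorbs the factor `t` produced by differentiating `e^{iλt}`. -/
lemma differentiableOn_ft (hk : Continuous k) (hC : ∀ t, 0 ≤ t → ‖k t‖ ≤ C * wt t ^ 2) :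
    DifferentiableOn ℂ (ft k) {l | 0 < l.im} := by
  intro l hl
  have hopen : IsOpen {l : ℂ | 0 < l.im} := isOpen_lt continuous_const continuous_im
  have hC0 : 0 ≤ C := by
    have := (norm_nonneg _).trans (hC 0 le_rfl)
    exact nonneg_of_mul_nonneg_left this (pow_pos (wt_pos 0) 2)
  have hC' : ∀ t, 0 ≤ t → ‖k t‖ ≤ C * wt t := fun t ht => (hC t ht).trans
    (mul_le_mul_of_nonneg_left (by simpa using wt_pow_le t (show 1 ≤ 2 by omega)) hC0)
  have h := hasDerivAt_integral_of_dominated_loc_of_deriv_le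
    (μ := volume.restrict (Set.Ioi (0 : ℝ)))
    (F := fun (l : ℂ) (t : ℝ) => k t * exp (I * l * t))
    (F' := fun (l : ℂ) (t : ℝ) => k t * (exp (I * l * t) * (I * t))) (x₀ := l)
    (bound := fun t => C * wt t) (hopen.mem_nhds hl)
    (Eventually.of_forall fun l => Continuous.aestronglyMeasurable (by fun_prop))
    (integrableOn_ft hk hC' (le_of_lt hl)) (Continuous.aestronglyMeasurable (by fun_prop))
    ((ae_restrict_iff' measurableSet_Ioi).2 (Eventually.of_forall fun t ht z hz => ?_))
    (integrable_wt.const_mul C).integrableOn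
    (Eventually.of_forall fun t z _ => ?_)
  · exact h.2.differentiableAt.differentiableWithinAt
  · simp only [norm_mul, norm_I, one_mul, norm_real, Real.norm_eq_abs]
    have h1 := norm_exp_I_mul_le (le_of_lt hz) (le_of_lt ht)
    calc _ ≤ C * wt t ^ 2 * (1 * |t|) := by
          gcongr
          exact hC t (le_of_lt ht)
      _ = C * (|t| * wt t ^ 2) := by ring
      _ ≤ _ := mul_le_mul_of_nonneg_left (abs_mul_wt_sq_le t) hC0
  · have h1 : HasDerivAt (fun z : ℂ => I * z * t) (I * t) z := by
      simpa using ((hasDerivAt_id z).const_mul I).mul_const (t : ℂ)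
    exact h1.cexp.const_mul (k t)

lemma continuous_ft_param {c : ℝ × ℝ → ℂ} (hc : Continuous c) {w : ℝ → ℝ} (hw : Continuous w)
    (hC : ∀ x t, 0 ≤ t → ‖c (x, t)‖ ≤ w x * wt t) {l : ℂ} (hl : 0 ≤ l.im) :
    Continuous fun x => ft (fun t => c (x, t)) l := by
  rw [continuous_iff_continuousAt]
  intro x
  have hev : ∀ᶠ y in 𝓝 x, w y ≤ w x + 1 :=
    (hw.tendsto x).eventually (eventually_le_nhds (by linarith))
  refine continuousAt_of_dominated (bound := fun t => (w x + 1) * wt t)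
    (Eventually.of_forall fun y => Continuous.aestronglyMeasurable (by fun_prop)) ?_
    (integrable_wt.const_mul _).integrableOn
    (Eventually.of_forall fun t => by fun_prop)
  filter_upwards [hev] with y hy
  refine (ae_restrict_iff' measurableSet_Ioi).2 (Eventually.of_forall fun t ht => ?_)
  rw [norm_mul]
  refine (mul_le_of_le_one_right (norm_nonneg _) (norm_exp_I_mul_le hl (le_of_lt ht))).trans
    ((hC y t (le_of_lt ht)).trans ?_)
  exact mul_le_mul_of_nonneg_right hy (wt_pos t).le

end ft

/-! ### Integral equations for the amplitudes. -/

/-- Kernels `b`, `d` of the Jost solution of `B' = r D`, `D' = -2iλD + sB`. -/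
structure JostKernel (s r : ℝ → ℂ) (b d : ℝ × ℝ → ℂ) (C : ℝ) : Prop where
  cont_s : Continuous s
  cont_r : Continuous r
  cont_b : Continuous b
  cont_d : Continuous d
  nonneg : 0 ≤ C
  s_le : ∀ x, ‖s x‖ ≤ C * wt x ^ 5
  r_le : ∀ x, ‖r x‖ ≤ C * wt x ^ 5
  b_le : ∀ x t, 0 ≤ t → ‖b (x, t)‖ ≤ C * (1 + x ^ 2) ^ 3 * wt t ^ 3
  d_le : ∀ x t, 0 ≤ t → ‖d (x, t)‖ ≤ C * (1 + x ^ 2) ^ 3 * wt t ^ 3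
  b_eq : ∀ x t, b (x, t) = -∫ u in Set.Ioi x, r u * d (u, t)
  d_eq : ∀ x t, d (x, t) = -(1 / 2) * s (x + t / 2) -
        ∫ v, if x ≤ v ∧ v ≤ x + t / 2 then s v * b (v, t - 2 * (v - x)) else 0

theorem exists_jostKernel (s r : 𝓢(ℝ, ℂ)) : ∃ b d C, JostKernel s r b d C := by
  obtain ⟨C1, h10, h1⟩ := exists_wt_bound s 5
  obtain ⟨C2, h20, h2⟩ := exists_wt_bound r 5
  have w := wt_pos
  obtain ⟨b, d, hb, hd, ⟨C, hC0, hC⟩, hbe, hde⟩ := exists_jost_kernel s.continuous r.continuous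
    (M := C1 + C2) (by positivity)
    (fun x => (h1 x).trans (by
      have := wt_pow_le x (show 3 ≤ 5 by omega)
      have := w x
      gcongr; linarith))
    (fun x => (h2 x).trans (by
      have := wt_pow_le x (show 1 ≤ 5 by omega)
      have := w x
      rw [pow_one] at *
      gcongr; linarith))
  refine ⟨b, d, C + C1 + C2, s.continuous, r.continuous, hb, hd, by positivity,
    fun x => (h1 x).trans ?_, fun x => (h2 x).trans ?_, fun x t ht => (hC x t ht).1.trans ?_,
    fun x t ht => (hC x t ht).2.trans ?_, hbe, hde⟩
  · have := w x; gcongr; linarith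
  · have := w x; gcongr; linarith
  · have := w t; gcongr; linarith
  · have := w t; gcongr; linarith

/-- The component `B` obtained from the kernel `b`. -/
def amplB (b : ℝ × ℝ → ℂ) (l : ℂ) (x : ℝ) : ℂ := 1 + ft (fun t => b (x, t)) l

/-- The component `D` obtained from the kernel `d`. -/
def amplD (d : ℝ × ℝ → ℂ) (l : ℂ) (x : ℝ) : ℂ := ft (fun t => d (x, t)) l

lemma integral_Ioi_comp_half (g : ℝ → ℂ) (x : ℝ) :
    ∫ t in Set.Ioi (0 : ℝ), g (x + t / 2) = 2 * ∫ v in Set.Ioi x, g v := by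
  have h1 := Measure.integral_comp_div (fun t => (Set.Ioi x).indicator g (x + t)) 2
  rw [integral_add_left_eq_self (fun v => (Set.Ioi x).indicator g v),
    integral_indicator measurableSet_Ioi] at h1
  rw [← integral_indicator measurableSet_Ioi]
  simp only [abs_two, real_smul, ofReal_ofNat] at h1
  rw [← h1]
  congr 1
  ext t
  simp [Set.indicator]

lemma norm_exp_two_mul_le {l : ℂ} (hl : 0 ≤ l.im) {x v : ℝ} (hv : x < v) :
    ‖exp (2 * I * l * (v - x))‖ ≤ 1 := by
  have h := norm_exp_I_mul_le hl (t := 2 * (v - x)) (by linarith)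
  refine (congrArg norm (congrArg exp ?_)).trans_le h
  push_cast
  ring

/-- This is why fifth powers are imposed on the potentials: three of them cancel the growth `(1 +
x²)³` of the amplitudes and two remain for integrability. -/
lemma norm_mul_le_wt {f g : ℝ → ℂ} {M N : ℝ} (hM : 0 ≤ M) (hf : ∀ x, ‖f x‖ ≤ M * wt x ^ 5)
    (hg : ∀ x, ‖g x‖ ≤ N * (1 + x ^ 2) ^ 3) (x : ℝ) : ‖f x * g x‖ ≤ M * N * wt x ^ 2 := by
  have := wt_pos x
  rw [norm_mul]
  calc _ ≤ M * wt x ^ 5 * (N * (1 + x ^ 2) ^ 3) := by gcongr; exacts [hf x, hg x]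
    _ = M * N * wt x ^ 2 * (wt x * (1 + x ^ 2)) ^ 3 := by ring
    _ = _ := by rw [wt_mul]; ring

lemma integrableOn_exp_mul {f : ℝ → ℂ} {M : ℝ} {l : ℂ} (hl : 0 ≤ l.im) (hf : Continuous f)
    (hM : ∀ x, ‖f x‖ ≤ M * wt x) (x : ℝ) :
    IntegrableOn (fun v : ℝ => exp (2 * I * l * (v - x)) * f v) (Set.Ioi x) := by
  refine (integrable_wt.const_mul M).integrableOn.mono'
    (Continuous.aestronglyMeasurable (by fun_prop))
    ((ae_restrict_iff' measurableSet_Ioi).2 (Eventually.of_forall fun v hv => ?_))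
  rw [norm_mul]
  exact (mul_le_of_le_one_left (norm_nonneg _) (norm_exp_two_mul_le hl hv)).trans (hM v)

namespace JostKernel

variable {s r : ℝ → ℂ} {b d : ℝ × ℝ → ℂ} {C : ℝ} (h : JostKernel s r b d C)
include h

lemma wt_bound {c : ℝ × ℝ → ℂ} (hc : ∀ x t, 0 ≤ t → ‖c (x, t)‖ ≤ C * (1 + x ^ 2) ^ 3 * wt t ^ 3)
    (x t : ℝ) (ht : 0 ≤ t) : ‖c (x, t)‖ ≤ C * (1 + x ^ 2) ^ 3 * wt t := by
  have := h.nonneg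
  refine (hc x t ht).trans (mul_le_mul_of_nonneg_left ?_ (by positivity))
  simpa using wt_pow_le t (show 1 ≤ 3 by omega)

lemma continuous_amplB {l : ℂ} (hl : 0 ≤ l.im) : Continuous (amplB b l) :=
  continuous_const.add
    (continuous_ft_param h.cont_b (by fun_prop) (fun x t ht => h.wt_bound h.b_le x t ht) hl)

lemma continuous_amplD {l : ℂ} (hl : 0 ≤ l.im) : Continuous (amplD d l) :=
  continuous_ft_param h.cont_d (by fun_prop) (fun x t ht => h.wt_bound h.d_le x t ht) hl

lemma norm_amplD_le {l : ℂ} (hl : 0 ≤ l.im) (x : ℝ) :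
    ‖amplD d l x‖ ≤ C * Real.pi * (1 + x ^ 2) ^ 3 := by
  have := h.nonneg
  exact (norm_ft_le (by positivity) (h.wt_bound h.d_le x) hl).trans_eq (by ring)

lemma norm_amplB_le {l : ℂ} (hl : 0 ≤ l.im) (x : ℝ) :
    ‖amplB b l x‖ ≤ (1 + C * Real.pi) * (1 + x ^ 2) ^ 3 := by
  have := h.nonneg
  have h1 := norm_ft_le (by positivity) (h.wt_bound h.b_le x) hl
  have h2 : 1 ≤ (1 + x ^ 2) ^ 3 := one_le_pow₀ (one_le_one_add_sq x)
  refine (norm_add_le _ _).trans ?_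
  rw [norm_one]
  calc _ ≤ (1 + x ^ 2) ^ 3 + C * (1 + x ^ 2) ^ 3 * Real.pi := add_le_add h2 h1
    _ = _ := by ring

/-- The transform in `t` of the kernel equation for `b`; Fubini applies because the decay of `r`
beats the growth of `d` in `u`. -/
lemma amplB_eq {l : ℂ} (hl : 0 ≤ l.im) (x : ℝ) :
    amplB b l x = 1 - ∫ u in Set.Ioi x, r u * amplD d l u := by
  have hC := h.nonneg
  have hcont := h.cont_d
  have hcr := h.cont_r
  have hint : Integrable (Function.uncurry fun (t u : ℝ) => r u * d (u, t) * exp (I * l * t))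
      ((volume.restrict (Set.Ioi (0 : ℝ))).prod (volume.restrict (Set.Ioi x))) := by
    rw [Measure.prod_restrict]
    have hb := ((integrable_wt_pow 2).mul_prod (integrable_wt_pow 1)).const_mul (C * C)
    refine hb.integrableOn.mono' (Continuous.aestronglyMeasurable (by fun_prop))
      ((ae_restrict_iff' (measurableSet_Ioi.prod measurableSet_Ioi)).2
        (Eventually.of_forall ?_))
    rintro ⟨t, u⟩ ⟨ht, -⟩
    simp only [Function.uncurry_apply_pair, norm_mul]
    have ht' : 0 ≤ t := le_of_lt ht
    have h1 := h.r_le u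
    have h2 := h.d_le u t ht'
    have h3 := norm_exp_I_mul_le hl ht'
    have h4 := wt_pos u
    have h5 := wt_pos t
    calc _ ≤ (C * wt u ^ 5) * (C * (1 + u ^ 2) ^ 3 * wt t ^ 3) * 1 := by gcongr
      _ = C * C * (wt t ^ 3 * wt u ^ 2) * (wt u * (1 + u ^ 2)) ^ 3 := by ring
      _ = _ := by rw [wt_mul]; ring
  unfold amplB ft amplD ft
  simp only [h.b_eq, neg_mul, integral_neg]
  rw [sub_eq_add_neg]
  congr 2
  calc _ = ∫ t in Set.Ioi (0 : ℝ), ∫ u in Set.Ioi x, r u * d (u, t) * exp (I * l * t) := by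
        simp only [integral_mul_const]
    _ = ∫ u in Set.Ioi x, ∫ t in Set.Ioi (0 : ℝ), r u * d (u, t) * exp (I * l * t) :=
        integral_integral_swap hint
    _ = _ := by simp only [mul_assoc, integral_const_mul]

/-- In the transform of the kernel equation for `d`, the free term becomes the integral of
`e^{2iλ(v-x)}s(v)` through `v = x + t/2`. In the double integral the shift of `t` by `2(v - x)`
produces the same exponential in front of the transform of `b`. -/
lemma amplD_eq {l : ℂ} (hl : 0 ≤ l.im) (x : ℝ) :
    amplD d l x = -∫ v in Set.Ioi x, exp (2 * I * l * (v - x)) * (s v * amplB b l v) := by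
  have hC := h.nonneg
  have hcb := h.cont_b
  have hcs := h.cont_s
  -- The domain of the double integral in `(v, t)`: integrating over `t` first gives the transform
  -- of `b (v, ·)`, integrating over `v` first gives the integral term of `d_eq`, up to two
  -- endpoints.
  let U : Set (ℝ × ℝ) := {z | x < z.1 ∧ 2 * (z.1 - x) < z.2}
  have hU : MeasurableSet U :=
    (measurableSet_lt (f := fun _ : ℝ × ℝ => x) (by fun_prop) measurable_fst).inter
      (measurableSet_lt (f := fun z : ℝ × ℝ => 2 * (z.1 - x)) (by fun_prop) measurable_snd)
  let F : ℝ × ℝ → ℂ := U.indicator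
    fun z => s z.1 * b (z.1, z.2 - 2 * (z.1 - x)) * exp (I * l * z.2)
  have hFle : ∀ z, ‖F z‖ ≤ C * C * (wt z.1 ^ 2 * wt (z.2 - 2 * (z.1 - x))) := by
    rintro ⟨v, t⟩
    have h4 := wt_pos v
    have h5 := wt_pos (t - 2 * (v - x))
    by_cases hz : (v, t) ∈ U
    · simp only [F, Set.indicator_of_mem hz, norm_mul]
      have hz1 : x < v := hz.1
      have hz2 : 2 * (v - x) < t := hz.2
      have h1 := h.s_le v
      have h2 := h.wt_bound h.b_le v (t - 2 * (v - x)) (by linarith)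
      have h3 := norm_exp_I_mul_le hl (t := t) (by linarith)
      calc _ ≤ (C * wt v ^ 5) * (C * (1 + v ^ 2) ^ 3 * wt (t - 2 * (v - x))) * 1 := by gcongr
        _ = C * C * (wt v ^ 2 * wt (t - 2 * (v - x))) * (wt v * (1 + v ^ 2)) ^ 3 := by ring
        _ = _ := by rw [wt_mul]; ring
    · simp only [F, Set.indicator_of_notMem hz, norm_zero]
      positivity
  have hFint : Integrable F (volume.prod volume) := by
    have hw : Integrable (fun z : ℝ × ℝ => wt z.1 ^ 2 * wt (z.2 - 2 * (z.1 - x)))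
        (volume.prod volume) := by
      rw [integrable_prod_iff (Continuous.aestronglyMeasurable (by fun_prop))]
      refine ⟨Eventually.of_forall fun v =>
        (integrable_wt.comp_sub_right (2 * (v - x))).const_mul (wt v ^ 2), ?_⟩
      have : (fun v => ∫ t, ‖wt v ^ 2 * wt (t - 2 * (v - x))‖) = fun v => wt v ^ 2 * Real.pi := by
        ext v
        have h1 : ∀ t, ‖wt v ^ 2 * wt (t - 2 * (v - x))‖ = wt v ^ 2 * wt (t - 2 * (v - x)) :=
          fun t => Real.norm_of_nonneg (by
            have := wt_pos v
            have := wt_pos (t - 2 * (v - x))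
            positivity)
        simp only [h1]
        rw [integral_const_mul, integral_sub_right_eq_self wt, integral_wt]
      simp only [this]
      exact (integrable_wt_pow 1).mul_const _
    exact (hw.const_mul (C * C)).mono'
      ((Continuous.aestronglyMeasurable (by fun_prop)).indicator hU) (Eventually.of_forall hFle)
  have hswap := integral_integral_swap (f := fun v t => F (v, t)) hFint
  have hleft : ∫ v, ∫ t, F (v, t) =
      ∫ v in Set.Ioi x, exp (2 * I * l * (v - x)) * (s v * ft (fun t => b (v, t)) l) := by
    rw [← integral_indicator measurableSet_Ioi]
    congr 1
    ext v
    by_cases hv : x < v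
    · rw [Set.indicator_of_mem (show v ∈ Set.Ioi x from hv), ft,
        ← integral_indicator measurableSet_Ioi,
        ← integral_sub_right_eq_self (fun t => (Set.Ioi (0 : ℝ)).indicator
          (fun t => b (v, t) * exp (I * l * t)) t) (2 * (v - x)), ← mul_assoc, ← integral_const_mul]
      congr 1
      ext t
      by_cases ht : 2 * (v - x) < t
      · rw [Set.indicator_of_mem (show t - 2 * (v - x) ∈ Set.Ioi (0 : ℝ) by
          rw [Set.mem_Ioi]; linarith)]
        simp only [F, Set.indicator_of_mem (show (v, t) ∈ U from ⟨hv, ht⟩)]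
        have : exp (I * l * t) =
            exp (2 * I * l * (v - x)) * exp (I * l * ((t - 2 * (v - x) : ℝ) : ℂ)) := by
          rw [← Complex.exp_add]
          congr 1
          push_cast
          ring
        rw [this]
        ring
      · rw [Set.indicator_of_notMem (show t - 2 * (v - x) ∉ Set.Ioi (0 : ℝ) by
          rw [Set.mem_Ioi]; linarith)]
        simp only [F, Set.indicator_of_notMem (show (v, t) ∉ U from fun h => ht h.2), mul_zero]
    · rw [Set.indicator_of_notMem (show v ∉ Set.Ioi x from hv)]
      have : ∀ t, F (v, t) = 0 := fun t =>
        Set.indicator_of_notMem (show (v, t) ∉ U from fun h => hv h.1) _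
      simp [this]
  let J : ℝ → ℂ := fun t =>
    ∫ v, if x ≤ v ∧ v ≤ x + t / 2 then s v * b (v, t - 2 * (v - x)) else 0
  have hpt : ∀ t, ∫ v, F (v, t) =
      (Set.Ioi (0 : ℝ)).indicator (fun t : ℝ => J t * exp (I * l * t)) t := by
    intro t
    by_cases ht : 0 < t
    · rw [Set.indicator_of_mem (show t ∈ Set.Ioi (0 : ℝ) from ht), ← integral_mul_const]
      refine integral_congr_ae ?_
      filter_upwards [compl_mem_ae_iff.2 (measure_singleton x),
        compl_mem_ae_iff.2 (measure_singleton (x + t / 2))] with v hv1 hv2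
      have hv1' : v ≠ x := hv1
      have hv2' : v ≠ x + t / 2 := hv2
      by_cases hv : x ≤ v ∧ v ≤ x + t / 2
      · rw [if_pos hv]
        have h1 := lt_of_le_of_ne hv.1 hv1'.symm
        have h2 := lt_of_le_of_ne hv.2 hv2'
        simp only [F, Set.indicator_of_mem (show (v, t) ∈ U from ⟨h1, by
          show 2 * (v - x) < t
          linarith⟩)]
      · rw [if_neg hv, zero_mul]
        simp only [F]
        refine Set.indicator_of_notMem (fun hz => hv ⟨le_of_lt hz.1, ?_⟩) _
        have : 2 * (v - x) < t := hz.2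
        linarith
    · rw [Set.indicator_of_notMem (show t ∉ Set.Ioi (0 : ℝ) from ht)]
      have : ∀ v, F (v, t) = 0 := fun v =>
        Set.indicator_of_notMem (fun hz => ht (by
          have h1 : x < v := hz.1
          have h2 : 2 * (v - x) < t := hz.2
          linarith)) _
      simp [this]
  have hJint : IntegrableOn (fun t : ℝ => J t * exp (I * l * t)) (Set.Ioi 0) := by
    have h1 := hFint.integral_prod_right
    simp only [hpt] at h1
    exact (integrable_indicator_iff measurableSet_Ioi).1 h1
  have hdint := integrableOn_ft (k := fun t => d (x, t)) (by have := h.cont_d; fun_prop)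
    (h.wt_bound h.d_le x) hl
  have hdJ : ∀ t : ℝ, -(1 / 2) * s (x + t / 2) * exp (I * l * t) =
      d (x, t) * exp (I * l * t) + J t * exp (I * l * t) := by
    intro t
    rw [h.d_eq x t]
    ring
  have hright : ∫ t, ∫ v, F (v, t) = ∫ t in Set.Ioi (0 : ℝ), J t * exp (I * l * t) := by
    simp only [hpt]
    rw [integral_indicator measurableSet_Ioi]
  have hfirst : ∫ t in Set.Ioi (0 : ℝ), -(1 / 2) * s (x + t / 2) * exp (I * l * t) =
      -∫ v in Set.Ioi x, exp (2 * I * l * (v - x)) * s v := by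
    have h1 := integral_Ioi_comp_half (fun v => exp (2 * I * l * (v - x)) * s v) x
    have h2 : ∀ t : ℝ, -(1 / 2) * s (x + t / 2) * exp (I * l * t) =
        -(1 / 2) * (exp (2 * I * l * (((x + t / 2 : ℝ) : ℂ) - x)) * s (x + t / 2)) := by
      intro t
      have : 2 * I * l * (((x + t / 2 : ℝ) : ℂ) - x) = I * l * t := by push_cast; ring
      rw [this]
      ring
    simp only [h2]
    rw [integral_const_mul, h1]
    ring
  simp only [hdJ] at hfirst
  rw [integral_add hdint hJint, ← hright, ← hswap, hleft] at hfirst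
  have hs1 : IntegrableOn (fun v : ℝ => exp (2 * I * l * (v - x)) * s v) (Set.Ioi x) :=
    integrableOn_exp_mul hl hcs (fun v => (h.s_le v).trans
      (mul_le_mul_of_nonneg_left (by simpa using wt_pow_le v (show 1 ≤ 5 by omega)) hC)) x
  have hs2 : IntegrableOn (fun v : ℝ => exp (2 * I * l * (v - x)) *
      (s v * ft (fun t => b (v, t)) l)) (Set.Ioi x) := by
    refine integrableOn_exp_mul hl (hcs.mul (continuous_ft_param h.cont_b (by fun_prop)
      (fun x t ht => h.wt_bound h.b_le x t ht) hl)) (M := C * (C * Real.pi)) (fun v => ?_) x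
    refine (norm_mul_le_wt (N := C * Real.pi) hC h.s_le (fun x => (norm_ft_le (by positivity)
      (h.wt_bound h.b_le x) hl).trans_eq (by ring)) v).trans ?_
    exact mul_le_mul_of_nonneg_left (by simpa using wt_pow_le v (show 1 ≤ 2 by omega))
      (by positivity)
  have hsplit : ∀ v : ℝ, exp (2 * I * l * (v - x)) * (s v * amplB b l v) =
      exp (2 * I * l * (v - x)) * s v +
        exp (2 * I * l * (v - x)) * (s v * ft (fun t => b (v, t)) l) := by
    intro v
    unfold amplB
    ring
  simp only [hsplit]
  rw [integral_add hs1 hs2]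
  have hD : amplD d l x = ∫ t in Set.Ioi (0 : ℝ), d (x, t) * exp (I * l * t) := rfl
  rw [hD]
  linear_combination hfirst

end JostKernel

/-! ### Derivatives, limits and integration by parts on half-lines. -/

lemma hasDerivAt_integral_Ioi {f : ℝ → ℂ} (hf : Continuous f)
    (hint : ∀ x, IntegrableOn f (Set.Ioi x)) (x : ℝ) :
    HasDerivAt (fun x => ∫ u in Set.Ioi x, f u) (-f x) x := by
  have h : (fun x => ∫ u in Set.Ioi x, f u) =
      fun x => (∫ u in Set.Ioi 0, f u) - ∫ u in (0 : ℝ)..x, f u := by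
    ext y
    rw [← intervalIntegral.integral_Ioi_sub_Ioi' (hint 0) (hint y)]
    ring
  rw [h]
  exact (hf.integral_hasStrictDerivAt 0 x).hasDerivAt.const_sub _

/-- The integrand may depend on `x`, as required for the factor `e^{2iλ(u-x)}`; the bound is the
explicit tail `π/2 - arctan x`. -/
lemma tendsto_setIntegral_Ioi_zero {f : ℝ → ℝ → ℂ} {C : ℝ}
    (hf : ∀ x u, x < u → ‖f x u‖ ≤ C * wt u) :
    Tendsto (fun x => ∫ u in Set.Ioi x, f x u) atTop (𝓝 0) := by
  refine squeeze_zero_norm (a := fun x => C * (Real.pi / 2 - Real.arctan x)) (fun x => ?_) ?_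
  · refine (norm_integral_le_of_norm_le (integrable_wt.const_mul C).integrableOn
      ((ae_restrict_iff' measurableSet_Ioi).2 (Eventually.of_forall (hf x)))).trans_eq ?_
    rw [integral_const_mul]
    congr 1
    exact integral_Ioi_inv_one_add_sq
  · have h := ((tendsto_nhds_of_tendsto_nhdsWithin Real.tendsto_arctan_atTop).const_sub
      (Real.pi / 2)).const_mul C
    simpa using h

lemma tendsto_setIntegral_Ioi_atBot {f : ℝ → ℂ} (hf : Integrable f) :
    Tendsto (fun x => ∫ u in Set.Ioi x, f u) atBot (𝓝 (∫ u, f u)) :=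
  (aecover_Ioi tendsto_id).integral_tendsto_of_countably_generated hf

lemma integrable_of_le_wt {f : ℝ → ℂ} (hf : Continuous f) {C : ℝ} (hC : ∀ x, ‖f x‖ ≤ C * wt x) :
    Integrable f :=
  (integrable_wt.const_mul C).mono' hf.aestronglyMeasurable (Eventually.of_forall hC)

lemma tendsto_wt : Tendsto wt atTop (𝓝 0) := by
  have h : Tendsto (fun x : ℝ => 1 + x ^ 2) atTop atTop :=
    tendsto_atTop_add_const_left _ _ (tendsto_pow_atTop (by norm_num))
  exact h.inv_tendsto_atTop

lemma tendsto_wt_atBot : Tendsto wt atBot (𝓝 0) := by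
  have h := tendsto_wt.comp tendsto_neg_atBot_atTop
  refine h.congr fun x => ?_
  simp [wt]

/-- Integration by parts for oscillatory half-line integrals. -/
lemma integral_exp_mul_parts {f f' : ℝ → ℂ} {M : ℝ} (hd : ∀ x, HasDerivAt f (f' x) x)
    (hf' : Continuous f') (hM : ∀ x, ‖f x‖ ≤ M * wt x) (hM' : ∀ x, ‖f' x‖ ≤ M * wt x) {l : ℂ}
    (hl : 0 ≤ l.im) (x : ℝ) :
    2 * I * l * ∫ u in Set.Ioi x, exp (2 * I * l * (u - x)) * f u =
      -f x - ∫ u in Set.Ioi x, exp (2 * I * l * (u - x)) * f' u := by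
  have hf : Continuous f := continuous_iff_continuousAt.2 fun x => (hd x).continuousAt
  have hi1 := (integrableOn_exp_mul hl hf hM x).const_mul (2 * I * l)
  have hi2 := integrableOn_exp_mul hl hf' hM' x
  have hder : ∀ u : ℝ, HasDerivAt (fun u : ℝ => exp (2 * I * l * (u - x)) * f u)
      (2 * I * l * (exp (2 * I * l * (u - x)) * f u) + exp (2 * I * l * (u - x)) * f' u) u := by
    intro u
    have h1 : HasDerivAt (fun u : ℝ => 2 * I * l * ((u : ℂ) - x)) (2 * I * l) u := by
      simpa using ((hasDerivAt_id u).ofReal_comp.sub_const (x : ℂ)).const_mul (2 * I * l)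
    refine (h1.cexp.mul (hd u)).congr_deriv ?_
    ring
  have hlim : Tendsto (fun u : ℝ => exp (2 * I * l * (u - x)) * f u) atTop (𝓝 0) := by
    refine squeeze_zero_norm' (a := fun u => M * wt u) ?_ (by simpa using tendsto_wt.const_mul M)
    filter_upwards [eventually_gt_atTop x] with u hu
    rw [norm_mul]
    exact (mul_le_of_le_one_left (norm_nonneg _) (norm_exp_two_mul_le hl hu)).trans (hM u)
  have h := integral_Ioi_of_hasDerivAt_of_tendsto' (a := x) (fun u _ => hder u) (hi1.add hi2) hlim
  rw [integral_add hi1 hi2, integral_const_mul] at h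
  simp only [sub_self, mul_zero, exp_zero, one_mul, zero_sub] at h
  linear_combination h

/-! ### Differential equations and limits of the amplitudes. -/

namespace JostKernel

section

variable {s r : ℝ → ℂ} {b d : ℝ × ℝ → ℂ} {C : ℝ} (h : JostKernel s r b d C)
include h

lemma norm_sB_le {l : ℂ} (hl : 0 ≤ l.im) (x : ℝ) :
    ‖s x * amplB b l x‖ ≤ C * (1 + C * Real.pi) * wt x := by
  have := h.nonneg
  refine (norm_mul_le_wt h.nonneg h.s_le (h.norm_amplB_le hl) x).trans ?_
  exact mul_le_mul_of_nonneg_left (by simpa using wt_pow_le x (show 1 ≤ 2 by omega))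
    (by positivity)

lemma norm_rD_le {l : ℂ} (hl : 0 ≤ l.im) (x : ℝ) :
    ‖r x * amplD d l x‖ ≤ C * (C * Real.pi) * wt x := by
  have := h.nonneg
  refine (norm_mul_le_wt h.nonneg h.r_le (h.norm_amplD_le hl) x).trans ?_
  exact mul_le_mul_of_nonneg_left (by simpa using wt_pow_le x (show 1 ≤ 2 by omega))
    (by positivity)

lemma hasDerivAt_amplB {l : ℂ} (hl : 0 ≤ l.im) (x : ℝ) :
    HasDerivAt (amplB b l) (r x * amplD d l x) x := by
  have hc : Continuous fun u => r u * amplD d l u := h.cont_r.mul (h.continuous_amplD hl)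
  have h1 := (hasDerivAt_integral_Ioi hc
    (fun x => (integrable_of_le_wt hc (h.norm_rD_le hl)).integrableOn) x).const_sub 1
  rw [neg_neg] at h1
  exact h1.congr_of_eventuallyEq (Eventually.of_forall fun y => h.amplB_eq hl y)

/-- With the exponential moved to the left, `x` enters the integral only through its lower limit,
which makes differentiation and the limit at `-∞` immediate. -/
lemma amplD_eq' {l : ℂ} (hl : 0 ≤ l.im) (x : ℝ) :
    exp (2 * I * l * x) * amplD d l x =
      -∫ v in Set.Ioi x, exp (2 * I * l * v) * (s v * amplB b l v) := by
  rw [h.amplD_eq hl, mul_neg, ← integral_const_mul]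
  congr 2
  ext v
  rw [← mul_assoc, ← Complex.exp_add]
  congr 2
  ring

lemma hasDerivAt_amplD {l : ℂ} (hl : 0 ≤ l.im) (x : ℝ) :
    HasDerivAt (amplD d l) (-2 * I * l * amplD d l x + s x * amplB b l x) x := by
  have hc : Continuous fun u => s u * amplB b l u := h.cont_s.mul (h.continuous_amplB hl)
  have hc' : Continuous fun u : ℝ => exp (2 * I * l * u) * (s u * amplB b l u) := by fun_prop
  have hint : ∀ x, IntegrableOn (fun u : ℝ => exp (2 * I * l * u) * (s u * amplB b l u))
      (Set.Ioi x) := by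
    intro x
    have h1 := (integrableOn_exp_mul hl hc (h.norm_sB_le hl) x).const_mul (exp (2 * I * l * x))
    refine h1.congr (Eventually.of_forall fun v => ?_)
    simp only
    rw [← mul_assoc, ← Complex.exp_add]
    congr 2
    ring
  have h1 := (hasDerivAt_integral_Ioi hc' hint x).neg
  have h2 : HasDerivAt (fun x : ℝ => exp (-(2 * I * l * x))) (exp (-(2 * I * l * x)) *
      -(2 * I * l)) x := by
    have : HasDerivAt (fun x : ℝ => -(2 * I * l * (x : ℂ))) (-(2 * I * l)) x := by
      simpa using (hasDerivAt_id x).ofReal_comp.const_mul (-(2 * I * l))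
    exact this.cexp
  have h3 := h2.mul h1
  have hee : ∀ y : ℝ, exp (-(2 * I * l * y)) * exp (2 * I * l * y) = 1 := fun y => by
    rw [← Complex.exp_add, neg_add_cancel, exp_zero]
  have h4 : (fun y : ℝ => exp (-(2 * I * l * y)) *
      -∫ v in Set.Ioi y, exp (2 * I * l * v) * (s v * amplB b l v)) = amplD d l := by
    ext y
    rw [← h.amplD_eq' hl, ← mul_assoc, hee, one_mul]
  have h5 := h3.congr_deriv (f' := _) (g' := -2 * I * l * amplD d l x + s x * amplB b l x) (by
    simp only [Pi.neg_apply]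
    rw [← h.amplD_eq' hl]
    linear_combination (-2 * I * l * amplD d l x + s x * amplB b l x) * hee x)
  exact h5.congr_of_eventuallyEq (Eventually.of_forall fun y => (congrFun h4 y).symm)

lemma tendsto_amplB {l : ℂ} (hl : 0 ≤ l.im) : Tendsto (amplB b l) atTop (𝓝 1) := by
  have h1 := (tendsto_setIntegral_Ioi_zero (f := fun _ u => r u * amplD d l u)
    (fun x u _ => h.norm_rD_le hl u)).const_sub 1
  rw [sub_zero] at h1
  exact h1.congr fun x => (h.amplB_eq hl x).symm

lemma tendsto_amplD {l : ℂ} (hl : 0 ≤ l.im) : Tendsto (amplD d l) atTop (𝓝 0) := by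
  have h1 := (tendsto_setIntegral_Ioi_zero
    (f := fun x u => exp (2 * I * l * (u - x)) * (s u * amplB b l u))
    (fun x u hu => by
      rw [norm_mul]
      exact (mul_le_of_le_one_left (norm_nonneg _) (norm_exp_two_mul_le hl hu)).trans
        (h.norm_sB_le hl u))).neg
  rw [neg_zero] at h1
  exact h1.congr fun x => (h.amplD_eq hl x).symm

lemma tendsto_amplB_atBot {l : ℂ} (hl : 0 ≤ l.im) : ∃ c, Tendsto (amplB b l) atBot (𝓝 c) := by
  have hc : Continuous fun u => r u * amplD d l u := h.cont_r.mul (h.continuous_amplD hl)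
  exact ⟨_, ((tendsto_setIntegral_Ioi_atBot (integrable_of_le_wt hc (h.norm_rD_le hl))).const_sub
    1).congr fun x => (h.amplB_eq hl x).symm⟩

lemma tendsto_amplD_atBot (l : ℝ) :
    ∃ c, Tendsto (fun x : ℝ => exp (2 * I * l * x) * amplD d l x) atBot (𝓝 c) := by
  have hl : 0 ≤ (l : ℂ).im := by simp
  have hcB := h.continuous_amplB hl
  have hcs := h.cont_s
  have hc : Continuous fun u : ℝ => exp (2 * I * l * u) * (s u * amplB b l u) := by fun_prop
  refine ⟨_, ((tendsto_setIntegral_Ioi_atBot (integrable_of_le_wt hc (C := C * (1 + C * Real.pi))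
    (fun x => ?_))).neg).congr fun x => (h.amplD_eq' hl x).symm⟩
  rw [norm_mul]
  have : ‖exp (2 * I * l * x)‖ = 1 := by
    rw [Complex.norm_exp]; simp
  rw [this, one_mul]
  exact h.norm_sB_le hl x

end

end JostKernel

/-! ### Division of a half-line transform by `λ`. -/

section tail

variable {e : ℝ → ℂ} {C : ℝ}

/-- The antiderivative vanishing at `+∞`, multiplied by `-i`. -/
def tailKernel (e : ℝ → ℂ) (t : ℝ) : ℂ := I * ∫ u in Set.Ioi t, e u

lemma integrableOn_Ioi_of_le (he : Continuous e) (hC : ∀ t, 0 ≤ t → ‖e t‖ ≤ C * wt t) (t : ℝ) :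
    IntegrableOn e (Set.Ioi t) := by
  have h0 : IntegrableOn e (Set.Ioi 0) :=
    (integrable_wt.const_mul C).integrableOn.mono' he.aestronglyMeasurable
      ((ae_restrict_iff' measurableSet_Ioi).2 (Eventually.of_forall fun t ht => hC t (le_of_lt ht)))
  rcases le_total 0 t with ht | ht
  · exact h0.mono_set (Set.Ioi_subset_Ioi ht)
  · rw [← Set.Ioc_union_Ioi_eq_Ioi ht]
    exact (he.integrableOn_Ioc).union h0

lemma hasDerivAt_tailKernel (he : Continuous e) (hC : ∀ t, 0 ≤ t → ‖e t‖ ≤ C * wt t) (t : ℝ) :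
    HasDerivAt (tailKernel e) (-I * e t) t := by
  have := (hasDerivAt_integral_Ioi he (integrableOn_Ioi_of_le he hC) t).const_mul I
  exact this.congr_deriv (by ring)

lemma norm_tailKernel_le (hC0 : 0 ≤ C) (hC : ∀ t, 0 ≤ t → ‖e t‖ ≤ C * wt t ^ 3) {t : ℝ}
    (ht : 0 ≤ t) : ‖tailKernel e t‖ ≤ C * Real.pi * wt t ^ 2 := by
  have hw := wt_pos t
  unfold tailKernel
  rw [norm_mul, norm_I, one_mul]
  refine (norm_setIntegral_le_of_wt (C := C * wt t ^ 2) measurableSet_Ioi (by positivity)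
    fun u hu => ?_).trans_eq (by ring)
  have hu' : t < u := hu
  refine (hC u (ht.trans hu'.le)).trans ?_
  have h1 : wt u ≤ wt t := by
    unfold wt
    gcongr
  have hw' := wt_pos u
  calc C * wt u ^ 3 = C * wt u ^ 2 * wt u := by ring
    _ ≤ _ := by gcongr

/-- Integration by parts in `t`. The boundary term `I * tailKernel e 0` equals `-ft e 0`, so the
tail kernel realizes `(ft e λ - ft e 0)/λ` with no singularity at `λ = 0`. -/
lemma mul_ft_tailKernel (hC0 : 0 ≤ C) (he : Continuous e)
    (hC : ∀ t, 0 ≤ t → ‖e t‖ ≤ C * wt t ^ 3) {l : ℂ} (hl : 0 ≤ l.im) :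
    l * ft (tailKernel e) l = ft e l + I * tailKernel e 0 := by
  have hC' : ∀ t, 0 ≤ t → ‖e t‖ ≤ C * wt t := fun t ht => (hC t ht).trans
    (mul_le_mul_of_nonneg_left (by simpa using wt_pow_le t (show 1 ≤ 3 by omega)) hC0)
  have hta : ∀ t, 0 ≤ t → ‖tailKernel e t‖ ≤ C * Real.pi * wt t := fun t ht =>
    (norm_tailKernel_le hC0 hC ht).trans
    (mul_le_mul_of_nonneg_left (by simpa using wt_pow_le t (show 1 ≤ 2 by omega)) (by positivity))
  have hcont : Continuous (tailKernel e) :=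
    continuous_iff_continuousAt.2 fun t => (hasDerivAt_tailKernel he hC' t).continuousAt
  have hi1 := (integrableOn_ft he hC' hl).const_mul (-I)
  have hi2 := (integrableOn_ft hcont hta hl).const_mul (I * l)
  have hder : ∀ t : ℝ, HasDerivAt (fun t : ℝ => tailKernel e t * exp (I * l * t))
      (-I * (e t * exp (I * l * t)) + I * l * (tailKernel e t * exp (I * l * t))) t := by
    intro t
    have h1 : HasDerivAt (fun t : ℝ => I * l * (t : ℂ)) (I * l) t := by
      simpa using (hasDerivAt_id t).ofReal_comp.const_mul (I * l)
    exact ((hasDerivAt_tailKernel he hC' t).mul h1.cexp).congr_deriv (by ring)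
  have hlim : Tendsto (fun t : ℝ => tailKernel e t * exp (I * l * t)) atTop (𝓝 0) := by
    refine squeeze_zero_norm' (a := fun t => C * Real.pi * wt t) ?_
      (by simpa using tendsto_wt.const_mul (C * Real.pi))
    filter_upwards [eventually_ge_atTop 0] with t ht
    rw [norm_mul]
    exact (mul_le_of_le_one_right (norm_nonneg _) (norm_exp_I_mul_le hl ht)).trans (hta t ht)
  have h := integral_Ioi_of_hasDerivAt_of_tendsto' (a := 0) (fun t _ => hder t) (hi1.add hi2) hlim
  rw [integral_add hi1 hi2, integral_const_mul, integral_const_mul] at h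
  simp only [ofReal_zero, mul_zero, exp_zero, mul_one, zero_sub] at h
  have h' : -I * ft e l + I * l * ft (tailKernel e) l = -tailKernel e 0 := h
  linear_combination (-I) * h' + (l * ft (tailKernel e) l - ft e l) * I_mul_I

end tail

/-! ### Reduction to the AKNS system and the amplitudes of `ψ`. -/

/-- The pointwise product of Schwartz functions. -/
def schwartzMul (f g : 𝓢(ℝ, ℂ)) : 𝓢(ℝ, ℂ) :=
  SchwartzMap.pairing (ContinuousLinearMap.mul ℂ ℂ) f g

@[simp]
lemma schwartzMul_apply (f g : 𝓢(ℝ, ℂ)) (x : ℝ) : schwartzMul f g x = f x * g x := rfl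

/-- The derivative of a Schwartz function. -/
def schwartzDeriv (f : 𝓢(ℝ, ℂ)) : 𝓢(ℝ, ℂ) := SchwartzMap.derivCLM ℂ ℂ f

lemma hasDerivAt_schwartz (f : 𝓢(ℝ, ℂ)) (x : ℝ) : HasDerivAt f (schwartzDeriv f x) x :=
  f.hasDerivAt x

/-- The second potential of the AKNS system equivalent to the energy-dependent one. -/
def aknsPotential (q r : 𝓢(ℝ, ℂ)) : 𝓢(ℝ, ℂ) :=
  (I / 2) • schwartzDeriv q - (1 / 4 : ℂ) • schwartzMul (schwartzMul q q) r

lemma aknsPotential_apply (q r : 𝓢(ℝ, ℂ)) (x : ℝ) :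
    aknsPotential q r x = I / 2 * schwartzDeriv q x - 1 / 4 * (q x * q x * r x) := rfl

/-- The kernel of `B` for the pair `(q, r)`. -/
def kernelB (q r : 𝓢(ℝ, ℂ)) : ℝ × ℝ → ℂ :=
  Classical.choose (exists_jostKernel (aknsPotential q r) r)

/-- The kernel of `D` for the pair `(q, r)`. -/
def kernelD (q r : 𝓢(ℝ, ℂ)) : ℝ × ℝ → ℂ :=
  Classical.choose (Classical.choose_spec (exists_jostKernel (aknsPotential q r) r))

/-- A common bound for potentials and kernels. -/
def kernelBound (q r : 𝓢(ℝ, ℂ)) : ℝ := Classical.choose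
  (Classical.choose_spec (Classical.choose_spec (exists_jostKernel (aknsPotential q r) r)))

lemma jostKernel (q r : 𝓢(ℝ, ℂ)) :
    JostKernel (aknsPotential q r) r (kernelB q r) (kernelD q r) (kernelBound q r) :=
  Classical.choose_spec
  (Classical.choose_spec (Classical.choose_spec (exists_jostKernel (aknsPotential q r) r)))

/-- `e^{-iλx} ψ₂`. -/
def jostB (q r : 𝓢(ℝ, ℂ)) (l : ℂ) (x : ℝ) : ℂ := amplB (kernelB q r) l x

/-- The second AKNS component. -/
def jostD (q r : 𝓢(ℝ, ℂ)) (l : ℂ) (x : ℝ) : ℂ := amplD (kernelD q r) l x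

/-- The kernel whose tail gives the kernel of `A`. -/
def kernelE (q r : 𝓢(ℝ, ℂ)) (x t : ℝ) : ℂ := kernelD q r (x, t) - I / 2 * q x * kernelB q r (x, t)

/-- The kernel of `A` for the pair `(q, r)`. -/
def kernelA (q r : 𝓢(ℝ, ℂ)) (x : ℝ) : ℝ → ℂ := tailKernel (kernelE q r x)

/-- `e^{-iλx} ψ₁ / ζ`. -/
def jostA (q r : 𝓢(ℝ, ℂ)) (l : ℂ) (x : ℝ) : ℂ := ft (kernelA q r x) l

section jost

variable (q r : 𝓢(ℝ, ℂ))

lemma continuous_kernelE (x : ℝ) : Continuous (kernelE q r x) := by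
  have h1 := (jostKernel q r).cont_b
  have h2 := (jostKernel q r).cont_d
  unfold kernelE
  fun_prop

lemma exists_kernelE_bound (x : ℝ) :
    ∃ C, 0 ≤ C ∧ ∀ t, 0 ≤ t → ‖kernelE q r x t‖ ≤ C * wt t ^ 3 := by
  have h := jostKernel q r
  have h0 := h.nonneg
  refine ⟨kernelBound q r * (1 + x ^ 2) ^ 3 + ‖I / 2 * q x‖ * (kernelBound q r * (1 + x ^ 2) ^ 3),
    by positivity, fun t ht => ?_⟩
  unfold kernelE
  refine (norm_sub_le _ _).trans ?_
  rw [norm_mul, add_mul, mul_assoc ‖I / 2 * q x‖]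
  exact add_le_add (h.d_le x t ht) (mul_le_mul_of_nonneg_left (h.b_le x t ht) (norm_nonneg _))

lemma exists_kernelA_bound (x : ℝ) :
    ∃ C, 0 ≤ C ∧ ∀ t, 0 ≤ t → ‖kernelA q r x t‖ ≤ C * wt t ^ 2 := by
  obtain ⟨C, hC0, hC⟩ := exists_kernelE_bound q r x
  exact ⟨C * Real.pi, by positivity, fun t ht => norm_tailKernel_le hC0 hC ht⟩

lemma wt_bound_of_pow {k : ℝ → ℂ} {C : ℝ} (hC0 : 0 ≤ C) {n : ℕ} (hn : 1 ≤ n)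
    (hC : ∀ t, 0 ≤ t → ‖k t‖ ≤ C * wt t ^ n) (t : ℝ) (ht : 0 ≤ t) : ‖k t‖ ≤ C * wt t :=
  (hC t ht).trans (mul_le_mul_of_nonneg_left (by simpa using wt_pow_le t hn) hC0)

lemma continuous_kernelA (x : ℝ) : Continuous (kernelA q r x) := by
  obtain ⟨C, hC0, hC⟩ := exists_kernelE_bound q r x
  exact continuous_iff_continuousAt.2 fun t => (hasDerivAt_tailKernel (continuous_kernelE q r x)
    (wt_bound_of_pow hC0 (by norm_num) hC) t).continuousAt

lemma continuous_kernelB (x : ℝ) : Continuous fun t => kernelB q r (x, t) := by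
  have h1 := (jostKernel q r).cont_b
  fun_prop

lemma exists_kernelB_bound (x : ℝ) :
    ∃ C, 0 ≤ C ∧ ∀ t, 0 ≤ t → ‖kernelB q r (x, t)‖ ≤ C * wt t ^ 2 := by
  have h := jostKernel q r
  have h0 := h.nonneg
  refine ⟨kernelBound q r * (1 + x ^ 2) ^ 3, by positivity, fun t ht => (h.b_le x t ht).trans ?_⟩
  exact mul_le_mul_of_nonneg_left (wt_pow_le t (by norm_num)) (by positivity)

lemma exists_kernelD_bound (x : ℝ) :
    ∃ C, 0 ≤ C ∧ ∀ t, 0 ≤ t → ‖kernelD q r (x, t)‖ ≤ C * wt t ^ 2 := by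
  have h := jostKernel q r
  have h0 := h.nonneg
  refine ⟨kernelBound q r * (1 + x ^ 2) ^ 3, by positivity, fun t ht => (h.d_le x t ht).trans ?_⟩
  exact mul_le_mul_of_nonneg_left (wt_pow_le t (by norm_num)) (by positivity)

lemma hasDerivAt_jostB {l : ℂ} (hl : 0 ≤ l.im) (x : ℝ) :
    HasDerivAt (jostB q r l) (r x * jostD q r l x) x := (jostKernel q r).hasDerivAt_amplB hl x

lemma hasDerivAt_jostD {l : ℂ} (hl : 0 ≤ l.im) (x : ℝ) :
    HasDerivAt (jostD q r l) (-2 * I * l * jostD q r l x + aknsPotential q r x * jostB q r l x) x :=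
  (jostKernel q r).hasDerivAt_amplD hl x

lemma tendsto_jostB {l : ℂ} (hl : 0 ≤ l.im) : Tendsto (jostB q r l) atTop (𝓝 1) :=
  (jostKernel q r).tendsto_amplB hl

lemma tendsto_jostD {l : ℂ} (hl : 0 ≤ l.im) : Tendsto (jostD q r l) atTop (𝓝 0) :=
  (jostKernel q r).tendsto_amplD hl

lemma tendsto_schwartz_atTop (f : 𝓢(ℝ, ℂ)) : Tendsto f atTop (𝓝 0) := by
  obtain ⟨C, -, hC⟩ := exists_wt_bound f 1
  simp only [pow_one] at hC
  exact squeeze_zero_norm hC (by simpa using tendsto_wt.const_mul C)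

lemma tendsto_schwartz_atBot (f : 𝓢(ℝ, ℂ)) : Tendsto f atBot (𝓝 0) := by
  obtain ⟨C, -, hC⟩ := exists_wt_bound f 1
  simp only [pow_one] at hC
  exact squeeze_zero_norm hC (by simpa using tendsto_wt_atBot.const_mul C)

/-- At zero energy the two AKNS components are proportional. -/
lemma jostD_zero (x : ℝ) : jostD q r 0 x = I / 2 * q x * jostB q r 0 x := by
  have h0 : (0 : ℝ) ≤ (0 : ℂ).im := by simp
  -- At `λ = 0` this combination, which would be `λA`, satisfies a scalar homogeneous equation and
  -- tends to zero at `+∞`.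
  let E : ℝ → ℂ := fun x => jostD q r 0 x - I / 2 * q x * jostB q r 0 x
  have hE : ∀ x, HasDerivAt E (-(I / 2) * (q x * r x) * E x) x := by
    intro x
    refine ((hasDerivAt_jostD q r h0 x).sub (((hasDerivAt_schwartz q x).const_mul (I / 2)).mul
      (hasDerivAt_jostB q r h0 x))).congr_deriv ?_
    simp only [E, aknsPotential_apply]
    linear_combination (-(1 / 4) * q x ^ 2 * r x * jostB q r 0 x) * I_mul_I
  obtain ⟨C, -, hC⟩ := exists_wt_bound (schwartzMul q r) 1
  simp only [pow_one] at hC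
  -- Supplies the integrating factor; it stays bounded at `+∞`, so the constant `E * exp (-(I / 2) *
  -- G)` must be zero.
  let G : ℝ → ℂ := fun x => ∫ u in Set.Ioi x, schwartzMul q r u
  have hG : ∀ x, HasDerivAt G (-(schwartzMul q r x)) x := fun x =>
    hasDerivAt_integral_Ioi (schwartzMul q r).continuous
      (fun x => (integrable_of_le_wt (schwartzMul q r).continuous hC).integrableOn) x
  have hGlim : Tendsto G atTop (𝓝 0) := tendsto_setIntegral_Ioi_zero fun x u _ => hC u
  have hder : ∀ x, HasDerivAt (fun x => E x * exp (-(I / 2) * G x)) 0 x := by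
    intro x
    refine ((hE x).mul ((hG x).const_mul (-(I / 2))).cexp).congr_deriv ?_
    rw [schwartzMul_apply]
    ring
  have hElim : Tendsto E atTop (𝓝 0) := by
    have := (tendsto_jostD q r h0).sub
      (((tendsto_schwartz_atTop q).const_mul (I / 2)).mul (tendsto_jostB q r h0))
    simpa using this
  have hlim : Tendsto (fun x => E x * exp (-(I / 2) * G x)) atTop (𝓝 0) := by
    have h1 := (Complex.continuous_exp.tendsto _).comp (hGlim.const_mul (-(I / 2)))
    have := hElim.mul h1
    simpa using this
  have hconst : ∀ y, E x * exp (-(I / 2) * G x) = E y * exp (-(I / 2) * G y) := fun y =>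
    is_const_of_deriv_eq_zero (fun z => (hder z).differentiableAt) (fun z => (hder z).deriv) x y
  have hzero : E x * exp (-(I / 2) * G x) = 0 :=
    tendsto_nhds_unique (tendsto_const_nhds.congr hconst) hlim
  have := (mul_eq_zero.1 hzero).resolve_right (Complex.exp_ne_zero _)
  exact sub_eq_zero.1 this

/-- The relation between the AKNS components and the energy-dependent ones. -/
lemma mul_jostA {l : ℂ} (hl : 0 ≤ l.im) (x : ℝ) :
    l * jostA q r l x = jostD q r l x - I / 2 * q x * jostB q r l x := by
  obtain ⟨C, hC0, hC⟩ := exists_kernelE_bound q r x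
  obtain ⟨CB, hB0, hB⟩ := exists_kernelB_bound q r x
  obtain ⟨CD, hD0, hD⟩ := exists_kernelD_bound q r x
  have hcd : Continuous fun t => kernelD q r (x, t) := by
    have := (jostKernel q r).cont_d
    fun_prop
  have key : ∀ {l : ℂ}, 0 ≤ l.im → ft (kernelE q r x) l =
      jostD q r l x - I / 2 * q x * (jostB q r l x - 1) := by
    intro l hl
    have h1 := integrableOn_ft hcd (wt_bound_of_pow hD0 (by norm_num) hD) hl
    have h2 := integrableOn_ft (continuous_kernelB q r x) (wt_bound_of_pow hB0 (by norm_num) hB) hl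
    unfold jostD jostB amplD amplB ft kernelE
    rw [add_sub_cancel_left, ← integral_const_mul, ← integral_sub h1 (h2.const_mul _)]
    congr 1
    ext t
    ring
  have h0 : (0 : ℝ) ≤ (0 : ℂ).im := by simp
  have h1 := mul_ft_tailKernel hC0 (continuous_kernelE q r x) hC h0
  have h2 := mul_ft_tailKernel hC0 (continuous_kernelE q r x) hC hl
  -- At `λ = 0` the formula determines the boundary term: by `jostD_zero` the transform of `kernelE`
  -- there is `(i/2)q`, exactly what the summand `1` in `B` contributes at every `λ`.
  rw [key h0, jostD_zero] at h1
  rw [key hl] at h2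
  unfold jostA kernelA
  linear_combination h2 - h1

lemma continuousOn_jostA (x : ℝ) : ContinuousOn (fun l => jostA q r l x) {l | 0 ≤ l.im} := by
  obtain ⟨C, hC0, hC⟩ := exists_kernelA_bound q r x
  exact continuousOn_ft (continuous_kernelA q r x) (wt_bound_of_pow hC0 (by norm_num) hC)

lemma continuousOn_jostB (x : ℝ) : ContinuousOn (fun l => jostB q r l x) {l | 0 ≤ l.im} := by
  obtain ⟨C, hC0, hC⟩ := exists_kernelB_bound q r x
  exact continuousOn_const.add
    (continuousOn_ft (continuous_kernelB q r x) (wt_bound_of_pow hC0 (by norm_num) hC))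

lemma differentiableOn_jostA (x : ℝ) :
    DifferentiableOn ℂ (fun l => jostA q r l x) {l | 0 < l.im} := by
  obtain ⟨C, -, hC⟩ := exists_kernelA_bound q r x
  exact differentiableOn_ft (continuous_kernelA q r x) hC

lemma differentiableOn_jostB (x : ℝ) :
    DifferentiableOn ℂ (fun l => jostB q r l x) {l | 0 < l.im} := by
  obtain ⟨C, -, hC⟩ := exists_kernelB_bound q r x
  exact (differentiableOn_const _).add (differentiableOn_ft (continuous_kernelB q r x) hC)

lemma exists_jostA_bound (x : ℝ) : ∃ K, ∀ l : ℂ, 0 ≤ l.im → ‖jostA q r l x‖ ≤ K := by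
  obtain ⟨C, hC0, hC⟩ := exists_kernelA_bound q r x
  exact ⟨_, fun l hl => norm_ft_le hC0 (wt_bound_of_pow hC0 (by norm_num) hC) hl⟩

/-! ### Large-energy expansions of the amplitudes. -/

/-- Large-energy expansion of the AKNS component `D`, uniformly in space. -/
lemma exists_jostD_asymptotic : ∃ K, 0 ≤ K ∧ ∀ l : ℂ, 0 ≤ l.im → ∀ x,
    ‖l * jostD q r l x‖ ≤ K ∧
    ‖l * (l * jostD q r l x + I / 2 * (aknsPotential q r x * jostB q r l x))‖ ≤ K := by
  set s := aknsPotential q r with hs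
  have hK := jostKernel q r
  set C := kernelBound q r
  have hC0 : 0 ≤ C := hK.nonneg
  let s1 := schwartzDeriv s
  let s2 := schwartzDeriv s1
  let r1 := schwartzDeriv r
  let P := schwartzMul s r
  let Q := (2 : ℂ) • schwartzMul s1 r + schwartzMul s r1
  let S := s2 + schwartzMul P s
  have hbB : ∀ f : 𝓢(ℝ, ℂ), ∃ M, 0 ≤ M ∧ ∀ l : ℂ, 0 ≤ l.im → ∀ x, ‖f x * jostB q r l x‖ ≤ M * wt x := by
    intro f
    obtain ⟨M, hM0, hM⟩ := exists_wt_bound f 5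
    refine ⟨M * (1 + C * Real.pi), by positivity, fun l hl x => ?_⟩
    refine (norm_mul_le_wt hM0 hM (hK.norm_amplB_le hl) x).trans ?_
    exact mul_le_mul_of_nonneg_left (by simpa using wt_pow_le x (show 1 ≤ 2 by omega))
      (by positivity)
  have hbD : ∀ f : 𝓢(ℝ, ℂ), ∃ M, 0 ≤ M ∧ ∀ l : ℂ, 0 ≤ l.im → ∀ x, ‖f x * jostD q r l x‖ ≤ M * wt x := by
    intro f
    obtain ⟨M, hM0, hM⟩ := exists_wt_bound f 5
    refine ⟨M * (C * Real.pi), by positivity, fun l hl x => ?_⟩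
    refine (norm_mul_le_wt hM0 hM (hK.norm_amplD_le hl) x).trans ?_
    exact mul_le_mul_of_nonneg_left (by simpa using wt_pow_le x (show 1 ≤ 2 by omega))
      (by positivity)
  obtain ⟨M0, hM00, hM0⟩ := hbB s
  obtain ⟨M1, hM10, hM1⟩ := hbB s1
  obtain ⟨M2, hM20, hM2⟩ := hbD P
  obtain ⟨M3, hM30, hM3⟩ := hbD Q
  obtain ⟨M4, hM40, hM4⟩ := hbB S
  obtain ⟨M5, hM50, hM5⟩ := exists_wt_bound P 1
  simp only [pow_one] at hM5
  -- `f1` and `f2` are the first and second `x`-derivatives of `f0 = sB`, computed from the system.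
  -- Each integration by parts in `D = -∫ e^{2iλ(v-x)}f0` gains one factor `1/λ`.
  let f0 : ℂ → ℝ → ℂ := fun l x => s x * jostB q r l x
  let f1 : ℂ → ℝ → ℂ := fun l x => s1 x * jostB q r l x + P x * jostD q r l x
  let f2 : ℂ → ℝ → ℂ := fun l x =>
    S x * jostB q r l x + Q x * jostD q r l x + (-2 * I) * (P x * (l * jostD q r l x))
  have hcB : ∀ {l : ℂ}, 0 ≤ l.im → Continuous (jostB q r l) := fun hl => hK.continuous_amplB hl
  have hcD : ∀ {l : ℂ}, 0 ≤ l.im → Continuous (jostD q r l) := fun hl => hK.continuous_amplD hl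
  have hd0 : ∀ {l : ℂ}, 0 ≤ l.im → ∀ x, HasDerivAt (f0 l) (f1 l x) x := by
    intro l hl x
    refine ((hasDerivAt_schwartz s x).mul (hasDerivAt_jostB q r hl x)).congr_deriv ?_
    simp only [f1, P, schwartzMul_apply, s1]
    ring
  have hd1 : ∀ {l : ℂ}, 0 ≤ l.im → ∀ x, HasDerivAt (f1 l) (f2 l x) x := by
    intro l hl x
    have hP : HasDerivAt P (s1 x * r x + s x * r1 x) x :=
      (hasDerivAt_schwartz s x).mul (hasDerivAt_schwartz r x)
    refine (((hasDerivAt_schwartz s1 x).mul (hasDerivAt_jostB q r hl x)).add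
      (hP.mul (hasDerivAt_jostD q r hl x))).congr_deriv ?_
    have e1 : S x = s2 x + s x * r x * s x := rfl
    have e2 : Q x = 2 * (s1 x * r x) + s x * r1 x := rfl
    have e3 : P x = s x * r x := rfl
    simp only [f2, e1, e2, e3]
    ring
  have hb0 : ∀ {l : ℂ}, 0 ≤ l.im → ∀ x, ‖f0 l x‖ ≤ M0 * wt x := fun hl x => hM0 _ hl x
  have hb1 : ∀ {l : ℂ}, 0 ≤ l.im → ∀ x, ‖f1 l x‖ ≤ (M1 + M2) * wt x := fun hl x =>
    (norm_add_le _ _).trans (by rw [add_mul]; exact add_le_add (hM1 _ hl x) (hM2 _ hl x))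
  have hDeq : ∀ {l : ℂ}, 0 ≤ l.im → ∀ x, jostD q r l x =
      -∫ v in Set.Ioi x, exp (2 * I * l * (v - x)) * f0 l v := fun hl x => hK.amplD_eq hl x
  have hle : ∀ {f : ℝ → ℂ} {M : ℝ} {l : ℂ}, 0 ≤ l.im → 0 ≤ M → (∀ x, ‖f x‖ ≤ M * wt x) → ∀ x : ℝ,
      ‖∫ v in Set.Ioi x, exp (2 * I * l * (v - x)) * f v‖ ≤ M * Real.pi := by
    intro f M l hl hM hf x
    refine norm_setIntegral_le_of_wt measurableSet_Ioi hM fun t ht => ?_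
    rw [norm_mul]
    exact (mul_le_of_le_one_left (norm_nonneg _) (norm_exp_two_mul_le hl ht)).trans (hf t)
  have hwle : ∀ {f : ℝ → ℂ} {M : ℝ}, 0 ≤ M → (∀ x, ‖f x‖ ≤ M * wt x) → ∀ x, ‖f x‖ ≤ M :=
    fun hM hf x => (hf x).trans (mul_le_of_le_one_right hM (wt_le_one x))
  have hc0 : ∀ {l : ℂ}, 0 ≤ l.im → Continuous (f0 l) := fun hl => s.continuous.mul (hcB hl)
  have hc1 : ∀ {l : ℂ}, 0 ≤ l.im → Continuous (f1 l) := fun hl =>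
    (s1.continuous.mul (hcB hl)).add (P.continuous.mul (hcD hl))
  have hc2 : ∀ {l : ℂ}, 0 ≤ l.im → Continuous (f2 l) := fun hl =>
    ((S.continuous.mul (hcB hl)).add (Q.continuous.mul (hcD hl))).add
      (continuous_const.mul (P.continuous.mul (continuous_const.mul (hcD hl))))
  set M := M0 + (M1 + M2) with hM
  have hp0 : ∀ {l : ℂ}, 0 ≤ l.im → ∀ x, l * jostD q r l x + I / 2 * f0 l x =
      -(I / 2) * ∫ v in Set.Ioi x, exp (2 * I * l * (v - x)) * f1 l v := by
    intro l hl x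
    have h1 := integral_exp_mul_parts (M := M) (hd0 hl) (hc1 hl)
      (fun x => (hb0 hl x).trans (mul_le_mul_of_nonneg_right (by linarith) (wt_pos x).le))
      (fun x => (hb1 hl x).trans (mul_le_mul_of_nonneg_right (by linarith) (wt_pos x).le)) hl x
    rw [hDeq hl x]
    linear_combination (I / 2) * h1 + (-l * ∫ v in Set.Ioi x, exp (2 * I * l * (v - x)) * f0 l v) *
      I_mul_I
  set K1 := 1 / 2 * M0 + 1 / 2 * ((M1 + M2) * Real.pi) with hK1
  have hI2 : ‖(I / 2 : ℂ)‖ = 1 / 2 := by simp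
  have hfirst : ∀ {l : ℂ}, 0 ≤ l.im → ∀ x, ‖l * jostD q r l x‖ ≤ K1 := by
    intro l hl x
    have : l * jostD q r l x = -(I / 2) * (∫ v in Set.Ioi x, exp (2 * I * l * (v - x)) * f1 l v) -
        I / 2 * f0 l x := by linear_combination hp0 hl x
    rw [this]
    refine (norm_sub_le _ _).trans ?_
    rw [norm_mul, norm_mul, norm_neg, hI2]
    have h1 := hwle hM00 (hb0 hl) x
    have h2 := hle hl (add_nonneg hM10 hM20) (hb1 hl) x
    linarith
  -- The second derivative contains `λD`, coming from `D'`; it is harmless because the first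
  -- integration by parts has already bounded `λD` uniformly in `x`.
  have hb2 : ∀ {l : ℂ}, 0 ≤ l.im → ∀ x, ‖f2 l x‖ ≤ (M4 + M3 + 2 * (M5 * K1)) * wt x := by
    intro l hl x
    have h1 : ‖(-2 * I) * (P x * (l * jostD q r l x))‖ ≤ 2 * (M5 * K1) * wt x := by
      have hw := wt_pos x
      have : ‖(-2 * I : ℂ)‖ = 2 := by simp
      rw [norm_mul, this, norm_mul]
      calc _ ≤ 2 * (M5 * wt x * K1) := by
            gcongr
            · exact hM5 x
            · exact hfirst hl x
        _ = _ := by ring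
    refine (norm_add_le _ _).trans ?_
    rw [add_mul, add_mul]
    exact add_le_add ((norm_add_le _ _).trans (add_le_add (hM4 _ hl x) (hM3 _ hl x))) h1
  have hK10 : 0 ≤ K1 := by positivity
  set N := M4 + M3 + 2 * (M5 * K1) with hN
  have hN0 : 0 ≤ N := by positivity
  have hp1 : ∀ {l : ℂ}, 0 ≤ l.im → ∀ x : ℝ,
      2 * I * l * ∫ v in Set.Ioi x, exp (2 * I * l * (v - x)) * f1 l v =
      -f1 l x - ∫ v in Set.Ioi x, exp (2 * I * l * (v - x)) * f2 l v := by
    intro l hl x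
    exact integral_exp_mul_parts (M := M1 + M2 + N) (hd1 hl) (hc2 hl)
      (fun x => (hb1 hl x).trans (mul_le_mul_of_nonneg_right (by linarith) (wt_pos x).le))
      (fun x => (hb2 hl x).trans (mul_le_mul_of_nonneg_right (by linarith) (wt_pos x).le)) hl x
  refine ⟨K1 + 1 / 4 * (M1 + M2 + N * Real.pi), by positivity, fun l hl x =>
    ⟨(hfirst hl x).trans (by linarith [show 0 ≤ 1 / 4 * (M1 + M2 + N * Real.pi) by positivity]), ?_⟩⟩
  have e : l * (l * jostD q r l x + I / 2 * (s x * jostB q r l x)) =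
      1 / 4 * (f1 l x + ∫ v in Set.Ioi x, exp (2 * I * l * (v - x)) * f2 l v) := by
    have e1 := hp0 hl x
    have e2 := hp1 hl x
    simp only [f0] at e1
    linear_combination l * e1 - 1 / 4 * e2
  rw [e, norm_mul]
  have h4 : ‖(1 / 4 : ℂ)‖ = 1 / 4 := by simp
  rw [h4]
  have h5 : ‖f1 l x + ∫ v in Set.Ioi x, exp (2 * I * l * (v - x)) * f2 l v‖ ≤
      M1 + M2 + N * Real.pi :=
    (norm_add_le _ _).trans (add_le_add (hwle (by positivity) (hb1 hl) x)
      (hle hl hN0 (hb2 hl) x))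
  linarith

/-- Large-energy expansion of `B`. -/
lemma exists_jostB_asymptotic (x : ℝ) : ∃ (K : ℝ) (c : ℂ), ∀ l : ℂ, 0 ≤ l.im →
    ‖l * (jostB q r l x - 1)‖ ≤ K ∧ ‖l * (l * (jostB q r l x - 1) - c)‖ ≤ K := by
  obtain ⟨K, hK0, hK⟩ := exists_jostD_asymptotic q r
  obtain ⟨M, hM0, hM⟩ := exists_wt_bound r 1
  obtain ⟨N, hN0, hN⟩ := exists_wt_bound (schwartzMul r (aknsPotential q r)) 1
  have hKM : 0 ≤ M * K * Real.pi := by positivity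
  have hKN : 0 ≤ 1 / 2 * (N * (M * K * Real.pi) * Real.pi) := by positivity
  simp only [pow_one] at hM hN
  have hk := jostKernel q r
  have hcr := r.continuous
  have hcs := (aknsPotential q r).continuous
  have e1 : ∀ {l : ℂ}, 0 ≤ l.im → ∀ y, l * (jostB q r l y - 1) =
      -∫ u in Set.Ioi y, r u * (l * jostD q r l u) := by
    intro l hl y
    have h1 : jostB q r l y = 1 - ∫ u in Set.Ioi y, r u * jostD q r l u := hk.amplB_eq hl y
    have h2 : ∫ u in Set.Ioi y, r u * (l * jostD q r l u) =
        l * ∫ u in Set.Ioi y, r u * jostD q r l u := by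
      rw [← integral_const_mul]
      congr 1
      ext u
      ring
    rw [h1, h2]
    ring
  have h1 : ∀ {l : ℂ}, 0 ≤ l.im → ∀ y, ‖l * (jostB q r l y - 1)‖ ≤ M * K * Real.pi := by
    intro l hl y
    rw [e1 hl y, norm_neg]
    refine norm_setIntegral_le_of_wt measurableSet_Ioi (by positivity) fun u _ => ?_
    rw [norm_mul]
    have := wt_pos u
    calc _ ≤ M * wt u * K := by gcongr; exacts [hM u, (hK l hl u).1]
      _ = _ := by ring
  refine ⟨M * K * Real.pi + (M * K * Real.pi + 1 / 2 * (N * (M * K * Real.pi) * Real.pi)),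
    I / 2 * ∫ u in Set.Ioi x, r u * aknsPotential q r u, fun l hl =>
    ⟨(h1 hl x).trans (by linarith), ?_⟩⟩
  have hcB : Continuous (jostB q r l) := hk.continuous_amplB hl
  have hcD : Continuous (jostD q r l) := hk.continuous_amplD hl
  -- In `l * (r * (l * D))`, `g1` carries the error of replacing `lD` by `-(i/2)sB`, and `g2` the
  -- error of then replacing `B` by `1`; what remains is `l` times the constant.
  let g1 : ℝ → ℂ := fun u =>
    r u * (l * (l * jostD q r l u + I / 2 * (aknsPotential q r u * jostB q r l u)))
  let g2 : ℝ → ℂ := fun u => r u * aknsPotential q r u * (l * (jostB q r l u - 1))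
  have hg1 : ∀ u, ‖g1 u‖ ≤ M * K * wt u := by
    intro u
    rw [norm_mul]
    have := wt_pos u
    calc _ ≤ M * wt u * K := by gcongr; exacts [hM u, (hK l hl u).2]
      _ = _ := by ring
  have hg2 : ∀ u, ‖g2 u‖ ≤ N * (M * K * Real.pi) * wt u := by
    intro u
    rw [norm_mul]
    have := wt_pos u
    calc _ ≤ N * wt u * (M * K * Real.pi) := by gcongr; exacts [hN u, h1 hl u]
      _ = _ := by ring
  have hi1 : Integrable g1 := integrable_of_le_wt (by fun_prop) hg1
  have hi2 : Integrable g2 := integrable_of_le_wt (by fun_prop) hg2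
  have hi3 : Integrable fun u => r u * aknsPotential q r u :=
    integrable_of_le_wt (by fun_prop) hN
  have key : l * (l * (jostB q r l x - 1) -
      I / 2 * ∫ u in Set.Ioi x, r u * aknsPotential q r u) =
      -(∫ u in Set.Ioi x, g1 u) + I / 2 * ∫ u in Set.Ioi x, g2 u := by
    rw [e1 hl x, mul_sub, mul_neg, ← integral_const_mul, ← integral_const_mul,
      ← integral_const_mul, ← integral_const_mul]
    have h3 : ∫ u in Set.Ioi x, l * (r u * (l * jostD q r l u)) =
        (∫ u in Set.Ioi x, g1 u) - (∫ u in Set.Ioi x, I / 2 * g2 u) -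
          ∫ u in Set.Ioi x, l * (I / 2 * (r u * aknsPotential q r u)) := by
      rw [← integral_sub hi1.integrableOn (hi2.const_mul _).integrableOn,
        ← integral_sub (f := fun u => g1 u - I / 2 * g2 u)
          (hi1.sub (hi2.const_mul _)).integrableOn ((hi3.const_mul _).const_mul _).integrableOn]
      congr 1
      ext u
      simp only [g1, g2]
      ring
    rw [h3]
    ring
  rw [key]
  refine (norm_add_le _ _).trans ?_
  have hI2 : ‖(I / 2 : ℂ)‖ = 1 / 2 := by simp
  rw [norm_neg, norm_mul, hI2]
  have h4 := norm_setIntegral_le_of_wt (measurableSet_Ioi (a := x)) (by positivity)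
    fun u _ => hg1 u
  have h5 := norm_setIntegral_le_of_wt (measurableSet_Ioi (a := x)) (by positivity)
    fun u _ => hg2 u
  linarith

/-- Large-energy expansion of `A`. -/
lemma exists_jostA_asymptotic (x : ℝ) : ∃ (K : ℝ) (c : ℂ), ∀ l : ℂ, 0 ≤ l.im →
    ‖l * jostA q r l x‖ ≤ K ∧ ‖l * (l * jostA q r l x - c)‖ ≤ K := by
  obtain ⟨K, hK0, hK⟩ := exists_jostD_asymptotic q r
  obtain ⟨K', c, hK'⟩ := exists_jostB_asymptotic q r x
  have hk := jostKernel q r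
  have hC := hk.nonneg
  have hK'0 : 0 ≤ K' := (norm_nonneg _).trans (hK' 0 (by simp)).1
  set N := kernelBound q r * Real.pi * (1 + x ^ 2) ^ 3 +
    ‖I / 2 * q x‖ * ((1 + kernelBound q r * Real.pi) * (1 + x ^ 2) ^ 3) with hN
  have hN0 : 0 ≤ N := by positivity
  -- In `λA = D - (i/2)qB` one has `D = O(1/λ)` and `B → 1`, so the leading coefficient is
  -- `-(i/2)q`.
  refine ⟨N + (K + ‖I / 2 * q x‖ * K'), -(I / 2 * q x), fun l hl => ⟨?_, ?_⟩⟩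
  · rw [mul_jostA q r hl]
    have : ‖jostD q r l x - I / 2 * q x * jostB q r l x‖ ≤ N := by
      refine (norm_sub_le _ _).trans ?_
      rw [norm_mul]
      exact add_le_add (hk.norm_amplD_le hl x)
        (mul_le_mul_of_nonneg_left (hk.norm_amplB_le hl x) (norm_nonneg _))
    have hKK : 0 ≤ K + ‖I / 2 * q x‖ * K' := by positivity
    linarith
  · rw [mul_jostA q r hl]
    have e : l * (jostD q r l x - I / 2 * q x * jostB q r l x - -(I / 2 * q x)) =
        l * jostD q r l x - I / 2 * q x * (l * (jostB q r l x - 1)) := by ring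
    rw [e]
    refine (norm_sub_le _ _).trans ?_
    rw [norm_mul (I / 2 * q x)]
    have := add_le_add (hK l hl x).1
      (mul_le_mul_of_nonneg_left (hK' l hl).1 (norm_nonneg (I / 2 * q x)))
    linarith

end jost

/-! ### Improper integrals. -/

lemma intervalIntegrable_of_locallyIntegrable {f : ℝ → ℂ} (hf : LocallyIntegrable f volume)
    (a b : ℝ) : IntervalIntegrable f volume a b :=
  (intervalIntegrable_iff' (by simp)).2 (hf.integrableOn_isCompact isCompact_uIcc)

namespace HasImproperIntegral

variable {f g : ℝ → ℂ} {a b : ℂ}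

lemma of_integrable (hf : Integrable f) : HasImproperIntegral f (∫ t, f t) :=
  ⟨hf.locallyIntegrable, intervalIntegral_tendsto_integral hf tendsto_fst tendsto_snd⟩

lemma add (hf : HasImproperIntegral f a) (hg : HasImproperIntegral g b) :
    HasImproperIntegral (fun t => f t + g t) (a + b) := by
  refine ⟨hf.1.add hg.1, (hf.2.add hg.2).congr fun p => ?_⟩
  rw [intervalIntegral.integral_add (intervalIntegrable_of_locallyIntegrable hf.1 _ _)
    (intervalIntegrable_of_locallyIntegrable hg.1 _ _)]

lemma const_mul (c : ℂ) (hf : HasImproperIntegral f a) :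
    HasImproperIntegral (fun t => c * f t) (c * a) := by
  refine ⟨hf.1.smul c, (hf.2.const_mul c).congr fun p => ?_⟩
  rw [intervalIntegral.integral_const_mul]

lemma sub (hf : HasImproperIntegral f a) (hg : HasImproperIntegral g b) :
    HasImproperIntegral (fun t => f t - g t) (a - b) := by
  have h := hf.add (hg.const_mul (-1))
  simpa only [neg_one_mul, ← sub_eq_add_neg] using h

lemma congr_ae (hf : HasImproperIntegral f a) (h : f =ᵐ[volume] g) : HasImproperIntegral g a := by
  refine ⟨fun x => ?_, hf.2.congr fun p => ?_⟩
  · obtain ⟨s, hs, hi⟩ := hf.1 x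
    exact ⟨s, hs, hi.congr (ae_restrict_of_ae h)⟩
  · refine intervalIntegral.integral_congr_ae ?_
    filter_upwards [h] with t ht _ using ht

lemma comp_neg (hf : HasImproperIntegral f a) : HasImproperIntegral (fun t => f (-t)) a := by
  refine ⟨fun x => ?_, ?_⟩
  · obtain ⟨s, hs, hi⟩ := hf.1 (-x)
    refine ⟨Neg.neg ⁻¹' s, (continuous_neg.tendsto x) hs, ?_⟩
    exact ((Measure.measurePreserving_neg volume).integrableOn_comp_preimage
      (Homeomorph.neg ℝ).measurableEmbedding).2 hi
  · have h : Tendsto (fun p : ℝ × ℝ => (-p.2, -p.1)) (atBot ×ˢ atTop) (atBot ×ˢ atTop) :=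
      (tendsto_neg_atTop_atBot.comp tendsto_snd).prodMk (tendsto_neg_atBot_atTop.comp tendsto_fst)
    refine (hf.2.comp h).congr fun p => ?_
    simp

lemma unique (hf : HasImproperIntegral f a) (hg : HasImproperIntegral f b) : a = b :=
  tendsto_nhds_unique hf.2 hg.2

lemma improperIntegral_eq (hf : HasImproperIntegral f a) : improperIntegral f = a := hf.2.limUnder_eq

lemma self (hf : HasImproperIntegral f a) : HasImproperIntegral f (improperIntegral f) := by
  rwa [hf.improperIntegral_eq]

end HasImproperIntegral

/-! ### Jordan's lemma and Fourier inversion by improper integrals. -/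

/-- **Jordan's lemma** for the upper half-plane, with independent limits of integration. -/
theorem hasImproperIntegral_jordan {G : ℂ → ℂ} (hc : ContinuousOn G {l | 0 ≤ l.im})
    (hd : DifferentiableOn ℂ G {l | 0 < l.im}) {K : ℝ}
    (hK : ∀ l : ℂ, 0 ≤ l.im → (1 + ‖l‖) * ‖G l‖ ≤ K) {τ : ℝ} (hτ : 0 < τ) :
    HasImproperIntegral (fun l : ℝ => G l * exp (I * l * τ)) 0 := by
  have hK0 : 0 ≤ K := (by positivity : (0:ℝ) ≤ (1 + ‖(0 : ℂ)‖) * ‖G 0‖).trans (hK 0 (by simp))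
  have hcont : Continuous fun l : ℝ => G l * exp (I * l * τ) := by
    refine Continuous.mul ?_ (by fun_prop)
    exact hc.comp_continuous continuous_ofReal fun x => by simp
  refine ⟨hcont.locallyIntegrable, ?_⟩
  let f : ℂ → ℂ := fun l => G l * exp (I * l * τ)
  have hfn : ∀ x y : ℝ, ‖exp (I * (x + y * I : ℂ) * τ)‖ = Real.exp (-τ * y) := by
    intro x y
    rw [Complex.norm_exp]
    congr 1
    simp
    ring
  have hG1 : ∀ l : ℂ, 0 ≤ l.im → ‖G l‖ ≤ K := fun l hl => by
    have := hK l hl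
    nlinarith [norm_nonneg l, norm_nonneg (G l)]
  have hG2 : ∀ x y : ℝ, x ≠ 0 → 0 ≤ y → ‖G (x + y * I)‖ ≤ K / |x| := by
    intro x y hx hy
    rw [le_div_iff₀ (abs_pos.2 hx)]
    have h1 := hK (x + y * I) (by simpa using hy)
    have h2 : |x| ≤ ‖(x + y * I : ℂ)‖ := by
      have := Complex.abs_re_le_norm (x + y * I : ℂ)
      simpa using this
    nlinarith [norm_nonneg (G (x + y * I))]
  have hexpint : ∀ H : ℝ, ∫ y in (0 : ℝ)..H, Real.exp (-τ * y) = (1 - Real.exp (-τ * H)) / τ := by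
    intro H
    have hder : ∀ y ∈ Set.uIcc 0 H, HasDerivAt (fun y => -(1 / τ) * Real.exp (-τ * y))
        (Real.exp (-τ * y)) y := by
      intro y _
      have h1 : HasDerivAt (fun y : ℝ => -τ * y) (-τ) y := by
        simpa using (hasDerivAt_id y).const_mul (-τ)
      refine (h1.exp.const_mul (-(1 / τ))).congr_deriv ?_
      field_simp
    rw [intervalIntegral.integral_eq_sub_of_hasDerivAt hder
      (Continuous.intervalIntegrable (by fun_prop) _ _)]
    simp
    field_simp
    ring
  -- On a vertical side `|G| ≤ K/|x|` and the exponential integrates to at most `1/τ`, a bound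
  -- independent of the height of the rectangle.
  have hside : ∀ x H : ℝ, x ≠ 0 → 0 ≤ H →
      ‖∫ y in (0 : ℝ)..H, f (x + y * I)‖ ≤ K / |x| / τ := by
    intro x H hx hH
    have h1 : ‖∫ y in (0 : ℝ)..H, f (x + y * I)‖ ≤
        ∫ y in (0 : ℝ)..H, K / |x| * Real.exp (-τ * y) := by
      refine intervalIntegral.norm_integral_le_of_norm_le hH (Eventually.of_forall fun y hy => ?_)
        (Continuous.intervalIntegrable (by fun_prop) _ _)
      simp only [f, norm_mul, hfn]
      exact mul_le_mul_of_nonneg_right (hG2 x y hx hy.1.le) (Real.exp_pos _).le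
    refine h1.trans ?_
    rw [intervalIntegral.integral_const_mul, hexpint, mul_div_assoc']
    gcongr
    exact mul_le_of_le_one_right (by positivity) (by linarith [Real.exp_pos (-τ * H)])
  have hmain : ∀ a b : ℝ, a < 0 → 0 < b →
      ‖∫ l in a..b, f l‖ ≤ K / |b| / τ + K / |a| / τ := by
    intro a b ha hb
    -- For fixed `a` and `b` the top edge disappears as its height tends to infinity. The remaining
    -- estimate treats the two endpoints separately, so they may go to infinity independently.
    have hlim : Tendsto (fun H : ℝ => K * Real.exp (-τ * H) * |b - a| +
        (K / |b| / τ + K / |a| / τ)) atTop (𝓝 (K / |b| / τ + K / |a| / τ)) := by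
      have h1 : Tendsto (fun H : ℝ => -τ * H) atTop atBot := by
        simpa using (tendsto_id (α := ℝ) (x := atTop)).const_mul_atTop_of_neg (by linarith : -τ < 0)
      have h2 := ((Real.tendsto_exp_atBot.comp h1).const_mul K).mul_const |b - a|
      have := h2.add_const (K / |b| / τ + K / |a| / τ)
      simpa using this
    refine ge_of_tendsto hlim ?_
    filter_upwards [eventually_gt_atTop 0] with H hH
    have hrect := Complex.integral_boundary_rect_eq_zero_of_continuousOn_of_differentiableOn f
      (a : ℂ) (b + H * I) (by
        refine ContinuousOn.mul (hc.mono ?_) (Continuous.continuousOn (by fun_prop))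
        rintro z ⟨-, hz⟩
        simp only [Set.mem_preimage, ofReal_im, add_im, mul_im, ofReal_re, I_im, mul_one, I_re,
          mul_zero, add_zero, zero_add, Set.uIcc_of_le hH.le] at hz
        exact hz.1) (by
        refine DifferentiableOn.mul (hd.mono ?_) (Differentiable.differentiableOn (by fun_prop))
        rintro z ⟨-, hz⟩
        simp only [Set.mem_preimage, ofReal_im, add_im, mul_im, ofReal_re, I_im, mul_one, I_re,
          mul_zero, add_zero, zero_add, min_eq_left hH.le] at hz
        exact hz.1)
    simp only [ofReal_re, ofReal_im, add_re, mul_re, I_re, mul_zero, I_im, mul_one, sub_self,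
      add_zero, add_im, mul_im, zero_add, ofReal_zero, zero_mul] at hrect
    have htop : ‖∫ x in a..b, f (x + H * I)‖ ≤ K * Real.exp (-τ * H) * |b - a| := by
      refine intervalIntegral.norm_integral_le_of_norm_le_const fun x _ => ?_
      simp only [f, norm_mul, hfn]
      exact mul_le_mul_of_nonneg_right (hG1 _ (by simpa using hH.le)) (Real.exp_pos _).le
    have hr := hside b H hb.ne' hH.le
    have hl := hside a H ha.ne hH.le
    have heq : ∫ l in a..b, f l = (∫ x in a..b, f (x + H * I)) -
        I * (∫ y in (0 : ℝ)..H, f (b + y * I)) + I * ∫ y in (0 : ℝ)..H, f (a + y * I) := by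
      simp only [smul_eq_mul] at hrect
      linear_combination hrect
    rw [heq]
    refine (norm_add_le _ _).trans ?_
    refine (add_le_add (norm_sub_le _ _) le_rfl).trans ?_
    simp only [norm_mul, norm_I, one_mul]
    linarith
  have h1 : Tendsto (fun p : ℝ × ℝ => K / |p.2| / τ + K / |p.1| / τ) (atBot ×ˢ atTop) (𝓝 0) := by
    have h2 : Tendsto (fun p : ℝ × ℝ => K / |p.2| / τ) (atBot ×ˢ atTop) (𝓝 0) := by
      have := ((tendsto_abs_atTop_atTop.comp tendsto_snd).const_div_atTop K
        (l := (atBot : Filter ℝ) ×ˢ (atTop : Filter ℝ))).div_const τ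
      simpa [Function.comp_def] using this
    have h3 : Tendsto (fun p : ℝ × ℝ => K / |p.1| / τ) (atBot ×ˢ atTop) (𝓝 0) := by
      have := ((tendsto_abs_atBot_atTop.comp tendsto_fst).const_div_atTop K
        (l := (atBot : Filter ℝ) ×ˢ (atTop : Filter ℝ))).div_const τ
      simpa [Function.comp_def] using this
    simpa using h2.add h3
  refine squeeze_zero_norm' ?_ h1
  filter_upwards [(eventually_lt_atBot 0).prod_mk (eventually_gt_atTop 0)] with p hp
  exact hmain p.1 p.2 hp.1 hp.2

/-- Fourier inversion in the normalization `F(λ) = ∫ f(t) e^{iλt} dt`. -/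
theorem integral_fourier_inversion {f : ℝ → ℂ} {F : ℝ → ℂ} (hf : Integrable f)
    (hF : ∀ l : ℝ, F l = ∫ t : ℝ, f t * exp (I * l * t)) (hFi : Integrable F) {τ : ℝ}
    (hτ : ContinuousAt f τ) :
    ∫ l : ℝ, F l * exp (-I * l * τ) = 2 * Real.pi * f τ := by
  -- The standard transform uses `e^{-2πitw}`, so the frequencies are related by `λ = -2πw`.
  have hFT : FourierTransform.fourier f = fun w : ℝ => F (-(2 * Real.pi) * w) := by
    ext w
    rw [Real.fourier_real_eq_integral_exp_smul, hF]
    congr 1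
    ext t
    rw [smul_eq_mul, mul_comm]
    congr 2
    push_cast
    ring
  have hFTi : Integrable (FourierTransform.fourier f) := by
    rw [hFT]
    exact hFi.comp_mul_left' (by have := Real.pi_pos; linarith)
  have h := hf.fourierInv_fourier_eq hFTi hτ
  rw [Real.fourierInv_eq', hFT] at h
  have h2 := Measure.integral_comp_mul_left (fun l : ℝ => F l * exp (-I * l * τ)) (-(2 * Real.pi))
  have h3 : ∫ w : ℝ, F (-(2 * Real.pi) * w) * exp (-I * ((-(2 * Real.pi) * w : ℝ) : ℂ) * τ) =
      f τ := by
    rw [← h]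
    congr 1
    ext w
    rw [smul_eq_mul, mul_comm]
    congr 2
    simp
    ring
  rw [h3] at h2
  have hpi := Real.pi_pos
  rw [h2, abs_inv, abs_neg, abs_of_pos (by positivity), real_smul]
  have : (Real.pi : ℂ) ≠ 0 := ofReal_ne_zero.2 hpi.ne'
  generalize ∫ l : ℝ, F l * exp (-I * l * τ) = J
  push_cast
  field_simp

lemma ft_exp {l : ℂ} (hl : 0 ≤ l.im) : ft (fun t => exp (-(t : ℂ))) l = I / (l + I) := by
  have h := integral_exp_mul_complex_Ioi (a := I * l - 1) (by simp; linarith) 0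
  have h1 : ∀ t : ℝ, exp (-(t : ℂ)) * exp (I * l * t) = exp ((I * l - 1) * t) := by
    intro t
    rw [← Complex.exp_add]
    ring_nf
  unfold ft
  simp only [h1]
  rw [h]
  have h2 : l + I ≠ 0 := by
    intro h0
    have := congrArg Complex.im h0
    simp at this
    linarith
  have h3 : I * l - 1 = I * (l + I) := by linear_combination -I_mul_I
  rw [h3]
  have := I_ne_zero
  simp
  field_simp
  simp

lemma ofReal_add_I_ne_zero (l : ℝ) : (l : ℂ) + I ≠ 0 := by
  intro h0
  have := congrArg Complex.im h0
  simp at this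

/-- The function `2/(1+λ²)` is the integrable transform of `e^{-|t|}`, so ordinary inversion applies
to it. It differs from `i/(λ+i)` only by `i/(λ-i)`, whose integral against `e^{-iλτ}` vanishes by
Jordan's lemma after `λ ↦ -λ`. -/
lemma hasImproperIntegral_exp {τ : ℝ} (hτ : 0 < τ) :
    HasImproperIntegral (fun l : ℝ => I / (l + I) * exp (-I * l * τ))
      (2 * Real.pi * exp (-(τ : ℂ))) := by
  have him : ∀ l : ℂ, 0 ≤ l.im → 1 + ‖l‖ ≤ 2 * ‖l + I‖ := by
    intro l hl
    have h1 : (1 : ℝ) ≤ ‖l + I‖ := by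
      have := Complex.im_le_norm (l + I)
      simp at this
      linarith
    have h2 : ‖l‖ ^ 2 ≤ ‖l + I‖ ^ 2 := by
      rw [Complex.sq_norm, Complex.sq_norm, Complex.normSq_apply, Complex.normSq_apply]
      simp
      nlinarith
    have h3 := (pow_le_pow_iff_left₀ (norm_nonneg _) (norm_nonneg _) two_ne_zero).1 h2
    linarith
  have hne : ∀ l : ℂ, 0 ≤ l.im → l + I ≠ 0 := by
    intro l hl h0
    have := congrArg Complex.im h0
    simp at this
    linarith
  have hJ := (hasImproperIntegral_jordan (G := fun l => -I / (l + I)) (K := 2)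
    (ContinuousOn.div continuousOn_const (by fun_prop) fun l hl => hne l hl)
    (DifferentiableOn.div (differentiableOn_const _) (by fun_prop) fun l hl => hne l (le_of_lt hl))
    (fun l hl => by
      have := him l hl
      have h0 : 0 < ‖l + I‖ := norm_pos_iff.2 (hne l hl)
      rw [norm_div, norm_neg, norm_I, mul_one_div, div_le_iff₀ h0]
      exact this) hτ).comp_neg
  let f : ℝ → ℂ := fun t => (Real.exp (-|t|) : ℂ)
  have hfle : ∀ t, ‖f t‖ ≤ 2 * wt t := by
    intro t
    have h0 := Real.quadratic_le_exp_of_nonneg (abs_nonneg t)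
    rw [norm_real, Real.norm_of_nonneg (Real.exp_pos _).le, Real.exp_neg, wt,
      ← div_eq_mul_inv, ← one_div, div_le_div_iff₀ (Real.exp_pos _) (by positivity)]
    nlinarith [sq_abs t, abs_nonneg t]
  have hfc : Continuous f := by fun_prop
  have hfi : Integrable f := integrable_of_le_wt hfc hfle
  have hsum : ∀ l : ℝ, (2 / (1 + l ^ 2) : ℂ) = I / (l + I) - I / (l - I) := by
    intro l
    have h1 := ofReal_add_I_ne_zero l
    have h2 : (l : ℂ) - I ≠ 0 := by
      have := ofReal_add_I_ne_zero (-l)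
      intro h0
      apply this
      push_cast
      linear_combination -h0
    have h3 : (1 + l ^ 2 : ℂ) = (l + I) * (l - I) := by linear_combination I_mul_I
    rw [h3]
    field_simp
    linear_combination 2 * I_mul_I
  have hF : ∀ l : ℝ, (2 / (1 + l ^ 2) : ℂ) = ∫ t : ℝ, f t * exp (I * l * t) := by
    intro l
    have hgi : Integrable fun t : ℝ => f t * exp (I * l * t) := by
      refine integrable_of_le_wt (by fun_prop) (C := 2) fun t => ?_
      rw [norm_mul, norm_exp_I_mul_ofReal, mul_one]
      exact hfle t
    have e1 := integral_comp_neg_Ioi (0 : ℝ) (fun t : ℝ => f t * exp (I * l * t))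
    rw [neg_zero] at e1
    rw [← intervalIntegral.integral_Iic_add_Ioi (b := 0) hgi.integrableOn hgi.integrableOn, ← e1]
    have e2 : ∫ t in Set.Ioi (0 : ℝ), f t * exp (I * l * t) = ft (fun t => exp (-(t : ℂ))) l := by
      refine setIntegral_congr_fun measurableSet_Ioi fun t ht => ?_
      simp [f, abs_of_pos (show 0 < t from ht)]
    have e3 : ∫ t in Set.Ioi (0 : ℝ), f (-t) * exp (I * l * (-t : ℝ)) =
        ft (fun t => exp (-(t : ℂ))) (-l) := by
      refine setIntegral_congr_fun measurableSet_Ioi fun t ht => ?_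
      simp [f, abs_of_pos (show 0 < t from ht)]
    rw [e2, e3, ft_exp (by simp), ft_exp (by simp), hsum]
    have e4 : (-l + I : ℂ) = -(l - I) := by ring
    rw [e4, div_neg]
    ring
  have hFle : ∀ l : ℝ, ‖(2 / (1 + l ^ 2) : ℂ)‖ ≤ 2 * wt l := by
    intro l
    have : (2 / (1 + l ^ 2) : ℂ) = ((2 * wt l : ℝ) : ℂ) := by
      unfold wt
      push_cast
      ring
    have hw := wt_pos l
    rw [this, norm_real, Real.norm_of_nonneg (by positivity)]
  have hFc : Continuous fun l : ℝ => (2 / (1 + l ^ 2) : ℂ) := by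
    refine Continuous.div continuous_const (by fun_prop) fun l => ?_
    have : (1 + (l : ℂ) ^ 2) = ((1 + l ^ 2 : ℝ) : ℂ) := by push_cast; ring
    rw [this, ofReal_ne_zero]
    positivity
  have hFi := integrable_of_le_wt hFc hFle
  have h1 := integral_fourier_inversion hfi hF hFi (τ := τ) (by fun_prop)
  have hi : Integrable fun l : ℝ => (2 / (1 + l ^ 2) : ℂ) * exp (-I * l * τ) := by
    refine integrable_of_le_wt (by fun_prop) (C := 2) fun l => ?_
    rw [norm_mul, norm_exp_neg_I_mul_ofReal, mul_one]
    exact hFle l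
  have h2 := (HasImproperIntegral.of_integrable hi).add hJ
  rw [h1, add_zero] at h2
  have h3 : f τ = exp (-(τ : ℂ)) := by
    simp [f, abs_of_pos hτ]
  rw [h3] at h2
  refine h2.congr_ae (Eventually.of_forall fun l => ?_)
  have e4 : (((-l : ℝ) : ℂ) + I) = -(l - I) := by push_cast; ring
  have e5 : I * ((-l : ℝ) : ℂ) * τ = -I * l * τ := by push_cast; ring
  simp only [hsum, e4, e5, neg_div_neg_eq]
  ring

/-- Fourier inversion for half-line transforms with a simple large-frequency expansion, the
inverse transform being an improper integral. -/
theorem hasImproperIntegral_ft_inversion {k : ℝ → ℂ} (hk : Continuous k) {C : ℝ} (hC0 : 0 ≤ C)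
    (hC : ∀ t, 0 ≤ t → ‖k t‖ ≤ C * wt t) {K : ℝ} {c : ℂ}
    (hK : ∀ l : ℝ, ‖l * (l * ft k l - c)‖ ≤ K) {τ : ℝ} (hτ : 0 < τ) :
    HasImproperIntegral (fun l : ℝ => ft k l * exp (-I * l * τ)) (2 * Real.pi * k τ) := by
  let e0 : ℝ → ℂ := fun t => exp (-(t : ℂ))
  -- The added exponential has transform `-c/(λ+i)`, which cancels the leading term `c/λ` and leaves
  -- an `O(λ⁻²)`, hence integrable, transform. Its own inversion is `hasImproperIntegral_exp`.
  let k' : ℝ → ℂ := fun t => k t + I * c * e0 t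
  have he0 : ∀ t : ℝ, 0 ≤ t → ‖e0 t‖ ≤ 2 * wt t := by
    intro t ht
    have h0 := Real.quadratic_le_exp_of_nonneg ht
    have : e0 t = (Real.exp (-t) : ℂ) := by simp [e0]
    rw [this, norm_real, Real.norm_of_nonneg (Real.exp_pos _).le, Real.exp_neg, wt,
      ← div_eq_mul_inv, ← one_div, div_le_div_iff₀ (Real.exp_pos _) (by positivity)]
    nlinarith
  have hk' : Continuous k' := by fun_prop
  have hC' : ∀ t, 0 ≤ t → ‖k' t‖ ≤ (C + ‖I * c‖ * 2) * wt t := by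
    intro t ht
    refine (norm_add_le _ _).trans ?_
    rw [norm_mul, add_mul, mul_assoc ‖I * c‖]
    exact add_le_add (hC t ht) (mul_le_mul_of_nonneg_left (he0 t ht) (norm_nonneg _))
  have hft : ∀ l : ℝ, ft k' l = ft k l - c / (l + I) := by
    intro l
    have hl : (0 : ℝ) ≤ (l : ℂ).im := by simp
    have h1 : ft k' l = ft k l + I * c * ft e0 l := by
      unfold ft
      rw [← integral_const_mul, ← integral_add (integrableOn_ft hk hC hl)
        ((integrableOn_ft (by fun_prop) he0 hl).const_mul _)]
      congr 1
      ext t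
      simp only [k']
      ring
    rw [h1, ft_exp hl]
    linear_combination (c / (l + I)) * I_mul_I
  have hFc : Continuous fun l : ℝ => ft k' l :=
    (continuousOn_ft hk' hC').comp_continuous continuous_ofReal fun l => by simp
  have hFle : ∀ l : ℝ, ‖ft k' l‖ ≤ ((C + ‖I * c‖ * 2) * Real.pi + (K + ‖c‖)) * wt l := by
    intro l
    have h1 : ‖ft k' l‖ ≤ (C + ‖I * c‖ * 2) * Real.pi :=
      norm_ft_le (by positivity) hC' (by simp)
    have h2 : (l : ℂ) * (l * ft k' l) = l * (l * ft k l - c) + c * I * (l / (l + I)) := by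
      have := ofReal_add_I_ne_zero l
      rw [hft]
      field_simp
      ring
    have h3 : ‖(l / (l + I) : ℂ)‖ ≤ 1 := by
      rw [norm_div]
      apply div_le_one_of_le₀ _ (norm_nonneg _)
      rw [norm_real, Real.norm_eq_abs]
      simpa using Complex.abs_re_le_norm (l + I : ℂ)
    have h4 : l ^ 2 * ‖ft k' l‖ ≤ K + ‖c‖ := by
      have h5 : ‖(l : ℂ) * (l * ft k' l)‖ = l ^ 2 * ‖ft k' l‖ := by
        rw [norm_mul, norm_mul, norm_real, Real.norm_eq_abs, ← mul_assoc, abs_mul_abs_self, sq]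
      rw [← h5, h2]
      refine (norm_add_le _ _).trans (add_le_add (hK l) ?_)
      rw [norm_mul, norm_mul, norm_I, mul_one]
      exact mul_le_of_le_one_right (norm_nonneg _) h3
    rw [wt, ← div_eq_mul_inv, le_div_iff₀ (by positivity)]
    nlinarith
  have hFi := integrable_of_le_wt hFc hFle
  let f : ℝ → ℂ := (Set.Ioi (0 : ℝ)).indicator k'
  have hfi : Integrable f := by
    refine (integrable_indicator_iff measurableSet_Ioi).2
      ((integrable_wt.const_mul (C + ‖I * c‖ * 2)).integrableOn.mono' hk'.aestronglyMeasurable ?_)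
    exact (ae_restrict_iff' measurableSet_Ioi).2
      (Eventually.of_forall fun t ht => hC' t (le_of_lt ht))
  have hF : ∀ l : ℝ, ft k' l = ∫ t : ℝ, f t * exp (I * l * t) := by
    intro l
    unfold ft
    rw [← integral_indicator measurableSet_Ioi]
    congr 1
    ext t
    by_cases ht : t ∈ Set.Ioi (0 : ℝ) <;> simp [f, ht]
  have hfτ : ContinuousAt f τ := by
    refine hk'.continuousAt.congr ?_
    filter_upwards [isOpen_Ioi.mem_nhds hτ] with t ht
    simp only [f]
    rw [Set.indicator_of_mem ht]
  have h1 := integral_fourier_inversion hfi hF hFi hfτ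
  have hi : Integrable fun l : ℝ => ft k' l * exp (-I * l * τ) := by
    refine integrable_of_le_wt (by fun_prop) (C := (C + ‖I * c‖ * 2) * Real.pi + (K + ‖c‖))
      fun l => ?_
    rw [norm_mul, norm_exp_neg_I_mul_ofReal, mul_one]
    exact hFle l
  have h2 := (HasImproperIntegral.of_integrable hi).sub
    ((hasImproperIntegral_exp hτ).const_mul (I * c))
  have h3 : f τ = k τ + I * c * exp (-(τ : ℂ)) := Set.indicator_of_mem (show τ ∈ Set.Ioi 0 from hτ) _
  rw [h1, h3] at h2
  have h4 : (2 * Real.pi * (k τ + I * c * exp (-(τ : ℂ))) -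
      I * c * (2 * Real.pi * exp (-(τ : ℂ))) : ℂ) = 2 * Real.pi * k τ := by ring
  rw [h4] at h2
  refine h2.congr_ae (Eventually.of_forall fun l => ?_)
  simp only [hft]
  linear_combination (-(c / (l + I)) * exp (-I * l * τ)) * I_mul_I

/-! ### Solutions and their symmetries -/

lemma isSolution_iff {q r : ℝ → ℂ} {ζ : ℂ} {w : ℝ → Fin 2 → ℂ} :
    IsSolution q r ζ w ↔
      (∀ x, HasDerivAt (fun x => w x 0)
        ((-I * ζ ^ 2 - I / 2 * (q x * r x)) * w x 0 + ζ * q x * w x 1) x) ∧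
      ∀ x, HasDerivAt (fun x => w x 1)
        (ζ * r x * w x 0 + (I * ζ ^ 2 + I / 2 * (q x * r x)) * w x 1) x := by
  unfold IsSolution
  simp only [hasDerivAt_pi, Fin.forall_fin_two, forall_and]
  simp [coeffMatrix, Matrix.mulVec, dotProduct, Fin.sum_univ_two]

/-- Interchange of the two components. -/
def swapVec (w : ℝ → Fin 2 → ℂ) (x : ℝ) : Fin 2 → ℂ := ![w x 1, w x 0]

/-- Interchange of the two components combined with the reflection of the line. -/
def reflVec (w : ℝ → Fin 2 → ℂ) (x : ℝ) : Fin 2 → ℂ := ![w (-x) 1, w (-x) 0]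

@[simp] lemma swapVec_zero (w : ℝ → Fin 2 → ℂ) (x : ℝ) : swapVec w x 0 = w x 1 := rfl
@[simp] lemma swapVec_one (w : ℝ → Fin 2 → ℂ) (x : ℝ) : swapVec w x 1 = w x 0 := rfl
@[simp] lemma reflVec_zero (w : ℝ → Fin 2 → ℂ) (x : ℝ) : reflVec w x 0 = w (-x) 1 := rfl
@[simp] lemma reflVec_one (w : ℝ → Fin 2 → ℂ) (x : ℝ) : reflVec w x 1 = w (-x) 0 := rfl

/-- Multiplication of a potential by `-i`, as it occurs in the component interchange. -/
def rot (f : 𝓢(ℝ, ℂ)) : 𝓢(ℝ, ℂ) := (-I) • f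

@[simp] lemma rot_apply (f : 𝓢(ℝ, ℂ)) (x : ℝ) : rot f x = -I * f x := rfl

/-- The potential `-f(-x)`, as it occurs in the reflection of the line. -/
def refl (f : 𝓢(ℝ, ℂ)) : 𝓢(ℝ, ℂ) :=
  -SchwartzMap.compCLMOfContinuousLinearEquiv ℂ (ContinuousLinearEquiv.neg ℝ) f

@[simp] lemma refl_apply (f : 𝓢(ℝ, ℂ)) (x : ℝ) : refl f x = -f (-x) := rfl

lemma refl_refl (f : 𝓢(ℝ, ℂ)) : refl (refl f) = f := by ext x; simp

section solutions

variable {q r : 𝓢(ℝ, ℂ)} {ζ : ℂ} {w : ℝ → Fin 2 → ℂ}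

/-- The factors balance: `(iζ)(-ir) = ζr`, while both `(iζ)² = -ζ²` and the product of the rotated
potentials, `-qr`, reverse the sign of the diagonal. -/
lemma IsSolution.swap (h : IsSolution (rot r) (rot q) (I * ζ) w) :
    IsSolution q r ζ (swapVec w) := by
  rw [isSolution_iff] at h ⊢
  refine ⟨fun x => (h.2 x).congr_deriv ?_, fun x => (h.1 x).congr_deriv ?_⟩ <;>
  simp only [rot_apply, swapVec_zero, swapVec_one, mul_pow, I_sq]
  · linear_combination (-ζ * q x * w x 0 + I / 2 * (q x * r x) * w x 1) * I_mul_I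
  · linear_combination (-ζ * r x * w x 1 - I / 2 * (q x * r x) * w x 0) * I_mul_I

/-- The sign from differentiating in `-x` is absorbed by the interchange on the diagonal and by the
sign in `refl` off it; `ζ` is unchanged. This turns normalization at `+∞` into normalization at
`-∞`. -/
lemma IsSolution.refl (h : IsSolution q r ζ w) :
    IsSolution (refl r) (refl q) ζ (reflVec w) := by
  rw [isSolution_iff] at h ⊢
  refine ⟨fun x => ?_, fun x => ?_⟩
  · have h1 := (h.2 (-x)).scomp x (hasDerivAt_neg x)
    refine h1.congr_deriv ?_
    simp only [refl_apply, reflVec_zero, reflVec_one, neg_smul, one_smul]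
    ring
  · have h1 := (h.1 (-x)).scomp x (hasDerivAt_neg x)
    refine h1.congr_deriv ?_
    simp only [refl_apply, reflVec_zero, reflVec_one, neg_smul, one_smul]
    ring

lemma IsSolution.sub {q r : ℝ → ℂ} {u v : ℝ → Fin 2 → ℂ} (hu : IsSolution q r ζ u)
    (hv : IsSolution q r ζ v) : IsSolution q r ζ (fun x => u x - v x) := by
  intro x
  rw [Matrix.mulVec_sub]
  exact (hu x).sub (hv x)

/-- The Wronskian of two vector functions. -/
def wronskian (u v : ℝ → Fin 2 → ℂ) (x : ℝ) : ℂ := u x 0 * v x 1 - u x 1 * v x 0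

/-- The coefficient matrix is traceless. -/
lemma wronskian_const {q r : ℝ → ℂ} {u v : ℝ → Fin 2 → ℂ} (hu : IsSolution q r ζ u)
    (hv : IsSolution q r ζ v) (x y : ℝ) : wronskian u v x = wronskian u v y := by
  rw [isSolution_iff] at hu hv
  have h : ∀ x, HasDerivAt (wronskian u v) 0 x := fun x =>
    (((hu.1 x).mul (hv.2 x)).sub ((hu.2 x).mul (hv.1 x))).congr_deriv (by ring)
  exact is_const_of_deriv_eq_zero (fun z => (h z).differentiableAt) (fun z => (h z).deriv) x y

lemma wronskian_eq_of_tendsto {q r : ℝ → ℂ} {u v : ℝ → Fin 2 → ℂ} (hu : IsSolution q r ζ u)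
    (hv : IsSolution q r ζ v) {c₁ c₂ d₁ d₂ : ℂ}
    (hu0 : Tendsto (fun x : ℝ => exp (I * ζ ^ 2 * x) * u x 0) atTop (𝓝 c₁))
    (hu1 : Tendsto (fun x : ℝ => exp (-I * ζ ^ 2 * x) * u x 1) atTop (𝓝 c₂))
    (hv0 : Tendsto (fun x : ℝ => exp (I * ζ ^ 2 * x) * v x 0) atTop (𝓝 d₁))
    (hv1 : Tendsto (fun x : ℝ => exp (-I * ζ ^ 2 * x) * v x 1) atTop (𝓝 d₂)) (x : ℝ) :
    wronskian u v x = c₁ * d₂ - c₂ * d₁ := by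
  have h := (hu0.mul hv1).sub (hu1.mul hv0)
  refine tendsto_nhds_unique (tendsto_const_nhds.congr fun y => ?_) h
  rw [wronskian_const hu hv x y]
  have e : exp (I * ζ ^ 2 * y) * exp (-I * ζ ^ 2 * y) = 1 := by
    rw [← Complex.exp_add]
    ring_nf
    simp
  unfold wronskian
  linear_combination (-(u y 0 * v y 1 - u y 1 * v y 0)) * e

/-- For real `λ` the exponential is unimodular, so the `o(1)` conditions in the Jost normalizations
agree with the exponentially weighted ones. -/
lemma tendsto_exp_mul_zero {l : ℝ} (hζ : ζ ^ 2 = l) {f : ℝ → ℂ} {F : Filter ℝ} :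
    Tendsto (fun x : ℝ => exp (I * ζ ^ 2 * x) * f x) F (𝓝 0) ↔ Tendsto f F (𝓝 0) := by
  rw [tendsto_zero_iff_norm_tendsto_zero, tendsto_zero_iff_norm_tendsto_zero (f := f)]
  simp only [norm_mul, hζ, norm_exp_I_mul_ofReal, one_mul]

lemma tendsto_exp_neg_mul_zero {l : ℝ} (hζ : ζ ^ 2 = l) {f : ℝ → ℂ} {F : Filter ℝ} :
    Tendsto (fun x : ℝ => exp (-I * ζ ^ 2 * x) * f x) F (𝓝 0) ↔ Tendsto f F (𝓝 0) := by
  rw [tendsto_zero_iff_norm_tendsto_zero, tendsto_zero_iff_norm_tendsto_zero (f := f)]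
  simp only [norm_mul, hζ, norm_exp_neg_I_mul_ofReal, one_mul]

/-! ### Explicit Jost solutions -/

/-- Obtained by dividing `λA = D - (i/2)qB` by `λ`, hence the exclusion of `λ = 0`. There `ψ₁ =
ζe^{iλx}A` vanishes anyway. -/
lemma hasDerivAt_jostA (q r : 𝓢(ℝ, ℂ)) {l : ℂ} (hl : 0 ≤ l.im) (hl0 : l ≠ 0) (x : ℝ) :
    HasDerivAt (jostA q r l)
      (-(2 * I * l + I / 2 * (q x * r x)) * jostA q r l x + q x * jostB q r l x) x := by
  have h1 : jostA q r l = fun x => l⁻¹ * (jostD q r l x - I / 2 * q x * jostB q r l x) := by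
    ext y
    rw [← mul_jostA q r hl, inv_mul_cancel_left₀ hl0]
  have h2 := ((hasDerivAt_jostD q r hl x).sub (((hasDerivAt_schwartz q x).const_mul (I / 2)).mul
      (hasDerivAt_jostB q r hl x))).const_mul l⁻¹
  have h3 : HasDerivAt (jostA q r l) _ x := h2.congr_of_eventuallyEq
    (Eventually.of_forall fun y => by rw [h1]; rfl)
  refine h3.congr_deriv ?_
  have h4 : jostD q r l x = l * jostA q r l x + I / 2 * q x * jostB q r l x := by
    rw [mul_jostA q r hl]; ring
  rw [h4, aknsPotential_apply]
  field_simp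
  ring_nf
  simp only [I_sq]
  ring

/-- The Jost solution `ψ` in terms of the amplitudes `A` and `B`. -/
def psiSol (q r : 𝓢(ℝ, ℂ)) (ζ : ℂ) (x : ℝ) : Fin 2 → ℂ :=
  ![exp (I * ζ ^ 2 * x) * (ζ * jostA q r (ζ ^ 2) x), exp (I * ζ ^ 2 * x) * jostB q r (ζ ^ 2) x]

@[simp] lemma psiSol_zero (q r : 𝓢(ℝ, ℂ)) (ζ : ℂ) (x : ℝ) :
    psiSol q r ζ x 0 = exp (I * ζ ^ 2 * x) * (ζ * jostA q r (ζ ^ 2) x) := rfl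

@[simp] lemma psiSol_one (q r : 𝓢(ℝ, ℂ)) (ζ : ℂ) (x : ℝ) :
    psiSol q r ζ x 1 = exp (I * ζ ^ 2 * x) * jostB q r (ζ ^ 2) x := rfl

/-- The Jost solution `φ`. -/
def phiSol (q r : 𝓢(ℝ, ℂ)) (ζ : ℂ) : ℝ → Fin 2 → ℂ := reflVec (psiSol (refl r) (refl q) ζ)

lemma hasDerivAt_exp_I (l : ℂ) (x : ℝ) :
    HasDerivAt (fun x : ℝ => exp (I * l * x)) (exp (I * l * x) * (I * l)) x := by
  have : HasDerivAt (fun x : ℝ => I * l * (x : ℂ)) (I * l) x := by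
    simpa using (hasDerivAt_id x).ofReal_comp.const_mul (I * l)
  exact this.cexp

lemma isSolution_psiSol (q r : 𝓢(ℝ, ℂ)) (hζ : 0 ≤ (ζ ^ 2).im) :
    IsSolution q r ζ (psiSol q r ζ) := by
  rw [isSolution_iff]
  refine ⟨fun x => ?_, fun x => ?_⟩
  · by_cases h0 : ζ = 0
    · subst h0
      simpa using hasDerivAt_const x (0 : ℂ)
    · refine ((hasDerivAt_exp_I (ζ ^ 2) x).mul
        ((hasDerivAt_jostA q r hζ (pow_ne_zero 2 h0) x).const_mul ζ)).congr_deriv ?_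
      simp only [psiSol_zero, psiSol_one]
      ring
  · refine ((hasDerivAt_exp_I (ζ ^ 2) x).mul (hasDerivAt_jostB q r hζ x)).congr_deriv ?_
    have h4 : jostD q r (ζ ^ 2) x = ζ ^ 2 * jostA q r (ζ ^ 2) x +
        I / 2 * q x * jostB q r (ζ ^ 2) x := by
      rw [mul_jostA q r hζ]; ring
    simp only [psiSol_zero, psiSol_one, h4]
    ring

lemma tendsto_jostA (q r : 𝓢(ℝ, ℂ)) {l : ℂ} (hl : 0 ≤ l.im) (hl0 : l ≠ 0) :
    Tendsto (jostA q r l) atTop (𝓝 0) := by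
  have h := ((tendsto_jostD q r hl).sub
      (((tendsto_schwartz_atTop q).const_mul (I / 2)).mul (tendsto_jostB q r hl))).const_mul l⁻¹
  simp only [mul_zero, zero_mul, sub_zero] at h
  refine h.congr fun y => ?_
  rw [← mul_jostA q r hl, inv_mul_cancel_left₀ hl0]

lemma isJostPsi_psiSol (q r : 𝓢(ℝ, ℂ)) {l : ℝ} (hζ : ζ ^ 2 = l) :
    IsJostPsi q r ζ (psiSol q r ζ) := by
  have him : 0 ≤ (ζ ^ 2).im := by simp [hζ]
  refine ⟨isSolution_psiSol q r him, ?_, ?_⟩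
  · simp only [psiSol_zero]
    rw [tendsto_exp_mul_zero hζ]
    by_cases h0 : ζ = 0
    · simp [h0]
    · simpa using (tendsto_jostA q r him (pow_ne_zero 2 h0)).const_mul ζ
  · refine (tendsto_jostB q r him).congr fun x => ?_
    rw [psiSol_one, ← mul_assoc, ← Complex.exp_add]
    ring_nf
    simp

lemma IsJostPsi.swap (h : IsJostPsi (rot r) (rot q) (I * ζ) w) :
    IsJostPsiBar q r ζ (swapVec w) := by
  refine ⟨h.1.swap, ?_, h.2.1⟩
  refine h.2.2.congr fun x => ?_
  rw [swapVec_zero, mul_pow, I_sq]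
  ring_nf

lemma IsJostPhi.swap (h : IsJostPhi (rot r) (rot q) (I * ζ) w) :
    IsJostPhiBar q r ζ (swapVec w) := by
  refine ⟨h.1.swap, h.2.2, ?_⟩
  refine h.2.1.congr fun x => ?_
  rw [swapVec_one, mul_pow, I_sq]
  ring_nf

lemma isSolution_phiSol (q r : 𝓢(ℝ, ℂ)) (hζ : 0 ≤ (ζ ^ 2).im) :
    IsSolution q r ζ (phiSol q r ζ) := by
  have h := (isSolution_psiSol (refl r) (refl q) hζ).refl
  rwa [refl_refl, refl_refl] at h

lemma isJostPhi_phiSol (q r : 𝓢(ℝ, ℂ)) {l : ℝ} (hζ : ζ ^ 2 = l) :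
    IsJostPhi q r ζ (phiSol q r ζ) := by
  have h := isJostPsi_psiSol (refl r) (refl q) hζ
  refine ⟨isSolution_phiSol q r (by simp [hζ]), ?_, ?_⟩
  · refine (h.2.2.comp tendsto_neg_atBot_atTop).congr fun x => ?_
    simp [phiSol]
  · exact h.2.1.comp tendsto_neg_atBot_atTop

lemma isJostPsiBar_swap (q r : 𝓢(ℝ, ℂ)) {l : ℝ} (hζ : ζ ^ 2 = l) :
    IsJostPsiBar q r ζ (swapVec (psiSol (rot r) (rot q) (I * ζ))) :=
  (isJostPsi_psiSol (rot r) (rot q) (l := -l) (by rw [mul_pow, I_sq, hζ]; simp)).swap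

lemma isJostPhiBar_swap (q r : 𝓢(ℝ, ℂ)) {l : ℝ} (hζ : ζ ^ 2 = l) :
    IsJostPhiBar q r ζ (swapVec (phiSol (rot r) (rot q) (I * ζ))) :=
  (isJostPhi_phiSol (rot r) (rot q) (l := -l) (by rw [mul_pow, I_sq, hζ]; simp)).swap

/-! ### Uniqueness -/

lemma wronskian_psiBar_psi {q r : ℝ → ℂ} {u v : ℝ → Fin 2 → ℂ} {l : ℝ} (hζ : ζ ^ 2 = l)
    (hu : IsJostPsiBar q r ζ u) (hv : IsJostPsi q r ζ v) (x : ℝ) : wronskian u v x = 1 := by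
  rw [wronskian_eq_of_tendsto hu.1 hv.1 hu.2.1 ((tendsto_exp_neg_mul_zero hζ).2 hu.2.2)
    ((tendsto_exp_mul_zero hζ).2 hv.2.1) hv.2.2]
  ring

/-- A solution at real energy vanishing at `+∞` is zero. -/
lemma IsSolution.eq_zero_of_tendsto_atTop {l : ℝ} (hζ : ζ ^ 2 = l) (hw : IsSolution q r ζ w)
    (h0 : Tendsto (fun x => w x 0) atTop (𝓝 0)) (h1 : Tendsto (fun x => w x 1) atTop (𝓝 0)) :
    w = 0 := by
  have hpsi := isJostPsi_psiSol q r hζ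
  have hbar := isJostPsiBar_swap q r hζ
  set v := psiSol q r ζ
  set u := swapVec (psiSol (rot r) (rot q) (I * ζ))
  have e0 := (tendsto_exp_mul_zero hζ).2 h0
  have e1 := (tendsto_exp_neg_mul_zero hζ).2 h1
  -- The two explicit solutions have Wronskian `1`, so they form a basis in which the coefficients
  -- of `w` are, up to sign, its Wronskians with them. Both vanish because `w` does at `+∞`.
  have w1 : ∀ x, wronskian w v x = 0 := fun x => by
    rw [wronskian_eq_of_tendsto hw hpsi.1 e0 e1 ((tendsto_exp_mul_zero hζ).2 hpsi.2.1) hpsi.2.2]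
    ring
  have w2 : ∀ x, wronskian w u x = 0 := fun x => by
    rw [wronskian_eq_of_tendsto hw hbar.1 e0 e1 hbar.2.1
      ((tendsto_exp_neg_mul_zero hζ).2 hbar.2.2)]
    ring
  have w3 := wronskian_psiBar_psi hζ hbar hpsi
  ext x i
  have a1 := w1 x
  have a2 := w2 x
  have a3 := w3 x
  unfold wronskian at a1 a2 a3
  fin_cases i
  · simp only [Pi.zero_apply, Fin.zero_eta]
    linear_combination u x 0 * a1 - v x 0 * a2 - w x 0 * a3
  · simp only [Pi.zero_apply, Fin.mk_one]
    linear_combination u x 1 * a1 - v x 1 * a2 - w x 1 * a3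

/-- A solution at real energy vanishing at `-∞` is zero. -/
lemma IsSolution.eq_zero_of_tendsto_atBot {l : ℝ} (hζ : ζ ^ 2 = l) (hw : IsSolution q r ζ w)
    (h0 : Tendsto (fun x => w x 0) atBot (𝓝 0)) (h1 : Tendsto (fun x => w x 1) atBot (𝓝 0)) :
    w = 0 := by
  have h := hw.refl.eq_zero_of_tendsto_atTop hζ (h1.comp tendsto_neg_atTop_atBot)
    (h0.comp tendsto_neg_atTop_atBot)
  ext x i
  have h2 := congrFun h (-x)
  fin_cases i
  · simpa using congrFun h2 1
  · simpa using congrFun h2 0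

section unique

variable {u v : ℝ → Fin 2 → ℂ} {l : ℝ}

lemma eq_of_sub_eq_zero (h : (fun x => u x - v x) = 0) : u = v := by
  ext x i
  have := congrFun (congrFun h x) i
  simpa [sub_eq_zero] using this

lemma tendsto_sub_zero_of_exp (hζ : ζ ^ 2 = l) {f g : ℝ → ℂ} {F : Filter ℝ}
    (hf : Tendsto (fun x : ℝ => exp (I * ζ ^ 2 * x) * f x) F (𝓝 1))
    (hg : Tendsto (fun x : ℝ => exp (I * ζ ^ 2 * x) * g x) F (𝓝 1)) :
    Tendsto (fun x => f x - g x) F (𝓝 0) := by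
  rw [← tendsto_exp_mul_zero hζ]
  simpa only [mul_sub, sub_self] using hf.sub hg

lemma tendsto_sub_zero_of_exp_neg (hζ : ζ ^ 2 = l) {f g : ℝ → ℂ} {F : Filter ℝ}
    (hf : Tendsto (fun x : ℝ => exp (-I * ζ ^ 2 * x) * f x) F (𝓝 1))
    (hg : Tendsto (fun x : ℝ => exp (-I * ζ ^ 2 * x) * g x) F (𝓝 1)) :
    Tendsto (fun x => f x - g x) F (𝓝 0) := by
  rw [← tendsto_exp_neg_mul_zero hζ]
  simpa only [mul_sub, sub_self] using hf.sub hg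

lemma tendsto_sub_zero {f g : ℝ → ℂ} {F : Filter ℝ} (hf : Tendsto f F (𝓝 0))
    (hg : Tendsto g F (𝓝 0)) : Tendsto (fun x => f x - g x) F (𝓝 0) := by
  simpa using hf.sub hg

lemma IsJostPsi.unique (hζ : ζ ^ 2 = l) (hu : IsJostPsi q r ζ u) (hv : IsJostPsi q r ζ v) :
    u = v :=
  eq_of_sub_eq_zero ((hu.1.sub hv.1).eq_zero_of_tendsto_atTop hζ
    (tendsto_sub_zero hu.2.1 hv.2.1) (tendsto_sub_zero_of_exp_neg hζ hu.2.2 hv.2.2))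

lemma IsJostPsiBar.unique (hζ : ζ ^ 2 = l) (hu : IsJostPsiBar q r ζ u)
    (hv : IsJostPsiBar q r ζ v) : u = v :=
  eq_of_sub_eq_zero ((hu.1.sub hv.1).eq_zero_of_tendsto_atTop hζ
    (tendsto_sub_zero_of_exp hζ hu.2.1 hv.2.1) (tendsto_sub_zero hu.2.2 hv.2.2))

lemma IsJostPhi.unique (hζ : ζ ^ 2 = l) (hu : IsJostPhi q r ζ u) (hv : IsJostPhi q r ζ v) :
    u = v :=
  eq_of_sub_eq_zero ((hu.1.sub hv.1).eq_zero_of_tendsto_atBot hζ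
    (tendsto_sub_zero_of_exp hζ hu.2.1 hv.2.1) (tendsto_sub_zero hu.2.2 hv.2.2))

lemma IsJostPhiBar.unique (hζ : ζ ^ 2 = l) (hu : IsJostPhiBar q r ζ u)
    (hv : IsJostPhiBar q r ζ v) : u = v :=
  eq_of_sub_eq_zero ((hu.1.sub hv.1).eq_zero_of_tendsto_atBot hζ
    (tendsto_sub_zero hu.2.1 hv.2.1) (tendsto_sub_zero_of_exp_neg hζ hu.2.2 hv.2.2))

end unique

/-- In `λA = D - (i/2)qB` the term with `q` vanishes at `-∞` because `B` has a limit there, so `A`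
inherits the limit of `e^{2iλx}D`. -/
lemma tendsto_jostA_atBot (q r : 𝓢(ℝ, ℂ)) {l : ℝ} (hl : l ≠ 0) :
    ∃ c, Tendsto (fun x : ℝ => exp (2 * I * l * x) * jostA q r l x) atBot (𝓝 c) := by
  have him : (0 : ℝ) ≤ (l : ℂ).im := by simp
  obtain ⟨c, hc⟩ := (jostKernel q r).tendsto_amplD_atBot l
  obtain ⟨b, hb⟩ := (jostKernel q r).tendsto_amplB_atBot him
  have h1 : Tendsto (fun x : ℝ => exp (2 * I * l * x) * (I / 2 * q x * jostB q r l x)) atBot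
      (𝓝 0) := by
    have h2 := ((tendsto_schwartz_atBot q).const_mul (I / 2)).mul hb
    rw [mul_zero, zero_mul] at h2
    rw [tendsto_zero_iff_norm_tendsto_zero] at h2 ⊢
    refine h2.congr fun x => ?_
    have : ‖exp (2 * I * l * x)‖ = 1 := by
      rw [Complex.norm_exp]; simp
    rw [norm_mul (exp _), this, one_mul]
    rfl
  refine ⟨_, ((hc.sub h1).const_mul (l : ℂ)⁻¹).congr fun x => ?_⟩
  have h3 := mul_jostA q r him x
  have h4 : (l : ℂ) ≠ 0 := ofReal_ne_zero.2 hl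
  have h5 : amplD (kernelD q r) l x = jostD q r l x := rfl
  rw [h5, ← mul_sub, ← h3]
  field_simp

section identification

variable (q r) {l : ℝ} (hζ : ζ ^ 2 = l)
include hζ

lemma psi_eq : psi q r ζ = psiSol q r ζ :=
  (Classical.epsilon_spec ⟨_, isJostPsi_psiSol q r hζ⟩ : IsJostPsi q r ζ (psi q r ζ)).unique hζ
    (isJostPsi_psiSol q r hζ)

lemma psiBar_eq : psiBar q r ζ = swapVec (psiSol (rot r) (rot q) (I * ζ)) :=
  (Classical.epsilon_spec ⟨_, isJostPsiBar_swap q r hζ⟩ :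
    IsJostPsiBar q r ζ (psiBar q r ζ)).unique hζ (isJostPsiBar_swap q r hζ)

lemma phi_eq : phi q r ζ = phiSol q r ζ :=
  (Classical.epsilon_spec ⟨_, isJostPhi_phiSol q r hζ⟩ : IsJostPhi q r ζ (phi q r ζ)).unique hζ
    (isJostPhi_phiSol q r hζ)

lemma phiBar_eq : phiBar q r ζ = swapVec (phiSol (rot r) (rot q) (I * ζ)) :=
  (Classical.epsilon_spec ⟨_, isJostPhiBar_swap q r hζ⟩ :
    IsJostPhiBar q r ζ (phiBar q r ζ)).unique hζ (isJostPhiBar_swap q r hζ)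

/-! ### Scattering coefficients -/

lemma exp_mul_phiSol_zero (x : ℝ) :
    exp (I * ζ ^ 2 * x) * phiSol q r ζ x 0 = jostB (refl r) (refl q) l (-x) := by
  simp only [phiSol, reflVec_zero, psiSol_one]
  rw [← mul_assoc, ← Complex.exp_add, hζ]
  push_cast
  ring_nf
  simp

lemma exp_mul_phiSol_one (x : ℝ) :
    exp (-I * ζ ^ 2 * x) * phiSol q r ζ x 1 =
      ζ * (exp (2 * I * l * (-x : ℝ)) * jostA (refl r) (refl q) l (-x)) := by
  simp only [phiSol, reflVec_one, psiSol_zero]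
  rw [← mul_assoc, ← Complex.exp_add, hζ]
  push_cast
  ring_nf

lemma tendsto_phi_zero :
    Tendsto (fun x : ℝ => exp (I * ζ ^ 2 * x) * phi q r ζ x 0) atTop (𝓝 (invT q r ζ)) := by
  obtain ⟨b, hb⟩ := (jostKernel (refl r) (refl q)).tendsto_amplB_atBot (l := (l : ℂ)) (by simp)
  refine tendsto_nhds_limUnder ⟨b, ?_⟩
  simp only [phi_eq q r hζ, exp_mul_phiSol_zero q r hζ]
  exact hb.comp tendsto_neg_atTop_atBot

lemma tendsto_phi_one :
    Tendsto (fun x : ℝ => exp (-I * ζ ^ 2 * x) * phi q r ζ x 1) atTop (𝓝 (RdivT q r ζ)) := by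
  simp only [RdivT]
  -- At `λ = 0` no limit of `A` is available, but the prefactor `ζ = 0` makes the expression
  -- identically zero.
  by_cases hl : l = 0
  · have h0 : ζ = 0 := by
      rw [hl] at hζ
      simpa using hζ
    refine tendsto_nhds_limUnder ⟨0, ?_⟩
    refine tendsto_const_nhds.congr fun x => ?_
    rw [phi_eq q r hζ, exp_mul_phiSol_one q r hζ, h0, zero_mul]
  · obtain ⟨b, hb⟩ := tendsto_jostA_atBot (refl r) (refl q) hl
    refine tendsto_nhds_limUnder ⟨ζ * b, ?_⟩
    simp only [phi_eq q r hζ, exp_mul_phiSol_one q r hζ]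
    exact (hb.comp tendsto_neg_atTop_atBot).const_mul ζ

lemma phiBar_eq_swap_phi : phiBar q r ζ = swapVec (phi (rot r) (rot q) (I * ζ)) := by
  rw [phiBar_eq q r hζ, phi_eq (rot r) (rot q) (l := -l) (by rw [mul_pow, I_sq, hζ]; simp)]

lemma invTBar_eq : invTBar q r ζ = invT (rot r) (rot q) (I * ζ) := by
  unfold invTBar invT
  rw [phiBar_eq_swap_phi q r hζ]
  congr 1
  ext x
  rw [swapVec_one, mul_pow, I_sq]
  ring_nf

lemma RBarDivTBar_eq : RBarDivTBar q r ζ = RdivT (rot r) (rot q) (I * ζ) := by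
  unfold RBarDivTBar RdivT
  rw [phiBar_eq_swap_phi q r hζ]
  congr 1
  ext x
  rw [swapVec_zero, mul_pow, I_sq]
  ring_nf

/-- At real energy the Jost solutions exist, are unique, and have scattering amplitudes. -/
lemma scatteringWellDefined : ScatteringWellDefined q r ζ := by
  have hζ' : (I * ζ) ^ 2 = ((-l : ℝ) : ℂ) := by rw [mul_pow, I_sq, hζ]; simp
  refine ⟨⟨_, isJostPsi_psiSol q r hζ, fun v hv => hv.unique hζ (isJostPsi_psiSol q r hζ)⟩,
    ⟨_, isJostPsiBar_swap q r hζ, fun v hv => hv.unique hζ (isJostPsiBar_swap q r hζ)⟩,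
    ⟨_, isJostPhi_phiSol q r hζ, fun v hv => hv.unique hζ (isJostPhi_phiSol q r hζ)⟩,
    ⟨_, isJostPhiBar_swap q r hζ, fun v hv => hv.unique hζ (isJostPhiBar_swap q r hζ)⟩,
    tendsto_phi_zero q r hζ, tendsto_phi_one q r hζ, ?_, ?_⟩
  · rw [invTBar_eq q r hζ, phiBar_eq_swap_phi q r hζ]
    refine (tendsto_phi_zero (rot r) (rot q) hζ').congr fun x => ?_
    rw [swapVec_one, mul_pow, I_sq]
    ring_nf
  · rw [RBarDivTBar_eq q r hζ, phiBar_eq_swap_phi q r hζ]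
    refine (tendsto_phi_one (rot r) (rot q) hζ').congr fun x => ?_
    rw [swapVec_zero, mul_pow, I_sq]
    ring_nf

end identification

end solutions

/-! ### Wronskians of Jost solutions -/

/-- `1 / T` as a function of `λ` in the closed upper half-plane. -/
def aCoef (q r : 𝓢(ℝ, ℂ)) (l : ℂ) : ℂ :=
  jostB (refl r) (refl q) l 0 * jostB q r l 0 -
    l * (jostA (refl r) (refl q) l 0 * jostA q r l 0)

/-- `R / (ζ T)` as a function of real `λ`. -/
def bCoef (q r : 𝓢(ℝ, ℂ)) (l : ℝ) : ℂ :=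
  jostB (rot r) (rot q) (-l) 0 * jostA (refl r) (refl q) l 0 -
    I * (jostA (rot r) (rot q) (-l) 0 * jostB (refl r) (refl q) l 0)

lemma exp_mul_exp_neg_ofReal (l : ℂ) (x : ℝ) :
    exp (I * l * (-x : ℝ)) * exp (I * l * x) = 1 := by
  rw [← Complex.exp_add]
  push_cast
  ring_nf
  simp

section coefficients

variable (q r : 𝓢(ℝ, ℂ)) {ζ : ℂ}

lemma wronskian_phiSol_psiSol_apply (ζ : ℂ) (x : ℝ) :
    wronskian (phiSol q r ζ) (psiSol q r ζ) x =
      jostB (refl r) (refl q) (ζ ^ 2) (-x) * jostB q r (ζ ^ 2) x -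
        ζ ^ 2 * (jostA (refl r) (refl q) (ζ ^ 2) (-x) * jostA q r (ζ ^ 2) x) := by
  simp only [wronskian, phiSol, reflVec_zero, reflVec_one, psiSol_zero, psiSol_one]
  linear_combination (jostB (refl r) (refl q) (ζ ^ 2) (-x) * jostB q r (ζ ^ 2) x -
    ζ ^ 2 * (jostA (refl r) (refl q) (ζ ^ 2) (-x) * jostA q r (ζ ^ 2) x)) *
    exp_mul_exp_neg_ofReal (ζ ^ 2) x

lemma wronskian_phiSol_psiSol (hζ : 0 ≤ (ζ ^ 2).im) (x : ℝ) :
    wronskian (phiSol q r ζ) (psiSol q r ζ) x = aCoef q r (ζ ^ 2) := by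
  rw [wronskian_const (isSolution_phiSol q r hζ) (isSolution_psiSol q r hζ) x 0,
    wronskian_phiSol_psiSol_apply]
  simp [aCoef]

variable {l : ℝ} (hζ : ζ ^ 2 = l)
include hζ

lemma wronskian_psiBarSol_phiSol (x : ℝ) :
    wronskian (swapVec (psiSol (rot r) (rot q) (I * ζ))) (phiSol q r ζ) x = ζ * bCoef q r l := by
  rw [wronskian_const (isJostPsiBar_swap q r hζ).1 (isSolution_phiSol q r (by simp [hζ])) x 0]
  simp only [wronskian, phiSol, reflVec_zero, reflVec_one, psiSol_zero, psiSol_one, swapVec_zero,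
    swapVec_one, bCoef, mul_pow, I_sq, hζ]
  simp
  ring

lemma invT_eq : invT q r ζ = aCoef q r l := by
  have h1 := isJostPhi_phiSol q r hζ
  have h2 := isJostPsi_psiSol q r hζ
  have e0 := tendsto_phi_zero q r hζ
  have e1 := tendsto_phi_one q r hζ
  rw [phi_eq q r hζ] at e0 e1
  have h3 := wronskian_eq_of_tendsto h1.1 h2.1 e0 e1 ((tendsto_exp_mul_zero hζ).2 h2.2.1) h2.2.2 0
  rw [wronskian_phiSol_psiSol q r (by simp [hζ]), hζ] at h3
  rw [h3]
  ring

lemma RdivT_eq : RdivT q r ζ = ζ * bCoef q r l := by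
  have h1 := isJostPhi_phiSol q r hζ
  have h2 := isJostPsiBar_swap q r hζ
  have e0 := tendsto_phi_zero q r hζ
  have e1 := tendsto_phi_one q r hζ
  rw [phi_eq q r hζ] at e0 e1
  have h3 := wronskian_eq_of_tendsto h2.1 h1.1 h2.2.1 ((tendsto_exp_neg_mul_zero hζ).2 h2.2.2)
    e0 e1 0
  rw [wronskian_psiBarSol_phiSol q r hζ] at h3
  rw [h3]
  ring

omit hζ

/-- The expansion `φ = aψ̄ + ζbψ`, written for amplitudes: take the Wronskians `W(φ,ψ) = a`,
`W(ψ̄,φ) = ζb`, `W(ψ̄,ψ) = 1` and solve. The other component carries an overall factor `ζ`, whence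
`l ≠ 0` in the second identity. -/
lemma jost_relation (l : ℝ) (x : ℝ) :
    jostB (refl r) (refl q) l (-x) = aCoef q r l * jostB (rot r) (rot q) (-l) x +
      l * bCoef q r l * exp (2 * I * l * x) * jostA q r l x ∧
    (l ≠ 0 → jostA (refl r) (refl q) l (-x) = I * aCoef q r l * jostA (rot r) (rot q) (-l) x +
      bCoef q r l * exp (2 * I * l * x) * jostB q r l x) := by
  -- Any square root serves, since only `ζ²` survives in the conclusion.
  obtain ⟨ζ, hζ⟩ := IsAlgClosed.exists_pow_nat_eq (l : ℂ) (n := 2) (by norm_num)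
  have w1 := wronskian_phiSol_psiSol q r (ζ := ζ) (by simp [hζ]) x
  have w2 := wronskian_psiBarSol_phiSol q r hζ x
  have w3 := wronskian_psiBar_psi hζ (isJostPsiBar_swap q r hζ) (isJostPsi_psiSol q r hζ) x
  have e1 := exp_mul_exp_neg_ofReal l x
  have e2 : exp (2 * I * l * x) = exp (I * l * x) * exp (I * l * x) := by
    rw [← Complex.exp_add]; ring_nf
  have e3 : exp (I * -l * x) = exp (I * l * (-x : ℝ)) := by push_cast; ring_nf
  have hI : (I * ζ) ^ 2 = -l := by rw [mul_pow, I_sq, hζ]; ring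
  simp only [wronskian, phiSol, reflVec_zero, reflVec_one, psiSol_zero, psiSol_one, swapVec_zero,
    swapVec_one, hI, hζ, e3] at w1 w2 w3
  rw [e2]
  set a := aCoef q r l
  set b := bCoef q r l
  set E := exp (I * l * x)
  set F := exp (I * l * (-x : ℝ))
  set A' := jostA (refl r) (refl q) l (-x)
  set B' := jostB (refl r) (refl q) l (-x)
  set A := jostA q r l x
  set B := jostB q r l x
  set Ah := jostA (rot r) (rot q) (-l) x
  set Bh := jostB (rot r) (rot q) (-l) x
  have hl : (l : ℂ) = ζ ^ 2 := hζ.symm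
  refine ⟨?_, fun h0 => ?_⟩
  · rw [hl]
    linear_combination E * (-(F * B') * w3 + F * Bh * w1 + E * (ζ * A) * w2) -
      (B' - a * Bh) * e1
  · have hz : ζ ≠ 0 := by
      rintro rfl
      simp at hζ
      exact h0 (ofReal_eq_zero.1 hζ.symm)
    refine mul_left_cancel₀ hz ?_
    linear_combination E * (-(F * (ζ * A')) * w3 + F * (I * ζ * Ah) * w1 + E * B * w2) -
      (ζ * A' - a * (I * ζ * Ah)) * e1

/-! ### Large energies -/

/-- For `λ ≠ 0`, `b` is the limit of `e^{2iλy}A(y)` as `y → -∞`, with `A` the amplitude for the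
reflected potentials. There `λA = D - (i/2)qB` loses the potential terms, so `λ³b` is a limit of
expressions controlled by the second-order bound on `D`. This is where uniformity of that bound in
space is needed. -/
lemma norm_pow_three_mul_bCoef_le : ∃ K, 0 ≤ K ∧ ∀ l : ℝ, ‖(l : ℂ) ^ 3 * bCoef q r l‖ ≤ K := by
  obtain ⟨K, hK0, hK⟩ := exists_jostD_asymptotic (refl r) (refl q)
  refine ⟨K, hK0, fun l => ?_⟩
  rcases eq_or_ne l 0 with rfl | hl0
  · simpa using hK0
  obtain ⟨ζ, hζ⟩ := IsAlgClosed.exists_pow_nat_eq (l : ℂ) (n := 2) (by norm_num)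
  have hl : (l : ℂ) ≠ 0 := ofReal_ne_zero.2 hl0
  have him : (0 : ℝ) ≤ (l : ℂ).im := by simp
  have hz : ζ ≠ 0 := by rintro rfl; simp at hζ; exact hl0 (ofReal_eq_zero.1 hζ.symm)
  have h1 := tendsto_phi_one q r hζ
  rw [phi_eq q r hζ, RdivT_eq q r hζ] at h1
  simp only [exp_mul_phiSol_one q r hζ] at h1
  have h2 := (h1.const_mul ((l : ℂ) ^ 3 * ζ⁻¹)).norm
  obtain ⟨b, hb⟩ := (jostKernel (refl r) (refl q)).tendsto_amplB_atBot him
  have hb' := hb.comp tendsto_neg_atTop_atBot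
  have h3 := ((tendsto_schwartz_atBot (aknsPotential (refl r) (refl q))).comp
    tendsto_neg_atTop_atBot).mul hb'
  have h4 := ((tendsto_schwartz_atBot (refl r)).comp tendsto_neg_atTop_atBot).mul hb'
  rw [zero_mul] at h3 h4
  have h5 := ((h3.norm.const_mul (‖(l : ℂ)‖ * (1 / 2))).add
    (h4.norm.const_mul (‖(l : ℂ)‖ ^ 2 * (1 / 2)))).const_add K
  simp only [norm_zero, mul_zero, add_zero] at h5
  have e : (l : ℂ) ^ 3 * ζ⁻¹ * (ζ * bCoef q r l) = (l : ℂ) ^ 3 * bCoef q r l := by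
    field_simp
  rw [e] at h2
  refine le_of_tendsto_of_tendsto' h2 h5 fun x => ?_
  have h6 := (hK l him (-x)).2
  have h7 := mul_jostA (refl r) (refl q) him (-x)
  have h8 : ‖exp (2 * I * l * (-x : ℝ))‖ = 1 := by rw [Complex.norm_exp]; simp
  have e2 : (l : ℂ) ^ 3 * ζ⁻¹ * (ζ * (exp (2 * I * l * (-x : ℝ)) * jostA (refl r) (refl q) l (-x)))
      = exp (2 * I * l * (-x : ℝ)) * (l * (l * jostD (refl r) (refl q) l (-x) + I / 2 *
        (aknsPotential (refl r) (refl q) (-x) * jostB (refl r) (refl q) l (-x))) -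
        l * (I / 2 * (aknsPotential (refl r) (refl q) (-x) * jostB (refl r) (refl q) l (-x))) -
        l ^ 2 * (I / 2 * (refl r (-x) * jostB (refl r) (refl q) l (-x)))) := by
    linear_combination (l : ℂ) ^ 2 * exp (2 * I * l * (-x : ℝ)) * h7 + (l : ℂ) ^ 3 *
      (exp (2 * I * l * (-x : ℝ)) * jostA (refl r) (refl q) l (-x)) * inv_mul_cancel₀ hz
  rw [e2, norm_mul, h8, one_mul]
  refine (norm_sub_le _ _).trans (add_le_add (norm_sub_le _ _) le_rfl |>.trans ?_)
  have hI : ‖I / 2‖ = 1 / 2 := by simp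
  simp only [norm_mul, hI, norm_pow, Function.comp_apply] at h6 ⊢
  have : jostB (refl r) (refl q) l (-x) = amplB (kernelB (refl r) (refl q)) l (-x) := rfl
  rw [this] at h6 ⊢
  linarith

lemma continuous_bCoef : Continuous (bCoef q r) := by
  have h1 : ∀ (q r : 𝓢(ℝ, ℂ)), Continuous fun l : ℝ => jostA q r l 0 := fun q r =>
    (continuousOn_jostA q r 0).comp_continuous continuous_ofReal fun x => by simp
  have h2 : ∀ (q r : 𝓢(ℝ, ℂ)), Continuous fun l : ℝ => jostB q r l 0 := fun q r =>
    (continuousOn_jostB q r 0).comp_continuous continuous_ofReal fun x => by simp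
  have h3 := (h1 (rot r) (rot q)).comp continuous_neg
  have h4 := (h2 (rot r) (rot q)).comp continuous_neg
  simp only [Function.comp_def, ofReal_neg] at h3 h4
  exact (h4.mul (h1 _ _)).sub (continuous_const.mul (h3.mul (h2 _ _)))

lemma continuousOn_aCoef : ContinuousOn (aCoef q r) {l | 0 ≤ l.im} :=
  ((continuousOn_jostB _ _ 0).mul (continuousOn_jostB _ _ 0)).sub
    (continuousOn_id.mul ((continuousOn_jostA _ _ 0).mul (continuousOn_jostA _ _ 0)))

lemma differentiableOn_aCoef : DifferentiableOn ℂ (aCoef q r) {l | 0 < l.im} :=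
  ((differentiableOn_jostB _ _ 0).mul (differentiableOn_jostB _ _ 0)).sub
    (differentiableOn_id.mul ((differentiableOn_jostA _ _ 0).mul (differentiableOn_jostA _ _ 0)))

lemma exists_jostB_bound (x : ℝ) : ∃ K, 0 ≤ K ∧ ∀ l : ℂ, 0 ≤ l.im → ‖jostB q r l x‖ ≤ K :=
  ⟨_, (norm_nonneg _).trans ((jostKernel q r).norm_amplB_le (l := 0) (by simp) x),
    fun _ hl => (jostKernel q r).norm_amplB_le hl x⟩

lemma norm_mul_aCoef_sub_one_le : ∃ K, 0 ≤ K ∧ ∀ l : ℂ, 0 ≤ l.im →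
    ‖l * (aCoef q r l - 1)‖ ≤ K := by
  obtain ⟨K1, c1, h1⟩ := exists_jostB_asymptotic q r 0
  obtain ⟨K2, c2, h2⟩ := exists_jostB_asymptotic (refl r) (refl q) 0
  obtain ⟨K3, c3, h3⟩ := exists_jostA_asymptotic q r 0
  obtain ⟨K4, c4, h4⟩ := exists_jostA_asymptotic (refl r) (refl q) 0
  obtain ⟨M, hM0, hM⟩ := exists_jostB_bound q r 0
  have p1 : 0 ≤ K1 := (norm_nonneg _).trans (h1 0 (by simp)).1
  have p2 : 0 ≤ K2 := (norm_nonneg _).trans (h2 0 (by simp)).1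
  have p3 : 0 ≤ K3 := (norm_nonneg _).trans (h3 0 (by simp)).1
  have p4 : 0 ≤ K4 := (norm_nonneg _).trans (h4 0 (by simp)).1
  refine ⟨K2 * M + K1 + K4 * K3, by positivity, fun l hl => ?_⟩
  have e : l * (aCoef q r l - 1) = l * (jostB (refl r) (refl q) l 0 - 1) * jostB q r l 0 +
      l * (jostB q r l 0 - 1) - (l * jostA (refl r) (refl q) l 0) * (l * jostA q r l 0) := by
    unfold aCoef; ring
  rw [e]
  refine (norm_sub_le _ _).trans (add_le_add ((norm_add_le _ _).trans (add_le_add ?_ ?_)) ?_)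
  · rw [norm_mul]
    exact mul_le_mul (h2 l hl).1 (hM l hl) (norm_nonneg _) p2
  · exact (h1 l hl).1
  · rw [norm_mul]
    exact mul_le_mul (h4 l hl).1 (h3 l hl).1 (norm_nonneg _) p4

/-- Outside the half-disc of radius `2K + 1` one has `|a - 1| ≤ 1/2`; on the compact half-disc `1/a`
is continuous. -/
lemma exists_inv_aCoef_bound (ha : ∀ l : ℂ, 0 ≤ l.im → aCoef q r l ≠ 0) :
    ∃ M, 0 ≤ M ∧ ∀ l : ℂ, 0 ≤ l.im → ‖(aCoef q r l)⁻¹‖ ≤ M := by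
  obtain ⟨K, hK0, hK⟩ := norm_mul_aCoef_sub_one_le q r
  have hcl : IsClosed {l : ℂ | 0 ≤ l.im} := isClosed_le continuous_const continuous_im
  have hcomp : IsCompact (Metric.closedBall (0 : ℂ) (2 * K + 1) ∩ {l | 0 ≤ l.im}) :=
    (isCompact_closedBall _ _).inter_right hcl
  obtain ⟨M, hM⟩ := hcomp.exists_bound_of_continuousOn
    (((continuousOn_aCoef q r).inv₀ ha).mono Set.inter_subset_right)
  refine ⟨max M 2, by positivity, fun l hl => ?_⟩
  by_cases h : ‖l‖ ≤ 2 * K + 1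
  · exact (hM l ⟨by simpa using h, hl⟩).trans (le_max_left _ _)
  · push Not at h
    refine le_max_of_le_right ?_
    have h1 := hK l hl
    rw [norm_mul] at h1
    have h2 : ‖aCoef q r l - 1‖ ≤ 1 / 2 := by
      by_contra! h3
      nlinarith [norm_nonneg l]
    have h3 : 1 / 2 ≤ ‖aCoef q r l‖ := by
      have := norm_sub_norm_le (1 : ℂ) (1 - aCoef q r l)
      rw [sub_sub_cancel, norm_one, norm_sub_rev] at this
      linarith
    rw [norm_inv]
    exact inv_le_of_inv_le₀ (by norm_num) (by linarith)

end coefficients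

/-! ### Zeros of the transmission denominator are bound states -/

lemma tendsto_exp_mul_one_add_sq_pow {η : ℝ} (hη : 0 < η) :
    Tendsto (fun x : ℝ => Real.exp (-η * x) * (1 + x ^ 2) ^ 4) atTop (𝓝 0) := by
  have h := fun k => isLittleO_pow_exp_pos_mul_atTop k hη
  have h1 : (fun x : ℝ => (1 + x ^ 2) ^ 4) =o[atTop] fun x => Real.exp (η * x) := by
    have h2 := ((((h 0).add ((h 2).const_mul_left 4)).add ((h 4).const_mul_left 6)).add
      ((h 6).const_mul_left 4)).add (h 8)
    refine h2.congr_left fun x => ?_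
    ring
  refine h1.tendsto_div_nhds_zero.congr fun x => ?_
  rw [neg_mul, Real.exp_neg]
  ring

/-- The exponential absorbs one more factor `1 + x²` than needed to offset the polynomial growth, so
`u` is `O(wt)` at both ends. -/
lemma memLp_two_of_exp_decay {u : ℝ → ℂ} (hu : Continuous u) {η C X : ℝ} (hη : 0 < η) (hC : 0 ≤ C)
    (h1 : ∀ x, X ≤ x → ‖u x‖ ≤ C * (Real.exp (-η * x) * (1 + x ^ 2) ^ 3))
    (h2 : ∀ x, ‖u x‖ ≤ C * (Real.exp (η * x) * (1 + x ^ 2) ^ 3)) : MemLp u 2 volume := by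
  have hev := (tendsto_exp_mul_one_add_sq_pow hη).eventually (gt_mem_nhds one_pos)
  have hle : ∀ x : ℝ, Real.exp (-η * x) * (1 + x ^ 2) ^ 4 < 1 →
      C * (Real.exp (-η * x) * (1 + x ^ 2) ^ 3) ≤ C * wt x := by
    intro x hx
    refine mul_le_mul_of_nonneg_left ?_ hC
    have hw := wt_pos x
    calc _ = Real.exp (-η * x) * (1 + x ^ 2) ^ 3 * (wt x * (1 + x ^ 2)) := by rw [wt_mul]; ring
      _ = wt x * (Real.exp (-η * x) * (1 + x ^ 2) ^ 4) := by ring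
      _ ≤ wt x := mul_le_of_le_one_right hw.le hx.le
  have ht : (fun x => ‖u x‖ ^ 2) =O[atTop] wt := by
    refine Asymptotics.IsBigO.of_bound (C ^ 2) ?_
    filter_upwards [hev, eventually_ge_atTop X] with x hx hX
    have h3 := (h1 x hX).trans (hle x hx)
    have hw := wt_pos x
    rw [Real.norm_of_nonneg (by positivity), Real.norm_of_nonneg hw.le]
    calc _ ≤ (C * wt x) ^ 2 := by gcongr
      _ = C ^ 2 * wt x * wt x := by ring
      _ ≤ _ := mul_le_of_le_one_right (by positivity) (wt_le_one x)
  have hb : (fun x => ‖u x‖ ^ 2) =O[atBot] wt := by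
    refine Asymptotics.IsBigO.of_bound (C ^ 2) ?_
    filter_upwards [tendsto_neg_atBot_atTop.eventually hev] with x hx
    have h3 := hle (-x) hx
    have h4 : wt (-x) = wt x := by simp [wt]
    rw [h4, neg_mul_neg, neg_sq] at h3
    replace h3 := (h2 x).trans h3
    have hw := wt_pos x
    rw [Real.norm_of_nonneg (by positivity), Real.norm_of_nonneg hw.le]
    calc _ ≤ (C * wt x) ^ 2 := by gcongr
      _ = C ^ 2 * wt x * wt x := by ring
      _ ≤ _ := mul_le_of_le_one_right (by positivity) (wt_le_one x)
  rw [memLp_two_iff_integrable_sq_norm hu.aestronglyMeasurable]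
  have hc : Continuous fun x => ‖u x‖ ^ 2 := by fun_prop
  exact hc.locallyIntegrable.integrable_of_isBigO_atBot_atTop hb
    ⟨_, Filter.univ_mem, integrable_wt.integrableOn⟩ ht ⟨_, Filter.univ_mem, integrable_wt.integrableOn⟩

lemma exists_psiSol_bound (q r : 𝓢(ℝ, ℂ)) {ζ : ℂ} (hζ : 0 ≤ (ζ ^ 2).im) (h0 : ζ ≠ 0) :
    ∃ C, 0 ≤ C ∧ ∀ x i, ‖psiSol q r ζ x i‖ ≤
      C * (Real.exp (-(ζ ^ 2).im * x) * (1 + x ^ 2) ^ 3) := by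
  have hk := jostKernel q r
  have hC := hk.nonneg
  set C := kernelBound q r
  obtain ⟨M, hM0, hM⟩ := exists_wt_bound q 0
  simp only [pow_zero, mul_one] at hM
  have hB : ∀ x, ‖jostB q r (ζ ^ 2) x‖ ≤ (1 + C * Real.pi) * (1 + x ^ 2) ^ 3 :=
    hk.norm_amplB_le hζ
  have hD : ∀ x, ‖jostD q r (ζ ^ 2) x‖ ≤ C * Real.pi * (1 + x ^ 2) ^ 3 := hk.norm_amplD_le hζ
  have hexp : ∀ x : ℝ, ‖exp (I * ζ ^ 2 * x)‖ = Real.exp (-(ζ ^ 2).im * x) := fun x => by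
    rw [Complex.norm_exp]; simp
  have hz : 0 < ‖ζ‖ := norm_pos_iff.2 h0
  refine ⟨(1 + C * Real.pi) + ‖ζ‖⁻¹ * (C * Real.pi + 1 / 2 * M * (1 + C * Real.pi)),
    by positivity, fun x i => ?_⟩
  have hA : ‖ζ * jostA q r (ζ ^ 2) x‖ ≤
      ‖ζ‖⁻¹ * (C * Real.pi + 1 / 2 * M * (1 + C * Real.pi)) * (1 + x ^ 2) ^ 3 := by
    have e : ζ * jostA q r (ζ ^ 2) x =
        ζ⁻¹ * (jostD q r (ζ ^ 2) x - I / 2 * q x * jostB q r (ζ ^ 2) x) := by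
      rw [← mul_jostA q r hζ]
      field_simp
    rw [e, norm_mul, norm_inv, mul_assoc ‖ζ‖⁻¹]
    refine mul_le_mul_of_nonneg_left ((norm_sub_le (_ : ℂ) _).trans ?_) (by positivity)
    rw [add_mul]
    refine add_le_add (hD x) ?_
    have hI : ‖I / 2‖ = 1 / 2 := by simp
    rw [norm_mul, norm_mul, hI, mul_assoc (1 / 2 * M)]
    exact mul_le_mul (mul_le_mul_of_nonneg_left (hM x) (by norm_num)) (hB x) (norm_nonneg _)
      (by positivity)
  have key : ∀ (c : ℂ) (N N' : ℝ), 0 ≤ N' → ‖c‖ ≤ N * (1 + x ^ 2) ^ 3 →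
      ‖exp (I * ζ ^ 2 * x) * c‖ ≤ (N + N') * (Real.exp (-(ζ ^ 2).im * x) * (1 + x ^ 2) ^ 3) := by
    intro c N N' hN' hc
    rw [norm_mul, hexp]
    calc _ ≤ Real.exp (-(ζ ^ 2).im * x) * ((N + N') * (1 + x ^ 2) ^ 3) := by
          gcongr
          refine hc.trans ?_
          gcongr
          linarith
      _ = _ := by ring
  fin_cases i
  · have := key _ _ (1 + C * Real.pi) (by positivity) hA
    rwa [add_comm] at this
  · exact key _ _ _ (by positivity) (hB x)

lemma IsSolution.continuous {q r : ℝ → ℂ} {ζ : ℂ} {w : ℝ → Fin 2 → ℂ} (h : IsSolution q r ζ w) :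
    Continuous w := continuous_iff_continuousAt.2 fun x => (h x).continuousAt

/-- The derivative of `u₂/v₂` is a multiple of the Wronskian. The quotient requires `v₂ ≠ 0`, so
proportionality is only claimed to the right of `X`. -/
lemma IsSolution.eq_smul_of_wronskian_eq_zero {q r : ℝ → ℂ} {ζ : ℂ} {u v : ℝ → Fin 2 → ℂ}
    (hu : IsSolution q r ζ u) (hv : IsSolution q r ζ v) (hw : ∀ x, wronskian u v x = 0) {X : ℝ}
    (hX : ∀ x, X ≤ x → v x 1 ≠ 0) : ∃ c : ℂ, ∀ x, X ≤ x → ∀ i, u x i = c * v x i := by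
  rw [isSolution_iff] at hu hv
  refine ⟨u X 1 / v X 1, fun x hx => ?_⟩
  have hd : ∀ y, X ≤ y → HasDerivAt (fun y => u y 1 / v y 1) 0 y := fun y hy => by
    refine ((hu.2 y).div (hv.2 y) (hX y hy)).congr_deriv ?_
    have := hw y
    unfold wronskian at this
    rw [div_eq_zero_iff]
    left
    linear_combination ζ * r y * this
  have h1 : u x 1 / v x 1 = u X 1 / v X 1 :=
    constant_of_has_deriv_right_zero (f := fun y => u y 1 / v y 1)
      (fun y hy => (hd y hy.1).continuousAt.continuousWithinAt)
      (fun y hy => (hd y hy.1).hasDerivWithinAt) x ⟨hx, le_rfl⟩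
  have h2 : u x 1 = u X 1 / v X 1 * v x 1 := by
    rw [← h1, div_mul_cancel₀ _ (hX x hx)]
  have h3 : u x 0 = u X 1 / v X 1 * v x 0 := by
    have h4 := hw x
    unfold wronskian at h4
    refine mul_right_cancel₀ (hX x hx) ?_
    linear_combination h4 + v x 0 * h2
  exact Fin.forall_fin_two.2 ⟨h3, h2⟩

/-- If `a` vanishes, `φ` is a multiple of `ψ` near `+∞` and decays there as well as at `-∞`. It is
then square-integrable, hence zero, contradicting its normalization. -/
lemma aCoef_ne_zero {q r : 𝓢(ℝ, ℂ)} (h : NoBoundStates q r) {l : ℂ} (hl : 0 < l.im) :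
    aCoef q r l ≠ 0 := by
  intro ha
  obtain ⟨ζ, rfl⟩ := IsAlgClosed.exists_pow_nat_eq l (n := 2) (by norm_num)
  have hz : ζ ≠ 0 := by rintro rfl; simp at hl
  have hw : ∀ x, wronskian (phiSol q r ζ) (psiSol q r ζ) x = 0 := fun x => by
    rw [wronskian_phiSol_psiSol q r hl.le, ha]
  have hphi := isSolution_phiSol q r hl.le
  obtain ⟨X, hX⟩ := eventually_atTop.1
    ((tendsto_jostB q r hl.le).eventually_ne one_ne_zero)
  -- `X` is chosen so that `B`, which tends to `1`, has no zero beyond it; then `ψ₂` has none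
  -- either.
  obtain ⟨c, hc⟩ := hphi.eq_smul_of_wronskian_eq_zero (isSolution_psiSol q r hl.le) hw
    (X := X) fun x hx => mul_ne_zero (Complex.exp_ne_zero _) (hX x hx)
  obtain ⟨C1, hC1, h1⟩ := exists_psiSol_bound q r hl.le hz
  obtain ⟨C2, hC2, h2⟩ := exists_psiSol_bound (refl r) (refl q) hl.le hz
  have hL : MemLp (phiSol q r ζ) 2 volume := by
    rw [memLp_pi_iff]
    intro i
    refine memLp_two_of_exp_decay (continuous_pi_iff.1 hphi.continuous i) hl
      (C := ‖c‖ * C1 + C2) (X := X) (by positivity) (fun x hx => ?_) (fun x => ?_)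
    · rw [hc x hx i, norm_mul]
      calc _ ≤ ‖c‖ * (C1 * (Real.exp (-(ζ ^ 2).im * x) * (1 + x ^ 2) ^ 3)) := by
            gcongr; exact h1 x i
        _ ≤ _ := by
            rw [← mul_assoc]
            gcongr
            linarith
    · have h3 : ‖phiSol q r ζ x i‖ ≤ C2 * (Real.exp ((ζ ^ 2).im * x) * (1 + x ^ 2) ^ 3) := by
        have h4 := h2 (-x)
        rw [neg_mul_neg, neg_sq] at h4
        fin_cases i
        exacts [h4 1, h4 0]
      refine h3.trans ?_
      gcongr
      exact le_add_of_nonneg_left (by positivity)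
  have h0 := h ζ _ hphi hL
  have hne : ∀ x, jostB (refl r) (refl q) (ζ ^ 2) x = 0 := fun x => by
    have h5 := congrFun (congrFun h0 (-x)) 0
    simp only [phiSol, reflVec_zero, neg_neg, psiSol_one, Pi.zero_apply] at h5
    exact (mul_eq_zero.1 h5).resolve_left (Complex.exp_ne_zero _)
  have h6 := tendsto_jostB (refl r) (refl q) hl.le
  exact one_ne_zero (tendsto_nhds_unique (h6.congr hne) tendsto_const_nhds)

lemma memLp_swapVec {w : ℝ → Fin 2 → ℂ} (h : MemLp w 2 volume) :
    MemLp (swapVec w) 2 volume := by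
  rw [memLp_pi_iff] at h ⊢
  exact Fin.forall_fin_two.2 ⟨h 1, h 0⟩

lemma NoBoundStates.rotate {q r : 𝓢(ℝ, ℂ)} (h : NoBoundStates q r) :
    NoBoundStates (rot r) (rot q) := by
  intro ζ w hw hL
  have h1 : IsSolution (rot r) (rot q) (I * (-I * ζ)) w := by
    rwa [← mul_assoc, mul_neg, I_mul_I, neg_neg, one_mul]
  have h2 := h _ _ h1.swap (memLp_swapVec hL)
  ext x i
  have h3 := congrFun h2 x
  fin_cases i
  · simpa using congrFun h3 1
  · simpa using congrFun h3 0

lemma zeta_sq (l : ℝ) : zeta l ^ 2 = l := by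
  unfold zeta Complex.sqrt
  simpa only [Nat.cast_ofNat] using Complex.cpow_nat_inv_pow (l : ℂ) (n := 2) (by norm_num)

lemma zeta_ne_zero {l : ℝ} (hl : l ≠ 0) : zeta l ≠ 0 := by
  intro h
  have := zeta_sq l
  rw [h] at this
  simp at this
  exact hl (ofReal_eq_zero.1 this.symm)

lemma I_mul_sq_eq {ζ : ℂ} {l : ℝ} (hζ : ζ ^ 2 = l) : (I * ζ) ^ 2 = ((-l : ℝ) : ℂ) := by
  rw [mul_pow, I_sq, hζ]; simp

lemma aCoef_ne_zero_of_nonneg {q r : 𝓢(ℝ, ℂ)} (h : NoBoundStates q r) (h' : NoRealPoles q r) :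
    (∀ l : ℂ, 0 ≤ l.im → aCoef q r l ≠ 0) ∧
      ∀ l : ℂ, 0 ≤ l.im → aCoef (rot r) (rot q) l ≠ 0 := by
  refine ⟨fun l hl => ?_, fun l hl => ?_⟩
  · rcases hl.eq_or_lt with h0 | h0
    · obtain ⟨x, rfl⟩ : ∃ x : ℝ, (x : ℂ) = l := ⟨l.re, by apply Complex.ext <;> simp [← h0]⟩
      have := (h' x).1
      rwa [invT_eq q r (zeta_sq x)] at this
    · exact aCoef_ne_zero h h0
  · rcases hl.eq_or_lt with h0 | h0
    -- The barred coefficient at `x` is that of the interchanged potentials at `-x`.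
    · obtain ⟨x, rfl⟩ : ∃ x : ℝ, ((-x : ℝ) : ℂ) = l :=
        ⟨-l.re, by apply Complex.ext <;> simp [← h0]⟩
      have := (h' x).2
      rwa [invTBar_eq q r (zeta_sq x), invT_eq _ _ (I_mul_sq_eq (zeta_sq x))] at this
    · exact aCoef_ne_zero h.rotate h0

/-! ### Fourier integrals of dominated functions -/

section fourier

variable {f k : ℝ → ℂ} {C M : ℝ}

lemma integrable_mul_exp (hf : Integrable f) (y : ℝ) :
    Integrable fun l : ℝ => f l * exp (I * l * y) :=
  hf.mul_bdd (c := 1) (Continuous.aestronglyMeasurable (by fun_prop))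
    (Eventually.of_forall fun l => (norm_exp_I_mul_ofReal l y).le)

lemma norm_integral_mul_exp_le (f : ℝ → ℂ) (y : ℝ) :
    ‖∫ l : ℝ, f l * exp (I * l * y)‖ ≤ ∫ l, ‖f l‖ := by
  refine (norm_integral_le_integral_norm _).trans_eq ?_
  simp [norm_exp_I_mul_ofReal]

lemma continuous_integral_mul_exp (hf : Integrable f) :
    Continuous fun y : ℝ => ∫ l : ℝ, f l * exp (I * l * y) := by
  refine continuous_of_dominated (bound := fun l => ‖f l‖)
    (fun y => (integrable_mul_exp hf y).aestronglyMeasurable)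
    (fun y => Eventually.of_forall fun l => ?_) hf.norm
    (Eventually.of_forall fun l => by fun_prop)
  rw [norm_mul, norm_exp_I_mul_ofReal, mul_one]

lemma hasDerivAt_integral_mul_exp (hf : Integrable f) (hf' : Integrable fun l : ℝ => l * f l)
    (y : ℝ) : HasDerivAt (fun y : ℝ => ∫ l : ℝ, f l * exp (I * l * y))
      (∫ l : ℝ, I * (l * f l) * exp (I * l * y)) y := by
  refine (hasDerivAt_integral_of_dominated_loc_of_deriv_le (bound := fun l => ‖l * f l‖)
    (F' := fun y l => I * (l * f l) * exp (I * l * y))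
    (s := Set.univ) Filter.univ_mem
    (Eventually.of_forall fun z => (integrable_mul_exp hf z).aestronglyMeasurable)
    (integrable_mul_exp hf y) (integrable_mul_exp (hf'.const_mul I) y).aestronglyMeasurable
    (Eventually.of_forall fun l z _ => ?_) hf'.norm (Eventually.of_forall fun l z _ => ?_)).2
  · rw [norm_mul, norm_exp_I_mul_ofReal, mul_one, norm_mul, norm_I, one_mul]
  · exact ((hasDerivAt_exp_I l z).const_mul (f l)).congr_deriv (by ring)

lemma integrable_mul_ft (hf : Integrable f) (hk : Continuous k) (hM0 : 0 ≤ M)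
    (hM : ∀ t, 0 ≤ t → ‖k t‖ ≤ M * wt t) : Integrable fun l : ℝ => f l * ft k l :=
  hf.mul_bdd (c := M * Real.pi)
    ((continuousOn_ft hk hM).comp_continuous continuous_ofReal
      fun x => by simp).aestronglyMeasurable
    (Eventually.of_forall fun l => norm_ft_le hM0 hM (by simp))

/-- Fubini: multiplication by a half-line transform becomes an integral of translates in `y`, the
origin of the `z`-integrals in the Marchenko system. -/
lemma integral_mul_ft_mul_exp (hf : Integrable f) (hk : Continuous k)
    (hM : ∀ t, 0 ≤ t → ‖k t‖ ≤ M * wt t) (y : ℝ) :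
    ∫ l : ℝ, f l * ft k l * exp (I * l * y) =
      ∫ t in Set.Ioi (0 : ℝ), k t * ∫ l : ℝ, f l * exp (I * l * (y + t : ℝ)) := by
  have hkI : IntegrableOn k (Set.Ioi 0) := by
    simpa using integrableOn_ft hk hM (l := 0) (by simp)
  have hprod : Integrable (Function.uncurry fun (l t : ℝ) =>
      f l * exp (I * l * y) * (k t * exp (I * l * t)))
      (volume.prod (volume.restrict (Set.Ioi 0))) := by
    have h1 := (integrable_mul_exp hf y).mul_prod hkI
    have h2 : Continuous fun z : ℝ × ℝ => exp (I * z.1 * z.2) := by fun_prop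
    refine (h1.mul_bdd (c := 1) h2.aestronglyMeasurable
      (Eventually.of_forall fun z => (norm_exp_I_mul_ofReal z.1 z.2).le)).congr
      (Eventually.of_forall fun z => ?_)
    simp only [Function.uncurry_def]
    ring
  calc _ = ∫ l : ℝ, ∫ t in Set.Ioi (0 : ℝ), f l * exp (I * l * y) * (k t * exp (I * l * t)) := by
        refine integral_congr_ae (Eventually.of_forall fun l => ?_)
        simp only
        rw [integral_const_mul, ← ft]
        ring
    _ = ∫ t in Set.Ioi (0 : ℝ), ∫ l : ℝ, f l * exp (I * l * y) * (k t * exp (I * l * t)) :=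
        integral_integral_swap hprod
    _ = _ := by
        refine integral_congr_ae (Eventually.of_forall fun t => ?_)
        simp only
        rw [← integral_const_mul]
        refine integral_congr_ae (Eventually.of_forall fun l => ?_)
        simp only
        have : exp (I * l * (y + t : ℝ)) = exp (I * l * y) * exp (I * l * t) := by
          rw [← Complex.exp_add]; push_cast; ring_nf
        rw [this]
        ring

end fourier

/-! ### The reflection coefficient -/

/-- `R / ζ` as a function of real `λ`. -/
def refCoef (q r : 𝓢(ℝ, ℂ)) (l : ℝ) : ℂ := bCoef q r l / aCoef q r l

/-- The Fourier transform of `R / ζ`. -/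
def refHat (q r : 𝓢(ℝ, ℂ)) (y : ℝ) : ℂ :=
  1 / (2 * Real.pi) * ∫ l : ℝ, refCoef q r l * exp (I * l * y)

/-- The derivative of the Fourier transform of `R / ζ`. -/
def refHatDeriv (q r : 𝓢(ℝ, ℂ)) (y : ℝ) : ℂ :=
  1 / (2 * Real.pi) * ∫ l : ℝ, I * (l * refCoef q r l) * exp (I * l * y)

section refCoef

variable {q r : 𝓢(ℝ, ℂ)} (ha : ∀ l : ℂ, 0 ≤ l.im → aCoef q r l ≠ 0)
include ha

lemma continuous_refCoef : Continuous (refCoef q r) :=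
  (continuous_bCoef q r).div
    ((continuousOn_aCoef q r).comp_continuous continuous_ofReal fun x => by simp)
    fun l => ha l (by simp)

/-- The factor `1/a` is bounded; `b` is bounded on `[-1, 1]` by continuity and beyond by the `λ⁻³`
estimate. The extra power of `λ` is what makes the Fourier transform differentiable. -/
lemma exists_refCoef_bound : ∃ C, ∀ l : ℝ,
    ‖refCoef q r l‖ ≤ C * wt l ∧ ‖l * refCoef q r l‖ ≤ C * wt l := by
  obtain ⟨M, hM0, hM⟩ := exists_inv_aCoef_bound q r ha
  obtain ⟨K, hK0, hK⟩ := norm_pow_three_mul_bCoef_le q r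
  obtain ⟨N, hN⟩ := (isCompact_Icc (a := (-1 : ℝ)) (b := 1)).exists_bound_of_continuousOn
    (continuous_bCoef q r).continuousOn
  have hN0 : 0 ≤ N := (norm_nonneg _).trans (hN 0 (by norm_num))
  have key : ∀ l : ℝ, (1 + l ^ 2) * ‖bCoef q r l‖ ≤ 2 * (N + K) ∧
      (1 + l ^ 2) * (|l| * ‖bCoef q r l‖) ≤ 2 * (N + K) := by
    intro l
    have h1 := hK l
    rw [norm_mul, norm_pow, norm_real, Real.norm_eq_abs] at h1
    have hb := norm_nonneg (bCoef q r l)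
    have hl := abs_nonneg l
    rw [← sq_abs l]
    by_cases h : |l| ≤ 1
    · have h2 := hN l (abs_le.1 h)
      have h3 : 1 + |l| ^ 2 ≤ 2 := by nlinarith
      have h4 : (1 + |l| ^ 2) * ‖bCoef q r l‖ ≤ 2 * (N + K) := by nlinarith
      refine ⟨h4, ?_⟩
      calc _ = |l| * ((1 + |l| ^ 2) * ‖bCoef q r l‖) := by ring
        _ ≤ 1 * (2 * (N + K)) := by gcongr
        _ = _ := one_mul _
    · push Not at h
      have h3 : 1 + |l| ^ 2 ≤ 2 * |l| ^ 2 := by nlinarith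
      have h4 : (1 + |l| ^ 2) * (|l| * ‖bCoef q r l‖) ≤ 2 * (N + K) := by
        calc _ ≤ 2 * |l| ^ 2 * (|l| * ‖bCoef q r l‖) := by gcongr
          _ = 2 * (|l| ^ 3 * ‖bCoef q r l‖) := by ring
          _ ≤ _ := by linarith
      refine ⟨?_, h4⟩
      refine le_trans ?_ h4
      gcongr
      exact le_mul_of_one_le_left hb h.le
  have div_bound : ∀ (l : ℝ) (c : ℂ), (1 + l ^ 2) * ‖c‖ ≤ 2 * (N + K) →
      ‖c * (aCoef q r l)⁻¹‖ ≤ 2 * (N + K) * M * wt l := by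
    intro l c hc
    have hw := wt_pos l
    rw [norm_mul]
    calc _ ≤ ‖c‖ * M := by gcongr; exact hM l (by simp)
      _ = (wt l * (1 + l ^ 2)) * ‖c‖ * M := by rw [wt_mul, one_mul]
      _ = wt l * M * ((1 + l ^ 2) * ‖c‖) := by ring
      _ ≤ wt l * M * (2 * (N + K)) := by gcongr
      _ = _ := by ring
  refine ⟨2 * (N + K) * M, fun l => ⟨div_bound l _ (key l).1, ?_⟩⟩
  have h := div_bound l (l * bCoef q r l)
    (by rw [norm_mul, norm_real, Real.norm_eq_abs]; exact (key l).2)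
  rwa [mul_assoc, ← div_eq_mul_inv] at h

lemma integrable_refCoef : Integrable (refCoef q r) := by
  obtain ⟨C, hC⟩ := exists_refCoef_bound ha
  exact integrable_of_le_wt (continuous_refCoef ha) fun l => (hC l).1

lemma integrable_mul_refCoef : Integrable fun l : ℝ => l * refCoef q r l := by
  obtain ⟨C, hC⟩ := exists_refCoef_bound ha
  exact integrable_of_le_wt (continuous_ofReal.mul (continuous_refCoef ha)) fun l => (hC l).2

lemma hasDerivAt_refHat (y : ℝ) : HasDerivAt (refHat q r) (refHatDeriv q r y) y :=
  (hasDerivAt_integral_mul_exp (integrable_refCoef ha) (integrable_mul_refCoef ha) y).const_mul _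

lemma continuous_refHatDeriv : Continuous (refHatDeriv q r) :=
  continuous_const.mul (continuous_integral_mul_exp ((integrable_mul_refCoef ha).const_mul I))

omit ha in
lemma exists_refHat_bound (q r : 𝓢(ℝ, ℂ)) : ∃ K, ∀ y, ‖refHat q r y‖ ≤ K :=
  ⟨_, fun y => (norm_mul_le _ _).trans
    (mul_le_mul_of_nonneg_left (norm_integral_mul_exp_le _ y) (norm_nonneg _))⟩

omit ha in
lemma exists_refHatDeriv_bound (q r : 𝓢(ℝ, ℂ)) : ∃ K, ∀ y, ‖refHatDeriv q r y‖ ≤ K :=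
  ⟨_, fun y => (norm_mul_le _ _).trans
    (mul_le_mul_of_nonneg_left (norm_integral_mul_exp_le _ y) (norm_nonneg _))⟩

/-! ### The Marchenko equations for the kernels -/

/-- The `φ₂` side of the scattering relation: analytic above the real axis since `a` has no zeros,
and `O(1/λ)` since `A` is. -/
lemma hasImproperIntegral_jostA_div (x : ℝ) {τ : ℝ} (hτ : 0 < τ) : HasImproperIntegral
    (fun l : ℝ => jostA (refl r) (refl q) l x / aCoef q r l * exp (I * l * τ)) 0 := by
  obtain ⟨M, hM0, hM⟩ := exists_inv_aCoef_bound q r ha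
  obtain ⟨K, hK⟩ := exists_jostA_bound (refl r) (refl q) x
  obtain ⟨K', c, hK'⟩ := exists_jostA_asymptotic (refl r) (refl q) x
  refine hasImproperIntegral_jordan (G := fun l => jostA (refl r) (refl q) l x / aCoef q r l)
    ((continuousOn_jostA _ _ x).div (continuousOn_aCoef q r) ha)
    ((differentiableOn_jostA _ _ x).div (differentiableOn_aCoef q r) fun l hl => ha l (le_of_lt hl))
    (K := (K + K') * M) (fun l hl => ?_) hτ
  have h1 := (hK' l hl).1
  rw [norm_mul] at h1
  have h2 := hK l hl
  rw [div_eq_mul_inv, norm_mul, ← mul_assoc]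
  refine mul_le_mul (by linarith) (hM l hl) (norm_nonneg _) ?_
  exact add_nonneg ((norm_nonneg _).trans h2) ((by positivity : (0 : ℝ) ≤ _).trans h1)

/-- The `φ₁` side of the relation. Both `B` and `a` tend to `1`, so this `1` must be subtracted
before Jordan's lemma applies. -/
lemma hasImproperIntegral_jostB_div (x : ℝ) {τ : ℝ} (hτ : 0 < τ) : HasImproperIntegral
    (fun l : ℝ => (jostB (refl r) (refl q) l x / aCoef q r l - 1) * exp (I * l * τ)) 0 := by
  obtain ⟨M, hM0, hM⟩ := exists_inv_aCoef_bound q r ha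
  obtain ⟨N, hN0, hN⟩ := norm_mul_aCoef_sub_one_le q r
  obtain ⟨K, hK0, hK⟩ := exists_jostB_bound (refl r) (refl q) x
  obtain ⟨K', c, hK'⟩ := exists_jostB_asymptotic (refl r) (refl q) x
  refine hasImproperIntegral_jordan (G := fun l => jostB (refl r) (refl q) l x / aCoef q r l - 1)
    (((continuousOn_jostB _ _ x).div (continuousOn_aCoef q r) ha).sub continuousOn_const)
    (((differentiableOn_jostB _ _ x).div (differentiableOn_aCoef q r)
      fun l hl => ha l (le_of_lt hl)).sub_const 1)
    (K := K * M + 1 + (K' + N) * M) (fun l hl => ?_) hτ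
  have hne := ha l hl
  have h1 : ‖jostB (refl r) (refl q) l x / aCoef q r l - 1‖ ≤ K * M + 1 := by
    refine (norm_sub_le _ _).trans (add_le_add ?_ (by simp))
    rw [div_eq_mul_inv, norm_mul]
    exact mul_le_mul (hK l hl) (hM l hl) (norm_nonneg _) hK0
  have h2 : ‖l‖ * ‖jostB (refl r) (refl q) l x / aCoef q r l - 1‖ ≤ (K' + N) * M := by
    have e : l * (jostB (refl r) (refl q) l x / aCoef q r l - 1) =
        (l * (jostB (refl r) (refl q) l x - 1) - l * (aCoef q r l - 1)) * (aCoef q r l)⁻¹ := by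
      field_simp
      ring
    rw [← norm_mul, e, norm_mul]
    refine mul_le_mul ((norm_sub_le _ _).trans (add_le_add (hK' l hl).1 (hN l hl))) (hM l hl)
      (norm_nonneg _) (add_nonneg ((norm_nonneg _).trans (hK' l hl).1) hN0)
  rw [add_mul, one_mul]
  exact add_le_add h1 h2

omit ha in
lemma hasImproperIntegral_kernelA (q r : 𝓢(ℝ, ℂ)) (x : ℝ) {τ : ℝ} (hτ : 0 < τ) :
    HasImproperIntegral (fun l : ℝ => jostA q r l x * exp (-I * l * τ))
      (2 * Real.pi * kernelA q r x τ) := by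
  obtain ⟨C, hC0, hC⟩ := exists_kernelA_bound q r x
  obtain ⟨K, c, hK⟩ := exists_jostA_asymptotic q r x
  exact hasImproperIntegral_ft_inversion (continuous_kernelA q r x) hC0
    (wt_bound_of_pow hC0 (by norm_num) hC) (fun l => (hK l (by simp)).2) hτ

omit ha in
lemma hasImproperIntegral_kernelB (q r : 𝓢(ℝ, ℂ)) (x : ℝ) {τ : ℝ} (hτ : 0 < τ) :
    HasImproperIntegral (fun l : ℝ => (jostB q r l x - 1) * exp (-I * l * τ))
      (2 * Real.pi * kernelB q r (x, τ)) := by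
  obtain ⟨C, hC0, hC⟩ := exists_kernelB_bound q r x
  obtain ⟨K, c, hK⟩ := exists_jostB_asymptotic q r x
  have e : ∀ l, jostB q r l x - 1 = ft (fun t => kernelB q r (x, t)) l := fun l => by
    simp [jostB, amplB]
  simp only [e] at hK ⊢
  exact hasImproperIntegral_ft_inversion (continuous_kernelB q r x) hC0
    (wt_bound_of_pow hC0 (by norm_num) hC) (fun l => (hK l (by simp)).2) hτ

omit ha in
lemma hasImproperIntegral_kernelA_neg (q r : 𝓢(ℝ, ℂ)) (x : ℝ) {τ : ℝ} (hτ : 0 < τ) :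
    HasImproperIntegral (fun l : ℝ => jostA q r (-l) x * exp (I * l * τ))
      (2 * Real.pi * kernelA q r x τ) := by
  simpa using (hasImproperIntegral_kernelA q r x hτ).comp_neg

omit ha in
lemma hasImproperIntegral_kernelB_neg (q r : 𝓢(ℝ, ℂ)) (x : ℝ) {τ : ℝ} (hτ : 0 < τ) :
    HasImproperIntegral (fun l : ℝ => (jostB q r (-l) x - 1) * exp (I * l * τ))
      (2 * Real.pi * kernelB q r (x, τ)) := by
  simpa using (hasImproperIntegral_kernelB q r x hτ).comp_neg

omit ha in
-- Discards the point `λ = 0`, where the divisions by `ζ` carry no information.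
lemma ae_ne_zero : ∀ᵐ l : ℝ, l ≠ 0 := by
  simp [ae_iff]

/-- The second identity of `jost_relation` divided by `a`, integrated against `e^{iλτ}`: one side is
zero by Jordan's lemma. On the other, `B = 1 + ft b` gives the transform of `R/ζ` alone and then
averaged against `b`. -/
lemma marchenko_kernelA (x : ℝ) {τ : ℝ} (hτ : 0 < τ) :
    I * kernelA (rot r) (rot q) x τ + refHat q r (2 * x + τ) +
      ∫ t in Set.Ioi (0 : ℝ), kernelB q r (x, t) * refHat q r (2 * x + τ + t) = 0 := by
  obtain ⟨C, hC0, hC⟩ := exists_kernelB_bound q r x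
  have hC' := wt_bound_of_pow hC0 (by norm_num) hC
  have hρ := integrable_refCoef ha
  have h1 := (hasImproperIntegral_kernelA_neg (rot r) (rot q) x hτ).const_mul I
  have h2 := HasImproperIntegral.of_integrable (integrable_mul_exp hρ (2 * x + τ))
  have h3 := HasImproperIntegral.of_integrable (integrable_mul_exp
    (integrable_mul_ft hρ (continuous_kernelB q r x) hC0 hC') (2 * x + τ))
  have h4 := hasImproperIntegral_jostA_div ha (-x) hτ
  rw [integral_mul_ft_mul_exp hρ (continuous_kernelB q r x) hC'] at h3
  have h5 := h4.unique (((h1.add h2).add h3).congr_ae ?_)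
  · simp only [refHat]
    have hpi : (Real.pi : ℂ) ≠ 0 := ofReal_ne_zero.2 Real.pi_ne_zero
    have e : ∀ t : ℝ, kernelB q r (x, t) * (1 / (2 * Real.pi) *
        ∫ l : ℝ, refCoef q r l * exp (I * l * (2 * x + τ + t : ℝ))) = 1 / (2 * Real.pi) *
        (kernelB q r (x, t) * ∫ l : ℝ, refCoef q r l * exp (I * l * (2 * x + τ + t : ℝ))) :=
      fun t => by ring
    simp only [e]
    rw [integral_const_mul]
    linear_combination (-1 / (2 * Real.pi) : ℂ) * h5 +
      (-(I * kernelA (rot r) (rot q) x τ)) * (mul_inv_cancel₀ hpi)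
  · filter_upwards [ae_ne_zero] with l hl
    have h6 := (jost_relation q r l x).2 hl
    have hne := ha l (by simp)
    have e : exp (I * l * (2 * x + τ : ℝ)) = exp (2 * I * l * x) * exp (I * l * τ) := by
      rw [← Complex.exp_add]; push_cast; ring_nf
    have e2 : ft (fun t => kernelB q r (x, t)) l = jostB q r l x - 1 := by simp [jostB, amplB]
    rw [h6, e, e2, refCoef]
    generalize exp (2 * I * l * x) = E
    field_simp
    ring

/-- The first identity of `jost_relation` treated likewise. Its factor `λR/ζ` is `-i` times the
symbol of the derivative of the transform, and no free term appears because `A` is a pure half-line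
transform. -/
lemma marchenko_kernelB (x : ℝ) {τ : ℝ} (hτ : 0 < τ) :
    kernelB (rot r) (rot q) (x, τ) -
      I * ∫ t in Set.Ioi (0 : ℝ), kernelA q r x t * refHatDeriv q r (2 * x + τ + t) = 0 := by
  obtain ⟨C, hC0, hC⟩ := exists_kernelA_bound q r x
  have hC' := wt_bound_of_pow hC0 (by norm_num) hC
  have hρ := (integrable_mul_refCoef ha).const_mul I
  have h1 := hasImproperIntegral_kernelB_neg (rot r) (rot q) x hτ
  have h3 := (HasImproperIntegral.of_integrable (integrable_mul_exp
    (integrable_mul_ft hρ (continuous_kernelA q r x) hC0 hC') (2 * x + τ))).const_mul (-I)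
  have h4 := hasImproperIntegral_jostB_div ha (-x) hτ
  rw [integral_mul_ft_mul_exp hρ (continuous_kernelA q r x) hC'] at h3
  have h5 := h4.unique ((h1.add h3).congr_ae ?_)
  · simp only [refHatDeriv]
    have hpi : (Real.pi : ℂ) ≠ 0 := ofReal_ne_zero.2 Real.pi_ne_zero
    have e : ∀ t : ℝ, kernelA q r x t * (1 / (2 * Real.pi) *
        ∫ l : ℝ, I * (l * refCoef q r l) * exp (I * l * (2 * x + τ + t : ℝ))) =
        1 / (2 * Real.pi) * (kernelA q r x t *
          ∫ l : ℝ, I * (l * refCoef q r l) * exp (I * l * (2 * x + τ + t : ℝ))) :=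
      fun t => by ring
    simp only [e]
    rw [integral_const_mul]
    linear_combination (-1 / (2 * Real.pi) : ℂ) * h5 +
      (-kernelB (rot r) (rot q) (x, τ)) * (mul_inv_cancel₀ hpi)
  · refine Eventually.of_forall fun l => ?_
    have h6 := (jost_relation q r l x).1
    have hne := ha l (by simp)
    have e : exp (I * l * (2 * x + τ : ℝ)) = exp (2 * I * l * x) * exp (I * l * τ) := by
      rw [← Complex.exp_add]; push_cast; ring_nf
    have e2 : ft (kernelA q r x) l = jostA q r l x := rfl
    simp only
    rw [h6, e, e2, refCoef]
    generalize exp (2 * I * l * x) = E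
    field_simp
    linear_combination (-(l * bCoef q r l * jostA q r l x * E)) * I_sq

end refCoef

/-! ### Applying the component interchange twice -/

section rotate

variable (q r : 𝓢(ℝ, ℂ))

/-- Two interchanges change the sign of both potentials, which is undone by changing the sign of the
first component. -/
lemma isJostPsi_rot_rot {ζ : ℂ} {w : ℝ → Fin 2 → ℂ} (h : IsJostPsi q r ζ w) :
    IsJostPsi (rot (rot q)) (rot (rot r)) ζ (fun x => ![-w x 0, w x 1]) := by
  obtain ⟨hs, h0, h1⟩ := h
  rw [isSolution_iff] at hs
  refine ⟨isSolution_iff.2 ⟨fun x => ?_, fun x => ?_⟩, by simpa using h0.neg, h1⟩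
  · refine (hs.1 x).neg.congr_deriv ?_
    simp only [rot_apply, Matrix.cons_val_zero, Matrix.cons_val_one]
    linear_combination (-(ζ * q x * w x 1) + I / 2 * (q x * r x) * w x 0 * (1 - I ^ 2)) * I_sq
  · refine (hs.2 x).congr_deriv ?_
    simp only [rot_apply, Matrix.cons_val_zero, Matrix.cons_val_one]
    linear_combination (ζ * r x * w x 0 + I / 2 * (q x * r x) * w x 1 * (1 - I ^ 2)) * I_sq

lemma jost_rot_rot (l : ℝ) (x : ℝ) :
    (l ≠ 0 → jostA (rot (rot q)) (rot (rot r)) l x = -jostA q r l x) ∧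
      jostB (rot (rot q)) (rot (rot r)) l x = jostB q r l x := by
  have hζ := zeta_sq l
  have h := (isJostPsi_psiSol (rot (rot q)) (rot (rot r)) hζ).unique hζ
    (isJostPsi_rot_rot q r (isJostPsi_psiSol q r hζ))
  have h0 := congrFun (congrFun h x) 0
  have h1 := congrFun (congrFun h x) 1
  simp only [psiSol_zero, psiSol_one, hζ, Matrix.cons_val_zero, Matrix.cons_val_one,
    ← mul_neg] at h0 h1
  refine ⟨fun hl => ?_, mul_left_cancel₀ (Complex.exp_ne_zero _) h1⟩
  exact mul_left_cancel₀ (zeta_ne_zero hl) (mul_left_cancel₀ (Complex.exp_ne_zero _) h0)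

lemma two_pi_ne_zero' : (2 * Real.pi : ℂ) ≠ 0 :=
  mul_ne_zero two_ne_zero (ofReal_ne_zero.2 Real.pi_ne_zero)

/-- The kernels are chosen from existence statements, so they are compared through their transforms;
inversion recovers them for `τ > 0`, which is all that is used. -/
lemma kernelA_rot_rot (x : ℝ) {τ : ℝ} (hτ : 0 < τ) :
    kernelA (rot (rot q)) (rot (rot r)) x τ = -kernelA q r x τ := by
  have h := (hasImproperIntegral_kernelA (rot (rot q)) (rot (rot r)) x hτ).unique
    (((hasImproperIntegral_kernelA q r x hτ).const_mul (-1)).congr_ae ?_)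
  · exact mul_left_cancel₀ two_pi_ne_zero' (by rw [h]; ring)
  · filter_upwards [ae_ne_zero] with l hl
    rw [(jost_rot_rot q r l x).1 hl]
    ring

lemma kernelB_rot_rot (x : ℝ) {τ : ℝ} (hτ : 0 < τ) :
    kernelB (rot (rot q)) (rot (rot r)) (x, τ) = kernelB q r (x, τ) := by
  have h := (hasImproperIntegral_kernelB (rot (rot q)) (rot (rot r)) x hτ).unique
    ((hasImproperIntegral_kernelB q r x hτ).congr_ae (Eventually.of_forall fun l => by
      simp only [(jost_rot_rot q r l x).2]))
  exact mul_left_cancel₀ two_pi_ne_zero' h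

/-! ### Identification of the Marchenko kernels -/

variable {x y : ℝ} (hxy : x < y)
include hxy

lemma hasImproperIntegral_integrandK1 :
    HasImproperIntegral (integrandK1 q r x y) (2 * Real.pi * kernelA q r x (y - x)) := by
  refine (hasImproperIntegral_kernelA q r x (sub_pos.2 hxy)).congr_ae ?_
  filter_upwards [ae_ne_zero] with l hl
  have hz := zeta_ne_zero hl
  have e : exp (-I * l * (y - x : ℝ)) = exp (I * l * x) * exp (-I * l * y) := by
    rw [← Complex.exp_add]; push_cast; ring_nf
  rw [integrandK1, psi_eq q r (zeta_sq l), psiSol_zero, zeta_sq, e]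
  field_simp

lemma hasImproperIntegral_integrandK2 :
    HasImproperIntegral (integrandK2 q r x y) (2 * Real.pi * kernelB q r (x, y - x)) := by
  refine (hasImproperIntegral_kernelB q r x (sub_pos.2 hxy)).congr_ae
    (Eventually.of_forall fun l => ?_)
  have e : exp (-I * l * (y - x : ℝ)) = exp (I * l * x) * exp (-I * l * y) := by
    rw [← Complex.exp_add]; push_cast; ring_nf
  simp only
  rw [integrandK2, psi_eq q r (zeta_sq l), psiSol_one, zeta_sq, e]
  ring

lemma hasImproperIntegral_integrandK1Bar : HasImproperIntegral (integrandK1Bar q r x y)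
    (2 * Real.pi * kernelB (rot r) (rot q) (x, y - x)) := by
  refine (hasImproperIntegral_kernelB_neg (rot r) (rot q) x (sub_pos.2 hxy)).congr_ae
    (Eventually.of_forall fun l => ?_)
  have e : exp (I * l * (y - x : ℝ)) = exp (-I * l * x) * exp (I * l * y) := by
    rw [← Complex.exp_add]; push_cast; ring_nf
  simp only
  rw [integrandK1Bar, psiBar_eq q r (zeta_sq l), swapVec_zero, psiSol_one,
    I_mul_sq_eq (zeta_sq l), e]
  push_cast
  ring_nf

lemma hasImproperIntegral_integrandK2Bar : HasImproperIntegral (integrandK2Bar q r x y)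
    (2 * Real.pi * (I * kernelA (rot r) (rot q) x (y - x))) := by
  have h := ((hasImproperIntegral_kernelA_neg (rot r) (rot q) x (sub_pos.2 hxy)).const_mul I)
  rw [mul_left_comm] at h
  refine h.congr_ae ?_
  filter_upwards [ae_ne_zero] with l hl
  have hz := zeta_ne_zero hl
  have e : exp (I * l * (y - x : ℝ)) = exp (I * (-l : ℝ) * x) * exp (I * l * y) := by
    rw [← Complex.exp_add]; push_cast; ring_nf
  rw [integrandK2Bar, psiBar_eq q r (zeta_sq l), swapVec_one, psiSol_zero,
    I_mul_sq_eq (zeta_sq l), e]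
  push_cast
  field_simp

lemma K1_eq : K1 q r x y = kernelA q r x (y - x) := by
  rw [K1, (hasImproperIntegral_integrandK1 q r hxy).improperIntegral_eq, ← mul_assoc,
    one_div_mul_cancel two_pi_ne_zero', one_mul]

lemma K2_eq : K2 q r x y = kernelB q r (x, y - x) := by
  rw [K2, (hasImproperIntegral_integrandK2 q r hxy).improperIntegral_eq, ← mul_assoc,
    one_div_mul_cancel two_pi_ne_zero', one_mul]

lemma K1Bar_eq : K1Bar q r x y = kernelB (rot r) (rot q) (x, y - x) := by
  rw [K1Bar, (hasImproperIntegral_integrandK1Bar q r hxy).improperIntegral_eq, ← mul_assoc,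
    one_div_mul_cancel two_pi_ne_zero', one_mul]

lemma K2Bar_eq : K2Bar q r x y = I * kernelA (rot r) (rot q) x (y - x) := by
  rw [K2Bar, (hasImproperIntegral_integrandK2Bar q r hxy).improperIntegral_eq, ← mul_assoc,
    one_div_mul_cancel two_pi_ne_zero', one_mul]

end rotate

/-! ### Identification of the reflection coefficients -/

section reflection

variable (q r : 𝓢(ℝ, ℂ))

lemma R_div_zeta_eq {l : ℝ} (hl : l ≠ 0) : R q r (zeta l) / zeta l = refCoef q r l := by
  have hz := zeta_ne_zero hl
  rw [R, invT_eq q r (zeta_sq l), RdivT_eq q r (zeta_sq l), refCoef]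
  field_simp

lemma RBar_div_zeta_eq {l : ℝ} (hl : l ≠ 0) :
    RBar q r (zeta l) / zeta l = I * refCoef (rot r) (rot q) (-l) := by
  have hz := zeta_ne_zero hl
  have h := I_mul_sq_eq (zeta_sq l)
  rw [RBar, invTBar_eq q r (zeta_sq l), RBarDivTBar_eq q r (zeta_sq l), invT_eq _ _ h,
    RdivT_eq _ _ h, refCoef]
  field_simp

lemma RHat_eq : RHat q r = refHat q r := by
  ext y
  unfold RHat refHat
  congr 1
  refine integral_congr_ae ?_
  filter_upwards [ae_ne_zero] with l hl
  rw [R_div_zeta_eq q r hl]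

/-- The substitution `λ ↦ -λ` turns `e^{-iλy}` into `e^{iλy}` and matches the sign reversal of `λ`
under the component interchange. -/
lemma RBarHat_eq (y : ℝ) : RBarHat q r y = I * refHat (rot r) (rot q) y := by
  unfold RBarHat refHat
  rw [mul_left_comm]
  congr 1
  rw [← integral_const_mul,
    ← integral_neg_eq_self (fun l : ℝ => RBar q r (zeta l) / zeta l * exp (-I * l * y)) volume]
  refine integral_congr_ae ?_
  filter_upwards [ae_ne_zero] with l hl
  rw [RBar_div_zeta_eq q r (neg_ne_zero.2 hl), neg_neg, mul_assoc]
  push_cast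
  ring_nf

end reflection

/-! ### Integrals over the half-line -/

section halfline

variable {k g : ℝ → ℂ} {C K : ℝ}

lemma integrableOn_mul_comp_add (hk : Continuous k) (hC : ∀ t, 0 ≤ t → ‖k t‖ ≤ C * wt t)
    (hg : Continuous g) (hK : ∀ t, ‖g t‖ ≤ K) (x y : ℝ) :
    IntegrableOn (fun z => k (z - x) * g (z + y)) (Set.Ioi x) := by
  have h : IntegrableOn (fun z => k (z - x)) (Set.Ioi x) := by
    refine ((integrable_wt.comp_sub_right x).const_mul C).integrableOn.mono'
      (Continuous.aestronglyMeasurable (by fun_prop))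
      ((ae_restrict_iff' measurableSet_Ioi).2 (Eventually.of_forall fun z hz => ?_))
    exact hC _ (sub_nonneg.2 (le_of_lt hz))
  exact h.mul_bdd (c := K) (Continuous.aestronglyMeasurable (by fun_prop))
    (Eventually.of_forall fun z => hK _)

lemma setIntegral_Ioi_mul_comp_add (k g : ℝ → ℂ) (x y : ℝ) :
    ∫ z in Set.Ioi x, k (z - x) * g (z + y) =
      ∫ t in Set.Ioi (0 : ℝ), k t * g (2 * x + (y - x) + t) := by
  have h := (measurePreserving_add_right volume x).setIntegral_preimage_emb
    (measurableEmbedding_addRight x) (fun z => k (z - x) * g (z + y)) (Set.Ioi x)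
  rw [← h]
  simp only [Set.preimage_add_const_Ioi, sub_self, add_sub_cancel_right]
  refine integral_congr_ae (Eventually.of_forall fun t => ?_)
  simp only
  ring_nf

end halfline

end DNLS

end

/-! ### Assembly of the Marchenko system. -/

theorem theorem5p1 (q r : 𝓢(ℝ, ℂ)) (hbound : DNLS.NoBoundStates q r)
    (hreal : DNLS.NoRealPoles q r) :
    -- the Jost solutions and the scattering coefficients are well defined for real `λ = ζ²`
    (∀ l : ℝ, DNLS.ScatteringWellDefined q r (DNLS.zeta l)) ∧
    -- the Fourier transforms of the reflection coefficients converge and are differentiable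
    Integrable (fun l : ℝ => DNLS.R q r (DNLS.zeta l) / DNLS.zeta l) volume ∧
    Integrable (fun l : ℝ => DNLS.RBar q r (DNLS.zeta l) / DNLS.zeta l) volume ∧
    Differentiable ℝ (DNLS.RHat q r) ∧ Differentiable ℝ (DNLS.RBarHat q r) ∧
    ∀ x y : ℝ, x < y →
      -- the Fourier integrals of the Jost solutions converge
      DNLS.HasImproperIntegral (DNLS.integrandK1 q r x y)
        (DNLS.improperIntegral (DNLS.integrandK1 q r x y)) ∧
      DNLS.HasImproperIntegral (DNLS.integrandK2 q r x y)
        (DNLS.improperIntegral (DNLS.integrandK2 q r x y)) ∧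
      DNLS.HasImproperIntegral (DNLS.integrandK1Bar q r x y)
        (DNLS.improperIntegral (DNLS.integrandK1Bar q r x y)) ∧
      DNLS.HasImproperIntegral (DNLS.integrandK2Bar q r x y)
        (DNLS.improperIntegral (DNLS.integrandK2Bar q r x y)) ∧
      -- the integrals over `z` converge absolutely
      IntegrableOn (fun z => -I * DNLS.K1 q r x z * deriv (DNLS.RHat q r) (z + y))
        (Set.Ioi x) volume ∧
      IntegrableOn (fun z => DNLS.K1Bar q r x z * DNLS.RBarHat q r (z + y))
        (Set.Ioi x) volume ∧
      IntegrableOn (fun z => DNLS.K2 q r x z * DNLS.RHat q r (z + y))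
        (Set.Ioi x) volume ∧
      IntegrableOn (fun z => I * DNLS.K2Bar q r x z * deriv (DNLS.RBarHat q r) (z + y))
        (Set.Ioi x) volume ∧
      -- the Marchenko system
      (0 : Matrix (Fin 2) (Fin 2) ℂ) =
        !![DNLS.K1Bar q r x y, DNLS.K1 q r x y;
           DNLS.K2Bar q r x y, DNLS.K2 q r x y] +
        !![0, DNLS.RBarHat q r (x + y);
           DNLS.RHat q r (x + y), 0] +
        !![∫ z in Set.Ioi x, -I * DNLS.K1 q r x z * deriv (DNLS.RHat q r) (z + y),
           ∫ z in Set.Ioi x, DNLS.K1Bar q r x z * DNLS.RBarHat q r (z + y);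
           ∫ z in Set.Ioi x, DNLS.K2 q r x z * DNLS.RHat q r (z + y),
           ∫ z in Set.Ioi x, I * DNLS.K2Bar q r x z * deriv (DNLS.RBarHat q r) (z + y)] := by
  open DNLS in
  obtain ⟨ha, ha'⟩ := aCoef_ne_zero_of_nonneg hbound hreal
  have hR : RHat q r = refHat q r := RHat_eq q r
  have hRB : RBarHat q r = fun y => I * refHat (rot r) (rot q) y := funext (RBarHat_eq q r)
  have hdR : ∀ y, HasDerivAt (RHat q r) (refHatDeriv q r y) y := fun y => by
    rw [hR]; exact hasDerivAt_refHat ha y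
  have hdRB : ∀ y, HasDerivAt (RBarHat q r) (I * refHatDeriv (rot r) (rot q) y) y := fun y => by
    rw [hRB]; exact (hasDerivAt_refHat ha' y).const_mul I
  have hdR' : deriv (RHat q r) = refHatDeriv q r := funext fun y => (hdR y).deriv
  have hdRB' : deriv (RBarHat q r) = fun y => I * refHatDeriv (rot r) (rot q) y :=
    funext fun y => (hdRB y).deriv
  have hcR : Continuous (refHat q r) := continuous_iff_continuousAt.2 fun y =>
    (hasDerivAt_refHat ha y).continuousAt
  have hcRB : Continuous (refHat (rot r) (rot q)) := continuous_iff_continuousAt.2 fun y =>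
    (hasDerivAt_refHat ha' y).continuousAt
  refine ⟨fun l => scatteringWellDefined q r (zeta_sq l), ?_, ?_,
    fun y => (hdR y).differentiableAt, fun y => (hdRB y).differentiableAt, fun x y hxy => ?_⟩
  · refine (integrable_refCoef ha).congr ?_
    filter_upwards [ae_ne_zero] with l hl
    rw [R_div_zeta_eq q r hl]
  · refine ((integrable_refCoef ha').comp_neg.const_mul I).congr ?_
    filter_upwards [ae_ne_zero] with l hl
    rw [RBar_div_zeta_eq q r hl]
  obtain ⟨CA, hA0, hA⟩ := exists_kernelA_bound q r x
  obtain ⟨CB, hB0, hB⟩ := exists_kernelB_bound q r x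
  obtain ⟨CA', hA0', hA'⟩ := exists_kernelA_bound (rot r) (rot q) x
  obtain ⟨CB', hB0', hB'⟩ := exists_kernelB_bound (rot r) (rot q) x
  obtain ⟨M, hM⟩ := exists_refHat_bound q r
  obtain ⟨N, hN⟩ := exists_refHatDeriv_bound q r
  obtain ⟨M', hM'⟩ := exists_refHat_bound (rot r) (rot q)
  obtain ⟨N', hN'⟩ := exists_refHatDeriv_bound (rot r) (rot q)
  have i1 := (integrableOn_mul_comp_add (continuous_kernelA q r x)
    (wt_bound_of_pow hA0 (by norm_num) hA) (continuous_refHatDeriv ha) hN x y).const_mul (-I)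
  have i2 := (integrableOn_mul_comp_add (continuous_kernelB (rot r) (rot q) x)
    (wt_bound_of_pow hB0' (by norm_num) hB') hcRB hM' x y).const_mul I
  have i3 := integrableOn_mul_comp_add (continuous_kernelB q r x)
    (wt_bound_of_pow hB0 (by norm_num) hB) hcR hM x y
  have i4 := (integrableOn_mul_comp_add (continuous_kernelA (rot r) (rot q) x)
    (wt_bound_of_pow hA0' (by norm_num) hA') (continuous_refHatDeriv ha') hN' x y).const_mul (-I)
  have e1 : Set.EqOn (fun z => -I * (kernelA q r x (z - x) * refHatDeriv q r (z + y)))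
      (fun z => -I * K1 q r x z * deriv (RHat q r) (z + y)) (Set.Ioi x) := fun z hz => by
    simp only [K1_eq q r hz, hdR']
    ring
  have e2 : Set.EqOn
      (fun z => I * (kernelB (rot r) (rot q) (x, z - x) * refHat (rot r) (rot q) (z + y)))
      (fun z => K1Bar q r x z * RBarHat q r (z + y)) (Set.Ioi x) := fun z hz => by
    simp only [K1Bar_eq q r hz, hRB]
    ring
  have e3 : Set.EqOn (fun z => kernelB q r (x, z - x) * refHat q r (z + y))
      (fun z => K2 q r x z * RHat q r (z + y)) (Set.Ioi x) := fun z hz => by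
    simp only [K2_eq q r hz, hR]
  have e4 : Set.EqOn
      (fun z => -I * (kernelA (rot r) (rot q) x (z - x) * refHatDeriv (rot r) (rot q) (z + y)))
      (fun z => I * K2Bar q r x z * deriv (RBarHat q r) (z + y)) (Set.Ioi x) := fun z hz => by
    simp only [K2Bar_eq q r hz, hdRB']
    linear_combination (-I * kernelA (rot r) (rot q) x (z - x) *
      refHatDeriv (rot r) (rot q) (z + y)) * I_sq
  refine ⟨(hasImproperIntegral_integrandK1 q r hxy).self,
    (hasImproperIntegral_integrandK2 q r hxy).self,
    (hasImproperIntegral_integrandK1Bar q r hxy).self,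
    (hasImproperIntegral_integrandK2Bar q r hxy).self,
    IntegrableOn.congr_fun i1 e1 measurableSet_Ioi, IntegrableOn.congr_fun i2 e2 measurableSet_Ioi,
    IntegrableOn.congr_fun i3 e3 measurableSet_Ioi, IntegrableOn.congr_fun i4 e4 measurableSet_Ioi, ?_⟩
  have hτ := sub_pos.2 hxy
  -- `m1` and `m3`, for the original potentials, give the left column; `m2` and `m4`, for the
  -- interchanged ones, give the right column once the double interchange is removed from their
  -- kernels.
  have m1 := marchenko_kernelB ha x hτ
  have m2 := marchenko_kernelA ha' x hτ
  have m3 := marchenko_kernelA ha x hτ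
  have m4 := marchenko_kernelB ha' x hτ
  rw [kernelA_rot_rot q r x hτ] at m2
  rw [kernelB_rot_rot q r x hτ] at m4
  have hs : 2 * x + (y - x) = x + y := by ring
  rw [← setIntegral_congr_fun measurableSet_Ioi e1, ← setIntegral_congr_fun measurableSet_Ioi e2,
    ← setIntegral_congr_fun measurableSet_Ioi e3, ← setIntegral_congr_fun measurableSet_Ioi e4,
    integral_const_mul, integral_const_mul, integral_const_mul,
    setIntegral_Ioi_mul_comp_add (kernelA q r x),
    setIntegral_Ioi_mul_comp_add (fun t => kernelB (rot r) (rot q) (x, t)),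
    setIntegral_Ioi_mul_comp_add (fun t => kernelB q r (x, t)),
    setIntegral_Ioi_mul_comp_add (kernelA (rot r) (rot q) x),
    K1_eq q r hxy, K2_eq q r hxy, K1Bar_eq q r hxy, K2Bar_eq q r hxy, hR, hRB]
  rw [hs] at m1 m2 m3 m4 ⊢
  ext i j
  fin_cases i <;> fin_cases j <;> simp
  · linear_combination -m1
  · linear_combination (-I) * m2 - kernelA q r x (y - x) * I_sq
  · linear_combination -m3
  · linear_combination -m4
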